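/- Let $\Bbbk$ be a field. All (co)algebras are (co)associative and (co)unital over $\Bbbk$, and $\otimes=\otimes_\Bbbk$. **Definitions.** Let $H$ be a bialgebra. A *left $H$-module coalgebra* is a coalgebra $C$ with a left $H$-module structure such that $\Delta(hc)=h_{(1)}c_{(1)}\otimes h_{(2)}c_{(2)}$ and $\varepsilon(hc)=\varepsilon(h)\varepsilon(c)$ for all $h\in H$, $c\in C$. The category $\mathfrak M^H$ of right $H$-comodules is monoidal: the coaction on $X\otimes Y$ is $x\otimes y\mapsto x_{(0)}\otimes y_{(0)}\otimes x_{(1)}y_{(1)}$, and the unit object is $\Bbbk$ with the coaction $a\mapsto a\otimes 1$. If $C$ is a left $H$-module coalgebra, the category $\mathfrak M^C$ of right $C$-comodules is a left $\mathfrak M^H$-module category: $X\in\mathfrak M^H$ acts on $M\in\mathfrak M^C$ by $X\otimes M$ with the coaction $x\otimes m\mapsto x_{(0)}\otimes m_{(0)}\otimes x_{(1)}m_{(1)}$. An *equivalence* of left module categories $\mathcal M,\mathcal N$ over a monoidal category $\mathcal C$ is a lax left $\mathcal C$-module functor $F:\mathcal M\to\mathcal N$ (a functor with a natural, unital and associative,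 not necessarily invertible family of morphisms $X\otimes F(M)\to F(X\otimes M)$) for which there is a lax left $\mathcal C$-module functor $G:\mathcal N\to\mathcal M$ with $G\circ F\cong\mathrm{id}_{\mathcal M}$ and $F\circ G\cong\mathrm{id}_{\mathcal N}$ as lax left $\mathcal C$-module functors. Two left $H$-module coalgebras $C$ and $D$ are *$H$-Morita–Takeuchi equivalent* if $\mathfrak M^C$ and $\mathfrak M^D$ are equivalent as left $\mathfrak M^H$-module categories. Suppose that $H$ is finite-dimensional. The dual space $H^*$ is a bialgebra, with the convolution product $(f\star g)(h)=f(h_{(1)})g(h_{(2)})$, unit $\varepsilon_H$, comultiplication determined by $f_{(1)}(h)f_{(2)}(h')=f(hh')$, and counit $f\mapsto f(1)$. For a left $H$-module coalgebra $C$, let $c\mapsto c_{[0]}\otimes c_{[1]}\in C\otimes H^*$ be the right $H^*$-coaction determined by $hc=c_{[1]}(h)\,c_{[0]}$ for all $h\in H$. The *cosmash product* $H^*\#C$ is the free left $H^*$-module $H^*\otimes C$ with $$\Delta(f\otimes c)=\bigl(f_{(1)}\otimes (c_{(1)})_{[0]}\bigr)\otimes\bigl(f_{(2)}\star (c_{(1)})_{[1]}\otimes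 c_{(2)}\bigr),\qquad \varepsilon(f\otimes c)=f(1)\,\varepsilon(c);$$ it is a left $H^*$-module coalgebra. **Theorem.** Let $H$ be a finite-dimensional bialgebra over $\Bbbk$. Two left $H$-module coalgebras $C$ and $D$ are $H$-Morita–Takeuchi equivalent if and only if the left $H^*$-module coalgebras $H^*\#C$ and $H^*\#D$ are $H^*$-Morita–Takeuchi equivalent. -/

import Mathlib

open CategoryTheory MonoidalCategory TensorProduct

universe u

set_option linter.unusedSectionVars false

noncomputable section

namespace MoritaTakeuchi

section ModuleCoalgebra

variable (k H C : Type u) [Field k] [Ring H] [Bialgebra k H]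
  [AddCommGroup C] [Module k C] [Module H C] [IsScalarTower k H C]

/-- The action map `H ⊗ C → C`, `h ⊗ c ↦ h • c`. -/
def actionMap : H ⊗[k] C →ₗ[k] C :=
  TensorProduct.lift (Algebra.lsmul k k C).toLinearMap

@[simp]
lemma actionMap_tmul (h : H) (c : C) : actionMap k H C (h ⊗ₜ c) = h • c := rfl

/-- `C` is a left `H`-module coalgebra: it is a coalgebra and a left `H`-module such that
`Δ(h c) = h₍₁₎ c₍₁₎ ⊗ h₍₂₎ c₍₂₎` and `ε(h c) = ε(h) ε(c)`. -/
class IsModuleCoalgebra [Coalgebra k C] : Prop where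
  comul_smul (h : H) (c : C) : Coalgebra.comul (R := k) (h • c) =
    TensorProduct.map (actionMap k H C) (actionMap k H C)
      (TensorProduct.tensorTensorTensorComm k H H C C
        (Coalgebra.comul (R := k) h ⊗ₜ[k] Coalgebra.comul (R := k) c))
  counit_smul (h : H) (c : C) : Coalgebra.counit (R := k) (h • c) =
    Coalgebra.counit (R := k) h * Coalgebra.counit (R := k) c

end ModuleCoalgebra

/-- A bialgebra is a left module coalgebra over itself by left multiplication. -/
instance isModuleCoalgebra_self (k H : Type u) [Field k] [Ring H] [Bialgebra k H] :
    IsModuleCoalgebra k H H where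
  comul_smul h c := by
    rw [smul_eq_mul, Bialgebra.comul_mul]
    induction Coalgebra.comul (R := k) h with
    | zero => simp
    | add x y hx hy => simp only [add_mul, TensorProduct.add_tmul, map_add, hx, hy]
    | tmul a b =>
      induction Coalgebra.comul (R := k) c with
      | zero => simp
      | add x y hx hy => simp only [mul_add, TensorProduct.tmul_add, map_add, hx, hy]
      | tmul x y => simp
  counit_smul h c := by simp

/-- Right comodules over a coalgebra `C`. -/
structure Comod (k C : Type u) [Field k] [AddCommGroup C] [Module k C] [Coalgebra k C] where
  /-- The underlying vector space. -/
  carrier : Type u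
  [addCommGroup : AddCommGroup carrier]
  [module : Module k carrier]
  /-- The coaction `m ↦ m₍₀₎ ⊗ m₍₁₎`. -/
  coact : carrier →ₗ[k] carrier ⊗[k] C
  coassoc : (TensorProduct.assoc k carrier C C).toLinearMap ∘ₗ coact.rTensor C ∘ₗ coact =
    Coalgebra.comul.lTensor carrier ∘ₗ coact
  counit : (Coalgebra.counit (R := k)).lTensor carrier ∘ₗ coact =
    (TensorProduct.mk k carrier k).flip 1

attribute [instance] Comod.addCommGroup Comod.module

namespace Comod

section Basic

variable {k C : Type u} [Field k] [AddCommGroup C] [Module k C] [Coalgebra k C]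

/-- Morphisms of right comodules: colinear maps. -/
@[ext]
structure Hom (M N : Comod k C) where
  /-- The underlying linear map. -/
  lin : M.carrier →ₗ[k] N.carrier
  colinear : N.coact ∘ₗ lin = lin.rTensor C ∘ₗ M.coact

/-- The category of right `C`-comodules. -/
instance : Category (Comod k C) where
  Hom M N := Hom M N
  id M := ⟨LinearMap.id, by simp⟩
  comp f g := ⟨g.lin ∘ₗ f.lin, by
    rw [← LinearMap.comp_assoc, g.colinear, LinearMap.comp_assoc, f.colinear,
      ← LinearMap.comp_assoc, LinearMap.rTensor_comp]⟩

@[simp] lemma id_lin (M : Comod k C) : Hom.lin (𝟙 M) = LinearMap.id := rfl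

@[simp] lemma comp_lin {L M N : Comod k C} (f : L ⟶ M) (g : M ⟶ N) :
    Hom.lin (f ≫ g) = Hom.lin g ∘ₗ Hom.lin f := rfl

@[ext] lemma hom_ext {M N : Comod k C} {f g : M ⟶ N} (h : Hom.lin f = Hom.lin g) : f = g :=
  Hom.ext h

/-- A bijective colinear map is an isomorphism of comodules. -/
def isoMk {M N : Comod k C} (e : M.carrier ≃ₗ[k] N.carrier)
    (h : N.coact ∘ₗ e.toLinearMap = e.toLinearMap.rTensor C ∘ₗ M.coact) : M ≅ N where
  hom := ⟨e.toLinearMap, h⟩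
  inv := ⟨e.symm.toLinearMap, by
    have h2 : N.coact = e.toLinearMap.rTensor C ∘ₗ M.coact ∘ₗ e.symm.toLinearMap := by
      rw [← LinearMap.comp_assoc, ← h, LinearMap.comp_assoc]; simp
    rw [h2, ← LinearMap.comp_assoc, ← LinearMap.rTensor_comp]; simp⟩
  hom_inv_id := by ext x; simp
  inv_hom_id := by ext x; simp

@[simp] lemma isoMk_hom_lin {M N : Comod k C} (e : M.carrier ≃ₗ[k] N.carrier) (h) :
    Hom.lin (isoMk (M := M) (N := N) e h).hom = e.toLinearMap := rfl

@[simp] lemma isoMk_inv_lin {M N : Comod k C} (e : M.carrier ≃ₗ[k] N.carrier) (h) :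
    Hom.lin (isoMk (M := M) (N := N) e h).inv = e.symm.toLinearMap := rfl

end Basic

section Action

variable (k H C : Type u) [Field k] [Ring H] [Bialgebra k H]
  [AddCommGroup C] [Module k C] [Module H C] [IsScalarTower k H C]

/-- The map `(X ⊗ H) ⊗ (M ⊗ C) → (X ⊗ M) ⊗ C`, `(x ⊗ h) ⊗ (m ⊗ c) ↦ (x ⊗ m) ⊗ h c`. -/
def shuffle (X M : Type u) [AddCommGroup X] [Module k X] [AddCommGroup M] [Module k M] :
    (X ⊗[k] H) ⊗[k] (M ⊗[k] C) →ₗ[k] (X ⊗[k] M) ⊗[k] C :=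
  (actionMap k H C).lTensor (X ⊗[k] M) ∘ₗ
    (TensorProduct.tensorTensorTensorComm k X H M C).toLinearMap

@[simp] lemma shuffle_tmul (X M : Type u) [AddCommGroup X] [Module k X] [AddCommGroup M]
    [Module k M] (x : X) (h : H) (m : M) (c : C) :
    shuffle k H C X M ((x ⊗ₜ h) ⊗ₜ (m ⊗ₜ c)) = (x ⊗ₜ m) ⊗ₜ (h • c) := rfl

lemma shuffle_map {X M X' M' : Type u} [AddCommGroup X] [Module k X] [AddCommGroup M]
    [Module k M] [AddCommGroup X'] [Module k X'] [AddCommGroup M'] [Module k M']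
    (f : X →ₗ[k] X') (g : M →ₗ[k] M') :
    shuffle k H C X' M' ∘ₗ TensorProduct.map (f.rTensor H) (g.rTensor C) =
      (TensorProduct.map f g).rTensor C ∘ₗ shuffle k H C X M := by
  ext x h m c; simp

variable {k H C}

lemma shuffle_coassoc {X M : Type u} [AddCommGroup X] [Module k X] [AddCommGroup M] [Module k M]
    {ρ : X →ₗ[k] X ⊗[k] H} {σ : M →ₗ[k] M ⊗[k] C} {Δ : C →ₗ[k] C ⊗[k] C}
    (hρ : (TensorProduct.assoc k X H H).toLinearMap ∘ₗ ρ.rTensor H ∘ₗ ρ =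
      Coalgebra.comul.lTensor X ∘ₗ ρ)
    (hσ : (TensorProduct.assoc k M C C).toLinearMap ∘ₗ σ.rTensor C ∘ₗ σ = Δ.lTensor M ∘ₗ σ)
    (hΔ : ∀ (h : H) (c : C), Δ (h • c) =
      TensorProduct.map (actionMap k H C) (actionMap k H C)
        (TensorProduct.tensorTensorTensorComm k H H C C
          (Coalgebra.comul (R := k) h ⊗ₜ[k] Δ c))) :
    (TensorProduct.assoc k (X ⊗[k] M) C C).toLinearMap ∘ₗ
        (shuffle k H C X M ∘ₗ TensorProduct.map ρ σ).rTensor C ∘ₗ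
        (shuffle k H C X M ∘ₗ TensorProduct.map ρ σ) =
      Δ.lTensor (X ⊗[k] M) ∘ₗ (shuffle k H C X M ∘ₗ TensorProduct.map ρ σ) := by
  have h1 : (shuffle k H C X M ∘ₗ
        TensorProduct.map ρ σ).rTensor C ∘ₗ shuffle k H C X M =
      (shuffle k H C X M).rTensor C ∘ₗ
        shuffle k H C (X ⊗[k] H) (M ⊗[k] C) ∘ₗ
        TensorProduct.map (ρ.rTensor H) (σ.rTensor C) := by
    ext x h m c; simp
  have h2 : (TensorProduct.assoc k (X ⊗[k] M) C C).toLinearMap ∘ₗ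
      (shuffle k H C X M).rTensor C ∘ₗ
        shuffle k H C (X ⊗[k] H) (M ⊗[k] C) =
      ((TensorProduct.map (actionMap k H C) (actionMap k H C)).lTensor _ ∘ₗ
        (TensorProduct.tensorTensorTensorComm k H H C C).toLinearMap.lTensor _ ∘ₗ
        (TensorProduct.tensorTensorTensorComm k X (H ⊗[k] H) M
          (C ⊗[k] C)).toLinearMap) ∘ₗ
        TensorProduct.map (TensorProduct.assoc k X H H).toLinearMap
          (TensorProduct.assoc k M C C).toLinearMap := by
    ext x h h' m c c'; simp
  have h3 : Δ.lTensor (X ⊗[k] M) ∘ₗ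
        shuffle k H C X M =
      ((TensorProduct.map (actionMap k H C) (actionMap k H C)).lTensor _ ∘ₗ
        (TensorProduct.tensorTensorTensorComm k H H C C).toLinearMap.lTensor _ ∘ₗ
        (TensorProduct.tensorTensorTensorComm k X (H ⊗[k] H) M
          (C ⊗[k] C)).toLinearMap) ∘ₗ
        TensorProduct.map (Coalgebra.comul.lTensor X)
          (Δ.lTensor M) := by
    ext x h m c; simp [hΔ]
  calc _ = (TensorProduct.assoc k (X ⊗[k] M) C C).toLinearMap ∘ₗ
        ((shuffle k H C X M ∘ₗ
          TensorProduct.map ρ σ).rTensor C ∘ₗ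
          shuffle k H C X M) ∘ₗ TensorProduct.map ρ σ := rfl
    _ = ((TensorProduct.assoc k (X ⊗[k] M) C C).toLinearMap ∘ₗ
        (shuffle k H C X M).rTensor C ∘ₗ
        shuffle k H C (X ⊗[k] H) (M ⊗[k] C)) ∘ₗ
        TensorProduct.map (ρ.rTensor H) (σ.rTensor C) ∘ₗ
        TensorProduct.map ρ σ := by
      rw [h1]; rfl
    _ = _ := by
      rw [h2, LinearMap.comp_assoc, ← TensorProduct.map_comp, ← TensorProduct.map_comp,
        hρ, hσ, TensorProduct.map_comp, ← LinearMap.comp_assoc, ← h3]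
      rfl

lemma shuffle_counit {X M : Type u} [AddCommGroup X] [Module k X] [AddCommGroup M] [Module k M]
    {ρ : X →ₗ[k] X ⊗[k] H} {σ : M →ₗ[k] M ⊗[k] C} {ε : C →ₗ[k] k}
    (hρ : (Coalgebra.counit (R := k)).lTensor X ∘ₗ ρ = (TensorProduct.mk k X k).flip 1)
    (hσ : ε.lTensor M ∘ₗ σ = (TensorProduct.mk k M k).flip 1)
    (hε : ∀ (h : H) (c : C), ε (h • c) = Coalgebra.counit (R := k) h * ε c) :
    ε.lTensor (X ⊗[k] M) ∘ₗ (shuffle k H C X M ∘ₗ TensorProduct.map ρ σ) =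
      (TensorProduct.mk k (X ⊗[k] M) k).flip 1 := by
  have h3 : ε.lTensor (X ⊗[k] M) ∘ₗ
        shuffle k H C X M =
      ((LinearMap.mul' k k).lTensor _ ∘ₗ
        (TensorProduct.tensorTensorTensorComm k X k M k).toLinearMap) ∘ₗ
        TensorProduct.map (Coalgebra.counit.lTensor X)
          (ε.lTensor M) := by
    ext x h m c; simp [hε]
  rw [← LinearMap.comp_assoc, h3, LinearMap.comp_assoc, ← TensorProduct.map_comp,
    hρ, hσ]
  ext x m; simp

variable [Coalgebra k C] [IsModuleCoalgebra k H C]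

/-- For a right `H`-comodule `X` and a right `C`-comodule `M`, the `C`-comodule `X ⊗ M` with
coaction `x ⊗ m ↦ (x₍₀₎ ⊗ m₍₀₎) ⊗ x₍₁₎ m₍₁₎`. -/
def act (X : Comod k H) (M : Comod k C) : Comod k C where
  carrier := X.carrier ⊗[k] M.carrier
  coact := shuffle k H C X.carrier M.carrier ∘ₗ TensorProduct.map X.coact M.coact
  coassoc := shuffle_coassoc X.coassoc M.coassoc IsModuleCoalgebra.comul_smul
  counit := shuffle_counit X.counit M.counit IsModuleCoalgebra.counit_smul

/-- The action of a pair of morphisms: the tensor product of the underlying linear maps. -/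
def actMap {X X' : Comod k H} {M M' : Comod k C} (f : X ⟶ X') (g : M ⟶ M') :
    act X M ⟶ act X' M' :=
  ⟨TensorProduct.map (Hom.lin f) (Hom.lin g), by
    change (shuffle k H C _ _ ∘ₗ TensorProduct.map X'.coact M'.coact) ∘ₗ _ =
      _ ∘ₗ shuffle k H C _ _ ∘ₗ TensorProduct.map X.coact M.coact
    rw [LinearMap.comp_assoc, ← TensorProduct.map_comp, Hom.colinear, Hom.colinear,
      TensorProduct.map_comp, ← LinearMap.comp_assoc, shuffle_map, LinearMap.comp_assoc]
    rfl⟩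

@[simp] lemma actMap_lin {X X' : Comod k H} {M M' : Comod k C} (f : X ⟶ X') (g : M ⟶ M') :
    Hom.lin (actMap f g) = TensorProduct.map (Hom.lin f) (Hom.lin g) := rfl

/-- The isomorphism `(X ⊗ Y) ⊗ M ≅ X ⊗ (Y ⊗ M)` of comodules. -/
def actAssoc (X Y : Comod k H) (M : Comod k C) : act (act X Y) M ≅ act X (act Y M) :=
  isoMk (TensorProduct.assoc k X.carrier Y.carrier M.carrier) (by
    have h1 : shuffle k H C X.carrier (Y.carrier ⊗[k] M.carrier) ∘ₗ
          (shuffle k H C Y.carrier M.carrier).lTensor _ ∘ₗ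
          (TensorProduct.assoc k (X.carrier ⊗[k] H) (Y.carrier ⊗[k] H)
            (M.carrier ⊗[k] C)).toLinearMap =
        (TensorProduct.assoc k X.carrier Y.carrier M.carrier).toLinearMap.rTensor C ∘ₗ
          shuffle k H C (X.carrier ⊗[k] Y.carrier) M.carrier ∘ₗ
          (shuffle k H H X.carrier Y.carrier).rTensor _ := by
      ext x h y h' m c; simp [mul_smul]
    refine TensorProduct.ext_threefold fun x y m => ?_
    have := LinearMap.congr_fun h1 ((X.coact x ⊗ₜ Y.coact y) ⊗ₜ M.coact m)
    simp at this
    exact this)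

variable (k H) in
/-- The unit object: `k` with the coaction `a ↦ a ⊗ 1`. -/
def unitObj : Comod k H where
  carrier := k
  coact := (TensorProduct.mk k k H).flip 1
  coassoc := by ext; simp [Algebra.TensorProduct.one_def]
  counit := by ext; simp

/-- The isomorphism `k ⊗ M ≅ M` of comodules. -/
def actUnit (M : Comod k C) : act (unitObj k H) M ≅ M :=
  isoMk (TensorProduct.lid k M.carrier) (by
    refine TensorProduct.ext' fun (a : k) m => ?_
    have h1 : (TensorProduct.lid k M.carrier).toLinearMap.rTensor C ∘ₗ
        shuffle k H C k M.carrier ∘ₗ TensorProduct.mk k _ _ ((a : k) ⊗ₜ (1 : H)) =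
          a • (LinearMap.id : M.carrier ⊗[k] C →ₗ[k] M.carrier ⊗[k] C) := by
      ext m c; simp [TensorProduct.smul_tmul']
    have := LinearMap.congr_fun h1 (M.coact m)
    simp at this
    exact (M.coact.map_smul a m).trans this.symm)

/-- The isomorphism `X ⊗ k ≅ X` of comodules. -/
def actRightUnit (X : Comod k H) : act X (unitObj k H) ≅ X :=
  isoMk (TensorProduct.rid k X.carrier) (by
    refine TensorProduct.ext' fun x (a : k) => ?_
    have h1 : (TensorProduct.rid k X.carrier).toLinearMap.rTensor H ∘ₗ
        shuffle k H H X.carrier k ∘ₗ (TensorProduct.mk k _ _).flip ((a : k) ⊗ₜ (1 : H)) =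
          a • (LinearMap.id : X.carrier ⊗[k] H →ₗ[k] X.carrier ⊗[k] H) := by
      ext m c; simp [TensorProduct.smul_tmul']
    have := LinearMap.congr_fun h1 (X.coact x)
    simp at this
    exact (X.coact.map_smul a x).trans this.symm)

@[simp] lemma actAssoc_hom_lin (X Y : Comod k H) (M : Comod k C) :
    Hom.lin (actAssoc X Y M).hom =
      (TensorProduct.assoc k X.carrier Y.carrier M.carrier).toLinearMap := rfl

@[simp] lemma actAssoc_inv_lin (X Y : Comod k H) (M : Comod k C) :
    Hom.lin (actAssoc X Y M).inv =
      (TensorProduct.assoc k X.carrier Y.carrier M.carrier).symm.toLinearMap := rfl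

@[simp] lemma actUnit_hom_lin (M : Comod k C) :
    Hom.lin (actUnit (H := H) M).hom = (TensorProduct.lid k M.carrier).toLinearMap := rfl

@[simp] lemma actUnit_inv_lin (M : Comod k C) :
    Hom.lin (actUnit (H := H) M).inv = (TensorProduct.lid k M.carrier).symm.toLinearMap := rfl

@[simp] lemma actRightUnit_hom_lin (X : Comod k H) :
    Hom.lin (actRightUnit X).hom = (TensorProduct.rid k X.carrier).toLinearMap := rfl

/-- The monoidal category of right comodules over a bialgebra `H`: the coaction on `X ⊗ Y` is
`x ⊗ y ↦ (x₍₀₎ ⊗ y₍₀₎) ⊗ x₍₁₎ y₍₁₎` and the unit object is `k` with `a ↦ a ⊗ 1`. -/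
instance : MonoidalCategory (Comod k H) where
  tensorObj X Y := act X Y
  whiskerLeft X _ _ f := actMap (𝟙 X) f
  whiskerRight f Y := actMap f (𝟙 Y)
  tensorHom f g := actMap f g
  tensorUnit := unitObj k H
  associator X Y Z := actAssoc X Y Z
  leftUnitor X := actUnit X
  rightUnitor X := actRightUnit X
  tensorHom_def f g := hom_ext (TensorProduct.ext' fun _ _ => rfl)
  id_tensorHom_id X Y := hom_ext (by simp; rfl)
  tensorHom_comp_tensorHom f g f' g' := hom_ext (TensorProduct.ext' fun _ _ => rfl)
  whiskerLeft_id X Y := hom_ext (by simp; rfl)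
  id_whiskerRight X Y := hom_ext (by simp; rfl)
  associator_naturality f g h := hom_ext (TensorProduct.ext_threefold fun _ _ _ => rfl)
  leftUnitor_naturality f := hom_ext (TensorProduct.ext' fun (a : k) x =>
    ((Hom.lin f).map_smul a x).symm)
  rightUnitor_naturality f := hom_ext (TensorProduct.ext' fun x (a : k) =>
    ((Hom.lin f).map_smul a x).symm)
  pentagon W X Y Z := hom_ext (TensorProduct.ext_fourfold fun _ _ _ _ => rfl)
  triangle X Y := hom_ext (TensorProduct.ext_threefold fun x (a : k) y =>
    (TensorProduct.smul_tmul a x y).symm)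

/-- For a left `H`-module coalgebra `C`, the category of right `C`-comodules is a left module
category over the monoidal category of right `H`-comodules by `(X, M) ↦ X ⊗ M`. -/
instance : MonoidalLeftAction (Comod k H) (Comod k C) where
  actionObj X M := act X M
  actionHomLeft f M := actMap f (𝟙 M)
  actionHomRight X _ _ f := actMap (𝟙 X) f
  actionHom f g := actMap f g
  actionAssocIso X Y M := actAssoc X Y M
  actionUnitIso M := actUnit M
  actionHom_def f g := hom_ext (TensorProduct.ext' fun _ _ => rfl)
  actionHomRight_id X M := hom_ext (by simp; rfl)
  id_actionHomLeft X M := hom_ext (by simp; rfl)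
  actionHom_comp f g f' g' := hom_ext (TensorProduct.ext' fun _ _ => rfl)
  actionAssocIso_hom_naturality f g h := hom_ext (TensorProduct.ext_threefold fun _ _ _ => rfl)
  actionUnitIso_hom_naturality f := hom_ext (TensorProduct.ext' fun (a : k) x =>
    (Hom.lin f).map_smul a x)
  whiskerLeft_actionHomLeft X Y Y' f M := hom_ext (TensorProduct.ext_threefold fun _ _ _ => rfl)
  whiskerRight_actionHomLeft X f M := hom_ext (TensorProduct.ext_threefold fun _ _ _ => rfl)
  associator_actionHom X Y Z M := hom_ext (TensorProduct.ext_fourfold fun _ _ _ _ => rfl)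
  leftUnitor_actionHom X M := hom_ext (TensorProduct.ext_threefold fun (a : k) x m =>
    TensorProduct.smul_tmul' a x m)
  rightUnitor_actionHom X M := hom_ext (TensorProduct.ext_threefold fun x (a : k) m =>
    TensorProduct.smul_tmul a x m)

end Action

end Comod

section DualBialgebra

variable {k H : Type u} [Field k] [Ring H] [Bialgebra k H]

variable (k H) in
/-- The dual space `H^*` of a bialgebra `H`, with the convolution product
`(f ⋆ g)(h) = f(h₍₁₎) g(h₍₂₎)` and the unit `ε`. -/
def DualBialg : Type u := WithConv (H →ₗ[k] k)

instance : Ring (DualBialg k H) := inferInstanceAs (Ring (WithConv (H →ₗ[k] k)))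

instance : Algebra k (DualBialg k H) := inferInstanceAs (Algebra k (WithConv (H →ₗ[k] k)))

variable (k H) in
/-- The identification of `DualBialg k H` with the space of linear forms on `H`. -/
def toDual : DualBialg k H ≃ₗ[k] Module.Dual k H where
  toFun f := WithConv.ofConv f
  invFun f := WithConv.toConv f
  map_add' _ _ := rfl
  map_smul' _ _ := rfl
  left_inv _ := rfl
  right_inv _ := rfl

lemma toDual_mul (f g : DualBialg k H) (h : H) : toDual k H (f * g) h =
    LinearMap.mul' k k (TensorProduct.map (toDual k H f) (toDual k H g)
      (Coalgebra.comul (R := k) h)) := rfl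

@[simp] lemma toDual_one (h : H) :
    toDual k H 1 h = Coalgebra.counit (R := k) h := rfl

lemma dual_ext {f g : DualBialg k H} (w : ∀ h, toDual k H f h = toDual k H g h) : f = g :=
  (toDual k H).injective (LinearMap.ext w)

/-- The canonical map `H^* ⊗ H^* → (H ⊗ H)^*`. -/
def evTwo : DualBialg k H ⊗[k] DualBialg k H →ₗ[k] Module.Dual k (H ⊗[k] H) :=
  TensorProduct.dualDistrib k H H ∘ₗ TensorProduct.map
    (toDual k H).toLinearMap
    (toDual k H).toLinearMap

@[simp] lemma evTwo_tmul (f g : DualBialg k H) (h h' : H) :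
    evTwo (f ⊗ₜ g) (h ⊗ₜ h') = toDual k H f h * toDual k H g h' := rfl

/-- The canonical map `H^* ⊗ (H^* ⊗ H^*) → (H ⊗ (H ⊗ H))^*`. -/
def evThree : DualBialg k H ⊗[k] (DualBialg k H ⊗[k] DualBialg k H) →ₗ[k]
    Module.Dual k (H ⊗[k] (H ⊗[k] H)) :=
  TensorProduct.dualDistrib k H (H ⊗[k] H) ∘ₗ TensorProduct.map
    (toDual k H).toLinearMap evTwo

@[simp] lemma evThree_tmul (f : DualBialg k H) (t : DualBialg k H ⊗[k] DualBialg k H) (h : H)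
    (s : H ⊗[k] H) : evThree (f ⊗ₜ t) (h ⊗ₜ s) = toDual k H f h * evTwo t s := rfl

lemma evThree_assoc (t : DualBialg k H ⊗[k] DualBialg k H) (g : DualBialg k H) (h h' h'' : H) :
    evThree (TensorProduct.assoc k _ _ _ (t ⊗ₜ g)) (h ⊗ₜ (h' ⊗ₜ h'')) =
      evTwo t (h ⊗ₜ h') * toDual k H g h'' := by
  induction t with
  | zero => simp
  | add x y hx hy =>
    simp only [TensorProduct.add_tmul, map_add, LinearMap.add_apply, hx, hy, add_mul]
  | tmul f g => simp [mul_assoc]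

lemma evTwo_mul (t t' : DualBialg k H ⊗[k] DualBialg k H) (h h' : H) :
    evTwo (t * t') (h ⊗ₜ h') = LinearMap.mul' k k (TensorProduct.map (evTwo t) (evTwo t')
      (TensorProduct.tensorTensorTensorComm k H H H H
        (Coalgebra.comul (R := k) h ⊗ₜ[k] Coalgebra.comul (R := k) h'))) := by
  induction t with
  | zero => simp
  | add x y hx hy =>
    simp only [add_mul, map_add, LinearMap.add_apply, TensorProduct.map_add_left, hx, hy]
  | tmul f g =>
    induction t' with
    | zero => simp
    | add x y hx hy =>
      simp only [mul_add, map_add, LinearMap.add_apply, TensorProduct.map_add_right, hx, hy]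
    | tmul f' g' =>
      rw [Algebra.TensorProduct.tmul_mul_tmul, evTwo_tmul, toDual_mul, toDual_mul]
      induction Coalgebra.comul (R := k) h with
      | zero => simp
      | add x y hx hy => simp only [TensorProduct.add_tmul, map_add, add_mul, hx, hy]
      | tmul a b =>
        induction Coalgebra.comul (R := k) h' with
        | zero => simp
        | add x y hx hy => simp only [TensorProduct.tmul_add, map_add, mul_add, hx, hy]
        | tmul a b => simp; ring

lemma mul_map_comp_mul (f g : H →ₗ[k] k) (s s' : H ⊗[k] H) :
    LinearMap.mul' k k (TensorProduct.map (f ∘ₗ LinearMap.mul' k H) (g ∘ₗ LinearMap.mul' k H)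
      (TensorProduct.tensorTensorTensorComm k H H H H (s ⊗ₜ[k] s'))) =
    LinearMap.mul' k k (TensorProduct.map f g (s * s')) := by
  induction s with
  | zero => simp
  | add x y hx hy => simp only [TensorProduct.add_tmul, map_add, add_mul, hx, hy]
  | tmul a b =>
    induction s' with
    | zero => simp
    | add x y hx hy => simp only [TensorProduct.tmul_add, map_add, mul_add, hx, hy]
    | tmul a b => simp

variable [FiniteDimensional k H]

lemma evTwo_injective : Function.Injective (evTwo (k := k) (H := H)) := by
  unfold evTwo
  rw [LinearMap.coe_comp]
  refine Function.Injective.comp (g := TensorProduct.dualDistrib k H H)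
    (TensorProduct.dualDistribEquiv k H H).injective ?_
  exact (TensorProduct.congr (toDual k H)
    (toDual k H)).injective

lemma evThree_injective : Function.Injective (evThree (k := k) (H := H)) := by
  unfold evThree
  rw [LinearMap.coe_comp]
  refine Function.Injective.comp (g := TensorProduct.dualDistrib k H (H ⊗[k] H))
    (TensorProduct.dualDistribEquiv k H (H ⊗[k] H)).injective ?_
  exact TensorProduct.map_injective_of_flat_flat _ _
    (toDual k H).injective evTwo_injective

/-- The coalgebra structure on `H^*` dual to the algebra structure of `H`:
`f₍₁₎(h) f₍₂₎(h') = f(h h')` and `ε(f) = f(1)`. -/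
instance dualCoalgebraStruct : CoalgebraStruct k (DualBialg k H) where
  comul := TensorProduct.map (toDual k H).symm.toLinearMap
      (toDual k H).symm.toLinearMap ∘ₗ
    (TensorProduct.dualDistribEquiv k H H).symm.toLinearMap ∘ₗ
    (LinearMap.mul' k H).dualMap ∘ₗ (toDual k H).toLinearMap
  counit := LinearMap.applyₗ (1 : H) ∘ₗ (toDual k H).toLinearMap

@[simp] lemma dual_counit (f : DualBialg k H) :
    Coalgebra.counit (R := k) f = toDual k H f 1 := rfl

@[simp] lemma evTwo_comul (f : DualBialg k H) :
    evTwo (Coalgebra.comul (R := k) f) = (toDual k H f) ∘ₗ LinearMap.mul' k H := by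
  have h1 : evTwo ∘ₗ TensorProduct.map (toDual k H).symm.toLinearMap
      (toDual k H).symm.toLinearMap =
        TensorProduct.dualDistrib k H H := by
    ext; rfl
  have h2 := LinearMap.congr_fun h1 ((TensorProduct.dualDistribEquiv k H H).symm
    (toDual k H f ∘ₗ LinearMap.mul' k H))
  exact h2.trans ((TensorProduct.dualDistribEquiv k H H).apply_symm_apply _)

lemma evThree_lTensor_comul (t : DualBialg k H ⊗[k] DualBialg k H) (h h' h'' : H) :
    evThree (Coalgebra.comul.lTensor _ t) (h ⊗ₜ (h' ⊗ₜ h'')) = evTwo t (h ⊗ₜ (h' * h'')) := by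
  induction t with
  | zero => simp
  | add x y hx hy => simp only [map_add, LinearMap.add_apply, hx, hy]
  | tmul f g => simp

lemma evThree_rTensor_comul (t : DualBialg k H ⊗[k] DualBialg k H) (h h' h'' : H) :
    evThree (TensorProduct.assoc k _ _ _ (Coalgebra.comul.rTensor _ t)) (h ⊗ₜ (h' ⊗ₜ h'')) =
      evTwo t ((h * h') ⊗ₜ h'') := by
  induction t with
  | zero => simp
  | add x y hx hy => simp only [map_add, LinearMap.add_apply, hx, hy]
  | tmul f g => simp [evThree_assoc]

lemma rTensor_counit_dual (t : DualBialg k H ⊗[k] DualBialg k H) (h : H) :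
    toDual k H (TensorProduct.lid k _ (Coalgebra.counit.rTensor _ t)) h = evTwo t (1 ⊗ₜ h) := by
  induction t with
  | zero => simp
  | add x y hx hy => simp only [map_add, LinearMap.add_apply, hx, hy]
  | tmul f g => simp

lemma lTensor_counit_dual (t : DualBialg k H ⊗[k] DualBialg k H) (h : H) :
    toDual k H (TensorProduct.rid k _ (Coalgebra.counit.lTensor _ t)) h = evTwo t (h ⊗ₜ 1) := by
  induction t with
  | zero => simp
  | add x y hx hy => simp only [map_add, LinearMap.add_apply, hx, hy]
  | tmul f g => simp [mul_comm]

instance dualCoalgebra : Coalgebra k (DualBialg k H) where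
  coassoc := by
    refine LinearMap.ext fun f => evThree_injective ?_
    refine TensorProduct.ext_threefold' fun h h' h'' => ?_
    simp only [LinearMap.comp_apply, LinearEquiv.coe_coe]
    rw [evThree_rTensor_comul, evThree_lTensor_comul]
    simp [mul_assoc]
  rTensor_counit_comp_comul := by
    refine LinearMap.ext fun f => (TensorProduct.lid k _).injective ?_
    refine dual_ext fun h => ?_
    simp [rTensor_counit_dual]
  lTensor_counit_comp_comul := by
    refine LinearMap.ext fun f => (TensorProduct.rid k _).injective ?_
    refine dual_ext fun h => ?_
    simp [lTensor_counit_dual]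

/-- The dual bialgebra of a finite-dimensional bialgebra. -/
instance dualBialgebra : Bialgebra k (DualBialg k H) :=
  Bialgebra.mk' k (DualBialg k H)
    (by simp)
    (by intro f g; simp [toDual_mul, Bialgebra.comul_one, Algebra.TensorProduct.one_def])
    (by
      apply evTwo_injective
      refine TensorProduct.ext' fun h h' => ?_
      rw [evTwo_comul, Algebra.TensorProduct.one_def, evTwo_tmul]
      simp)
    (by
      intro f g
      apply evTwo_injective
      refine TensorProduct.ext' fun h h' => ?_
      rw [evTwo_mul, evTwo_comul, evTwo_comul, evTwo_comul, mul_map_comp_mul]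
      simp [toDual_mul, Bialgebra.comul_mul])

end DualBialgebra
section Cosmash

variable (k H C : Type u) [Field k] [Ring H] [Bialgebra k H] [FiniteDimensional k H]
  [AddCommGroup C] [Module k C]

/-- The canonical map `C ⊗ H^* → Hom(H, C)`. -/
def evCoact : C ⊗[k] DualBialg k H →ₗ[k] H →ₗ[k] C :=
  dualTensorHom k H C ∘ₗ (TensorProduct.comm k C (Module.Dual k H)).toLinearMap ∘ₗ
    (toDual k H).toLinearMap.lTensor C

variable {k H C}

@[simp] lemma evCoact_tmul (c : C) (f : DualBialg k H) (h : H) :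
    evCoact k H C (c ⊗ₜ f) h = toDual k H f h • c := rfl

lemma evCoact_injective : Function.Injective (evCoact k H C) := by
  unfold evCoact
  rw [LinearMap.coe_comp, LinearMap.coe_comp]
  exact (dualTensorHomEquiv k H C).injective.comp
    ((TensorProduct.comm k C (Module.Dual k H)).injective.comp
      ((toDual k H).lTensor C).injective)

variable (k H C)

/-- The canonical map `C ⊗ (H^* ⊗ H^*) → Hom(H ⊗ H, C)`. -/
def evCoactTwo : C ⊗[k] (DualBialg k H ⊗[k] DualBialg k H) →ₗ[k] H ⊗[k] H →ₗ[k] C :=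
  dualTensorHom k (H ⊗[k] H) C ∘ₗ (TensorProduct.comm k C (Module.Dual k (H ⊗[k] H))).toLinearMap ∘ₗ
    evTwo.lTensor C

variable {k H C}

@[simp] lemma evCoactTwo_tmul (c : C) (t : DualBialg k H ⊗[k] DualBialg k H) (s : H ⊗[k] H) :
    evCoactTwo k H C (c ⊗ₜ t) s = evTwo t s • c := rfl

lemma evCoactTwo_injective : Function.Injective (evCoactTwo k H C) := by
  unfold evCoactTwo
  rw [LinearMap.coe_comp, LinearMap.coe_comp]
  exact (dualTensorHomEquiv k (H ⊗[k] H) C).injective.comp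
    ((TensorProduct.comm k C (Module.Dual k (H ⊗[k] H))).injective.comp
      (Module.Flat.lTensor_preserves_injective_linearMap _ evTwo_injective))

lemma evCoactTwo_comul (t : C ⊗[k] DualBialg k H) (h h' : H) :
    evCoactTwo k H C (Coalgebra.comul.lTensor C t) (h ⊗ₜ h') = evCoact k H C t (h * h') := by
  induction t with
  | zero => simp
  | add x y hx hy => simp only [map_add, LinearMap.add_apply, hx, hy]
  | tmul c f => simp

lemma evCoactTwo_assoc (t : C ⊗[k] DualBialg k H) (f : DualBialg k H) (h h' : H) :
    evCoactTwo k H C (TensorProduct.assoc k _ _ _ (t ⊗ₜ f)) (h ⊗ₜ h') =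
      toDual k H f h' • evCoact k H C t h := by
  induction t with
  | zero => simp
  | add x y hx hy =>
    simp only [TensorProduct.add_tmul, map_add, LinearMap.add_apply, hx, hy, smul_add]
  | tmul c g => simp [smul_smul, mul_comm]

lemma evCoact_one (t : C ⊗[k] DualBialg k H) :
    Coalgebra.counit.lTensor C t = evCoact k H C t 1 ⊗ₜ (1 : k) := by
  induction t with
  | zero => simp
  | add x y hx hy => simp only [map_add, LinearMap.add_apply, hx, hy, TensorProduct.add_tmul]
  | tmul c f => simp [TensorProduct.smul_tmul]

lemma evCoact_rTensor {D : Type u} [AddCommGroup D] [Module k D]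
    (φ : C →ₗ[k] D) (t : C ⊗[k] DualBialg k H) (h : H) :
    evCoact k H D (φ.rTensor _ t) h = φ (evCoact k H C t h) := by
  induction t with
  | zero => simp
  | add x y hx hy => simp only [map_add, LinearMap.add_apply, hx, hy]
  | tmul c f => simp

variable (k H C) [Module H C] [IsScalarTower k H C]

/-- The right `H^*`-coaction `c ↦ c_[0] ⊗ c_[1]` on a left `H`-module `C`, characterised by
`h • c = c_[1](h) c_[0]` for all `h`. -/
def dualCoact : C →ₗ[k] C ⊗[k] DualBialg k H :=
  (toDual k H).symm.toLinearMap.lTensor C ∘ₗ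
    (TensorProduct.comm k (Module.Dual k H) C).toLinearMap ∘ₗ
    (dualTensorHomEquiv k H C).symm.toLinearMap ∘ₗ
    (Algebra.lsmul k k C).toLinearMap.flip

variable {k H C}

@[simp] lemma evCoact_dualCoact (c : C) (h : H) : evCoact k H C (dualCoact k H C c) h = h • c := by
  have h1 : dualTensorHom k H C ((dualTensorHomEquiv k H C).symm
      ((Algebra.lsmul k k C).toLinearMap.flip c)) = (Algebra.lsmul k k C).toLinearMap.flip c :=
    (dualTensorHomEquiv k H C).apply_symm_apply _
  have h2 : ∀ t : Module.Dual k H ⊗[k] C, evCoact k H C ((toDual k H).symm.toLinearMap.lTensor C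
      (TensorProduct.comm k (Module.Dual k H) C t)) = dualTensorHom k H C t := by
    intro t
    induction t with
    | zero => simp
    | add x y hx hy => simp only [map_add, hx, hy]
    | tmul f c => ext h; simp
  have h3 := LinearMap.congr_fun ((h2 _).trans h1) h
  exact h3

lemma evCoactTwo_coact (t : C ⊗[k] DualBialg k H) (h h' : H) :
    evCoactTwo k H C (TensorProduct.assoc k _ _ _ ((dualCoact k H C).rTensor _ t)) (h ⊗ₜ h') =
      h • evCoact k H C t h' := by
  induction t with
  | zero => simp
  | add x y hx hy => simp only [map_add, LinearMap.add_apply, hx, hy, smul_add]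
  | tmul c f =>
    simp only [LinearMap.rTensor_tmul, evCoactTwo_assoc, evCoact_dualCoact, evCoact_tmul]
    exact (smul_algebra_smul_comm _ _ _).symm

lemma dualCoact_coassoc (c : C) :
    TensorProduct.assoc k _ _ _ ((dualCoact k H C).rTensor _ (dualCoact k H C c)) =
      Coalgebra.comul.lTensor C (dualCoact k H C c) := by
  apply evCoactTwo_injective
  refine TensorProduct.ext' fun h h' => ?_
  rw [evCoactTwo_coact, evCoactTwo_comul]
  simp [mul_smul]

lemma dualCoact_counit (c : C) :
    Coalgebra.counit.lTensor C (dualCoact k H C c) = c ⊗ₜ (1 : k) := by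
  simp [evCoact_one]

lemma evCoact_shuffle {D : Type u} [AddCommGroup D] [Module k D] (s : C ⊗[k] DualBialg k H)
    (t : D ⊗[k] DualBialg k H) (h : H) :
    evCoact k H (C ⊗[k] D) (Comod.shuffle k (DualBialg k H) (DualBialg k H) C D (s ⊗ₜ t)) h =
      TensorProduct.map (evCoact k H C s) (evCoact k H D t) (Coalgebra.comul (R := k) h) := by
  induction s with
  | zero => simp
  | add x y hx hy =>
    simp only [TensorProduct.add_tmul, map_add, LinearMap.add_apply, TensorProduct.map_add_left,
      hx, hy]
  | tmul c f =>
    induction t with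
    | zero => simp
    | add x y hx hy =>
      simp only [TensorProduct.tmul_add, map_add, LinearMap.add_apply,
        TensorProduct.map_add_right, hx, hy]
    | tmul d g =>
      rw [Comod.shuffle_tmul, evCoact_tmul, smul_eq_mul, toDual_mul]
      induction Coalgebra.comul (R := k) h with
      | zero => simp
      | add x y hx hy => simp only [map_add, add_smul, hx, hy]
      | tmul a b =>
        simp only [TensorProduct.map_tmul, LinearMap.mul'_apply, evCoact_tmul]
        rw [TensorProduct.smul_tmul_smul]

variable [Coalgebra k C] [IsModuleCoalgebra k H C]

lemma dualCoact_comul (c : C) :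
    (Coalgebra.comul (R := k)).rTensor _ (dualCoact k H C c) =
      Comod.shuffle k (DualBialg k H) (DualBialg k H) C C
        (TensorProduct.map (dualCoact k H C) (dualCoact k H C) (Coalgebra.comul (R := k) c)) := by
  apply evCoact_injective
  ext h
  rw [evCoact_rTensor, evCoact_dualCoact, IsModuleCoalgebra.comul_smul]
  induction Coalgebra.comul (R := k) c with
  | zero => simp
  | add x y hx hy => simp only [TensorProduct.tmul_add, map_add, LinearMap.add_apply, hx, hy]
  | tmul x y =>
    rw [TensorProduct.map_tmul, evCoact_shuffle]
    induction Coalgebra.comul (R := k) h with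
    | zero => simp
    | add x y hx hy => simp only [TensorProduct.add_tmul, map_add, hx, hy]
    | tmul a b => simp

lemma toDual_lid_rTensor (φ : C →ₗ[k] k) (t : C ⊗[k] DualBialg k H) (h : H) :
    toDual k H (TensorProduct.lid k _ (φ.rTensor _ t)) h = φ (evCoact k H C t h) := by
  induction t with
  | zero => simp
  | add x y hx hy => simp only [map_add, LinearMap.add_apply, hx, hy]
  | tmul c f => simp [mul_comm]

lemma dualCoact_counit_left (c : C) :
    (Coalgebra.counit (R := k)).rTensor _ (dualCoact k H C c) =
      Coalgebra.counit (R := k) c ⊗ₜ[k] (1 : DualBialg k H) := by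
  apply (TensorProduct.lid k _).injective
  refine dual_ext fun h => ?_
  rw [toDual_lid_rTensor]
  simp [IsModuleCoalgebra.counit_smul, mul_comm]

variable (k H C)

/-- The map `C → C ⊗ (H^* ⊗ C)`, `c ↦ (c₍₁₎)_[0] ⊗ ((c₍₁₎)_[1] ⊗ c₍₂₎)`. -/
def cosmashCoact : C →ₗ[k] C ⊗[k] (DualBialg k H ⊗[k] C) :=
  (TensorProduct.assoc k C (DualBialg k H) C).toLinearMap ∘ₗ
    (dualCoact k H C).rTensor C ∘ₗ Coalgebra.comul

/-- The comultiplication of the cosmash product: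
`f ⊗ c ↦ (f₍₁₎ ⊗ (c₍₁₎)_[0]) ⊗ (f₍₂₎ ⋆ (c₍₁₎)_[1] ⊗ c₍₂₎)`. -/
def cosmashComul : DualBialg k H ⊗[k] C →ₗ[k]
    (DualBialg k H ⊗[k] C) ⊗[k] (DualBialg k H ⊗[k] C) :=
  Comod.shuffle k (DualBialg k H) (DualBialg k H ⊗[k] C) (DualBialg k H) C ∘ₗ
    TensorProduct.map Coalgebra.comul (cosmashCoact k H C)

/-- The counit of the cosmash product: `f ⊗ c ↦ f(1) ε(c)`. -/
def cosmashCounit : DualBialg k H ⊗[k] C →ₗ[k] k :=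
  LinearMap.mul' k k ∘ₗ TensorProduct.map Coalgebra.counit Coalgebra.counit

variable {k H C}

lemma cosmashComul_smul (a : DualBialg k H) (x : DualBialg k H ⊗[k] C) :
    cosmashComul k H C (a • x) =
      TensorProduct.map (actionMap k (DualBialg k H) (DualBialg k H ⊗[k] C))
        (actionMap k (DualBialg k H) (DualBialg k H ⊗[k] C))
        (TensorProduct.tensorTensorTensorComm k _ _ _ _
          (Coalgebra.comul (R := k) a ⊗ₜ[k] cosmashComul k H C x)) := by
  induction x with
  | zero => simp
  | add x y hx hy => simp only [smul_add, map_add, TensorProduct.tmul_add, hx, hy]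
  | tmul f c =>
    rw [TensorProduct.smul_tmul', smul_eq_mul]
    simp only [cosmashComul, LinearMap.comp_apply, TensorProduct.map_tmul, Bialgebra.comul_mul]
    induction cosmashCoact k H C c with
    | zero => simp
    | add x y hx hy => simp only [map_add, TensorProduct.tmul_add, hx, hy]
    | tmul c w =>
      induction Coalgebra.comul (R := k) a with
      | zero => simp
      | add x y hx hy => simp only [map_add, TensorProduct.add_tmul, add_mul, hx, hy]
      | tmul a a' =>
        induction Coalgebra.comul (R := k) f with
        | zero => simp
        | add x y hx hy =>
          simp only [map_add, TensorProduct.add_tmul, TensorProduct.tmul_add, mul_add, hx, hy]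
        | tmul b b' => simp [mul_smul, TensorProduct.smul_tmul']

lemma cosmashCounit_smul (a : DualBialg k H) (x : DualBialg k H ⊗[k] C) :
    cosmashCounit k H C (a • x) = Coalgebra.counit (R := k) a * cosmashCounit k H C x := by
  induction x with
  | zero => simp
  | add x y hx hy => simp only [smul_add, map_add, mul_add, hx, hy]
  | tmul f c =>
    rw [TensorProduct.smul_tmul', smul_eq_mul]
    simp only [cosmashCounit, LinearMap.comp_apply, TensorProduct.map_tmul, Bialgebra.counit_mul]
    simp [mul_assoc]

/-- The map `(x ⊗ g) ⊗ (y ⊗ e) ↦ (x ⊗ (g₍₁₎ ⊗ y)) ⊗ g₍₂₎ e`. -/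
def cosmashAux (k H C : Type u) [Field k] [Ring H] [Bialgebra k H] [FiniteDimensional k H]
    [AddCommGroup C] [Module k C] : (C ⊗[k] DualBialg k H) ⊗[k] (C ⊗[k] DualBialg k H) →ₗ[k]
      (C ⊗[k] (DualBialg k H ⊗[k] C)) ⊗[k] DualBialg k H :=
  (TensorProduct.assoc k C (DualBialg k H) C).toLinearMap.rTensor _ ∘ₗ
    Comod.shuffle k (DualBialg k H) (DualBialg k H) (C ⊗[k] DualBialg k H) C ∘ₗ
    ((TensorProduct.assoc k C (DualBialg k H) (DualBialg k H)).symm.toLinearMap ∘ₗ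
      Coalgebra.comul.lTensor C).rTensor _

lemma cosmashCoact_dualCoact (c : C) :
    (cosmashCoact k H C).rTensor _ (dualCoact k H C c) =
      cosmashAux k H C (TensorProduct.map (dualCoact k H C) (dualCoact k H C)
        (Coalgebra.comul (R := k) c)) := by
  unfold cosmashCoact
  rw [LinearMap.rTensor_comp, LinearMap.rTensor_comp, LinearMap.comp_apply, LinearMap.comp_apply,
    dualCoact_comul]
  induction Coalgebra.comul (R := k) c with
  | zero => simp
  | add x y hx hy => simp only [map_add, hx, hy]
  | tmul x y =>
    have h1 := LinearMap.congr_fun (Comod.shuffle_map k (DualBialg k H) (DualBialg k H)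
      (dualCoact k H C) (LinearMap.id (R := k) (M := C))) (dualCoact k H C x ⊗ₜ dualCoact k H C y)
    simp only [LinearMap.comp_apply, TensorProduct.map_tmul, LinearMap.rTensor_id,
      LinearMap.id_apply] at h1
    rw [TensorProduct.map_tmul]
    unfold LinearMap.rTensor at h1 ⊢
    rw [← h1]
    simp only [cosmashAux, LinearMap.comp_apply, LinearMap.rTensor_tmul, LinearEquiv.coe_coe]
    rw [← dualCoact_coassoc, LinearEquiv.symm_apply_apply]
    rfl

lemma cosmashCoact_coassoc (c : C) :
    TensorProduct.assoc k _ _ _ ((cosmashCoact k H C).rTensor _ (cosmashCoact k H C c)) =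
      (cosmashComul k H C).lTensor C (cosmashCoact k H C c) := by
  have h1 : ∀ t : (C ⊗[k] DualBialg k H) ⊗[k] C,
      (cosmashCoact k H C).rTensor _ (TensorProduct.assoc k _ _ _ t) =
        TensorProduct.assoc k _ _ _ (((cosmashCoact k H C).rTensor _).rTensor _ t) := by
    intro t
    have : (cosmashCoact k H C).rTensor _ ∘ₗ (TensorProduct.assoc k C (DualBialg k H) C).toLinearMap
        = (TensorProduct.assoc k _ _ _).toLinearMap ∘ₗ
          (((cosmashCoact k H C).rTensor _).rTensor _) := by
      ext; simp
    exact LinearMap.congr_fun this t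
  have h2 : (cosmashCoact k H C).rTensor _ ∘ₗ dualCoact k H C =
      cosmashAux k H C ∘ₗ TensorProduct.map (dualCoact k H C) (dualCoact k H C) ∘ₗ
        Coalgebra.comul (R := k) := LinearMap.ext cosmashCoact_dualCoact
  have h3 : (cosmashCoact k H C).rTensor _ (cosmashCoact k H C c) =
      TensorProduct.assoc k _ _ _
        ((cosmashAux k H C ∘ₗ TensorProduct.map (dualCoact k H C) (dualCoact k H C)).rTensor C
          ((TensorProduct.assoc k C C C).symm
            (Coalgebra.comul.lTensor C (Coalgebra.comul (R := k) c)))) := by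
    conv_lhs => rw [cosmashCoact]
    simp only [LinearMap.comp_apply, LinearEquiv.coe_coe]
    erw [h1]
    rw [← LinearMap.comp_apply (LinearMap.rTensor _ _), ← LinearMap.rTensor_comp, h2,
      ← LinearMap.comp_assoc, LinearMap.rTensor_comp, LinearMap.comp_apply,
      Coalgebra.coassoc_symm_apply]
  rw [h3]
  simp only [cosmashCoact, LinearMap.comp_apply, LinearEquiv.coe_coe]
  induction Coalgebra.comul (R := k) c with
  | zero => simp
  | add x y hx hy => simp only [map_add, hx, hy]
  | tmul x z =>
    have h4 : ∀ s : C ⊗[k] DualBialg k H,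
        (cosmashComul k H C).lTensor C (TensorProduct.assoc k C (DualBialg k H) C (s ⊗ₜ z)) =
          (Comod.shuffle k (DualBialg k H) (DualBialg k H ⊗[k] C) (DualBialg k H) C ∘ₗ
            TensorProduct.map Coalgebra.comul
              ((TensorProduct.assoc k C (DualBialg k H) C).toLinearMap ∘ₗ
                (dualCoact k H C).rTensor C)).lTensor C
            (TensorProduct.assoc k C (DualBialg k H) (C ⊗[k] C)
              (s ⊗ₜ Coalgebra.comul (R := k) z)) := by
      intro s
      induction s with
      | zero => simp
      | add x y hx hy => simp only [TensorProduct.add_tmul, map_add, hx, hy]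
      | tmul p g => rfl
    rw [LinearMap.rTensor_tmul, h4, LinearMap.lTensor_tmul]
    induction Coalgebra.comul (R := k) z with
    | zero => simp
    | add x y hx hy => simp only [TensorProduct.tmul_add, map_add, hx, hy]
    | tmul y w =>
      rw [TensorProduct.assoc_symm_tmul, LinearMap.rTensor_tmul, LinearMap.comp_apply,
        TensorProduct.map_tmul]
      induction dualCoact k H C x with
      | zero => simp
      | add x y hx hy => simp only [TensorProduct.add_tmul, map_add, hx, hy]
      | tmul p g =>
        simp only [TensorProduct.assoc_tmul, LinearMap.lTensor_tmul, LinearMap.comp_apply,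
          TensorProduct.map_tmul, LinearMap.rTensor_tmul, LinearEquiv.coe_coe, cosmashAux]
        induction dualCoact k H C y with
        | zero => simp
        | add x y hx hy => simp only [TensorProduct.add_tmul, TensorProduct.tmul_add, map_add, hx, hy]
        | tmul q e =>
          induction Coalgebra.comul (R := k) g with
          | zero => simp
          | add x y hx hy =>
            simp only [TensorProduct.add_tmul, TensorProduct.tmul_add, map_add, hx, hy]
          | tmul g g' => simp [TensorProduct.smul_tmul']

lemma cosmashCoact_counit (c : C) :
    (cosmashCounit k H C).lTensor C (cosmashCoact k H C c) = c ⊗ₜ (1 : k) := by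
  have h0 := Coalgebra.lTensor_counit_comul (R := k) c
  rw [← h0]
  simp only [cosmashCoact, LinearMap.comp_apply, LinearEquiv.coe_coe]
  induction Coalgebra.comul (R := k) c with
  | zero => simp
  | add x y hx hy => simp only [map_add, hx, hy]
  | tmul x z =>
    have h1 : ∀ s : C ⊗[k] DualBialg k H, (cosmashCounit k H C).lTensor C
        (TensorProduct.assoc k C (DualBialg k H) C (s ⊗ₜ z)) =
          Coalgebra.counit (R := k) z • Coalgebra.counit.lTensor C s := by
      intro s
      induction s with
      | zero => simp
      | add x y hx hy => simp only [TensorProduct.add_tmul, map_add, smul_add, hx, hy]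
      | tmul p g =>
        simp [cosmashCounit, TensorProduct.smul_tmul', TensorProduct.smul_tmul, mul_comm]
    rw [LinearMap.rTensor_tmul, h1, dualCoact_counit]
    simp [TensorProduct.smul_tmul', TensorProduct.smul_tmul]

lemma cosmash_counit_left (x : DualBialg k H ⊗[k] C) :
    (cosmashCounit k H C).rTensor _ (cosmashComul k H C x) = (1 : k) ⊗ₜ x := by
  induction x with
  | zero => simp
  | add x y hx hy => simp only [map_add, TensorProduct.tmul_add, hx, hy]
  | tmul f c =>
    have h1 : ∀ (t : DualBialg k H ⊗[k] DualBialg k H) (s : C ⊗[k] (DualBialg k H ⊗[k] C)),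
        (cosmashCounit k H C).rTensor _
          (Comod.shuffle k (DualBialg k H) (DualBialg k H ⊗[k] C) (DualBialg k H) C (t ⊗ₜ s)) =
        (1 : k) ⊗ₜ ((TensorProduct.lid k _ (Coalgebra.counit.rTensor _ t)) •
          (TensorProduct.lid k _ ((Coalgebra.counit (R := k)).rTensor _ s))) := by
      intro t s
      induction t with
      | zero => simp
      | add x y hx hy => simp only [TensorProduct.add_tmul, map_add, add_smul,
          TensorProduct.tmul_add, hx, hy]
      | tmul f g =>
        induction s with
        | zero => simp
        | add x y hx hy => simp only [map_add, smul_add, TensorProduct.tmul_add, hx, hy]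
        | tmul c w =>
          simp only [Comod.shuffle_tmul, LinearMap.rTensor_tmul, cosmashCounit,
            LinearMap.comp_apply, TensorProduct.map_tmul, LinearMap.mul'_apply,
            TensorProduct.lid_tmul]
          rw [smul_assoc, smul_comm g, ← mul_smul,
            ← TensorProduct.smul_tmul (Coalgebra.counit (R := k) f * Coalgebra.counit (R := k) c),
            smul_eq_mul, mul_one]
    have h2 : (Coalgebra.counit (R := k)).rTensor _ (cosmashCoact k H C c) =
        (1 : k) ⊗ₜ ((1 : DualBialg k H) ⊗ₜ[k] c) := by
      have h0 := Coalgebra.rTensor_counit_comul (R := k) c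
      have h3 : ∀ (t : C ⊗[k] C), (Coalgebra.counit (R := k)).rTensor _
          (TensorProduct.assoc k C (DualBialg k H) C ((dualCoact k H C).rTensor C t)) =
          (TensorProduct.mk k (DualBialg k H) C 1).lTensor k
            ((Coalgebra.counit (R := k)).rTensor _ t) := by
        intro t
        induction t with
        | zero => simp
        | add x y hx hy => simp only [map_add, hx, hy]
        | tmul x z =>
          have h4 : ∀ s : C ⊗[k] DualBialg k H, (Coalgebra.counit (R := k)).rTensor _
              (TensorProduct.assoc k C (DualBialg k H) C (s ⊗ₜ z)) =
              TensorProduct.assoc k _ _ _ ((Coalgebra.counit (R := k)).rTensor _ s ⊗ₜ z) := by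
            intro s
            induction s with
            | zero => simp
            | add x y hx hy => simp only [TensorProduct.add_tmul, map_add, hx, hy]
            | tmul p g => simp
          rw [LinearMap.rTensor_tmul, h4, dualCoact_counit_left]
          simp
      exact (h3 _).trans (by rw [h0]; simp)
    simp only [cosmashComul, LinearMap.comp_apply, TensorProduct.map_tmul]
    rw [h1, h2]
    simp [TensorProduct.smul_tmul']

lemma cosmash_coassoc :
    (TensorProduct.assoc k (DualBialg k H ⊗[k] C) (DualBialg k H ⊗[k] C)
        (DualBialg k H ⊗[k] C)).toLinearMap ∘ₗ
      (cosmashComul k H C).rTensor _ ∘ₗ cosmashComul k H C =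
      (cosmashComul k H C).lTensor _ ∘ₗ cosmashComul k H C :=
  Comod.shuffle_coassoc Coalgebra.coassoc
    (LinearMap.ext cosmashCoact_coassoc) cosmashComul_smul

lemma cosmash_counit_right :
    (cosmashCounit k H C).lTensor _ ∘ₗ cosmashComul k H C =
      (TensorProduct.mk k (DualBialg k H ⊗[k] C) k).flip 1 :=
  Comod.shuffle_counit
    Coalgebra.lTensor_counit_comp_comul (LinearMap.ext cosmashCoact_counit) cosmashCounit_smul

/-- The cosmash product `H^* # C`: the free left `H^*`-module `H^* ⊗ C`, with the coalgebra
structure given by `cosmashComul` and `cosmashCounit`. -/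
def Cosmash (k H C : Type u) [Field k] [Ring H] [Bialgebra k H] [AddCommGroup C] [Module k C] :
    Type u := DualBialg k H ⊗[k] C

instance : AddCommGroup (Cosmash k H C) :=
  inferInstanceAs (AddCommGroup (DualBialg k H ⊗[k] C))

instance : Module k (Cosmash k H C) := inferInstanceAs (Module k (DualBialg k H ⊗[k] C))

instance : Module (DualBialg k H) (Cosmash k H C) :=
  inferInstanceAs (Module (DualBialg k H) (DualBialg k H ⊗[k] C))

instance : IsScalarTower k (DualBialg k H) (Cosmash k H C) :=
  inferInstanceAs (IsScalarTower k (DualBialg k H) (DualBialg k H ⊗[k] C))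

instance cosmashCoalgebra : Coalgebra k (Cosmash k H C) where
  comul := cosmashComul k H C
  counit := cosmashCounit k H C
  coassoc := cosmash_coassoc
  rTensor_counit_comp_comul := LinearMap.ext cosmash_counit_left
  lTensor_counit_comp_comul := cosmash_counit_right

/-- `H^* # C` is a left `H^*`-module coalgebra. -/
instance cosmashIsModuleCoalgebra :
    IsModuleCoalgebra k (DualBialg k H) (Cosmash k H C) where
  comul_smul := cosmashComul_smul
  counit_smul := cosmashCounit_smul

end Cosmash

section ModuleFunctors

open MonoidalLeftAction Functor.LaxLeftLinear

universe v₁ v₂ v₃ v₄ u₁ u₂ u₃ u₄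

variable (V : Type u₁) [Category.{v₁} V] [MonoidalCategory V]
  {M : Type u₂} [Category.{v₂} M] [MonoidalLeftAction V M]
  {N : Type u₃} [Category.{v₃} N] [MonoidalLeftAction V N]
  {P : Type u₄} [Category.{v₄} P] [MonoidalLeftAction V P]

/-- The identity functor as a lax module functor, with structure morphism the identity. -/
instance idLaxLeftLinear : (𝟭 M).LaxLeftLinear V where
  μₗ _ _ := 𝟙 _

/-- The composition of lax module functors, with structure morphism
`X ⊗ G(F(m)) → G(X ⊗ F(m)) → G(F(X ⊗ m))`. -/
instance compLaxLeftLinear (F : M ⥤ N) (G : N ⥤ P) [F.LaxLeftLinear V] [G.LaxLeftLinear V] :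
    (F ⋙ G).LaxLeftLinear V where
  μₗ X m := μₗ G X (F.obj m) ≫ G.map (μₗ F X m)
  μₗ_naturality_left f m := by
    simp [← Functor.map_comp]
  μₗ_naturality_right X m m' f := by
    simp [← Functor.map_comp]
  μₗ_associativity X Y m := by
    simp only [Functor.comp_obj, Functor.comp_map, Category.assoc]
    rw [← G.map_comp, μₗ_associativity F, G.map_comp, G.map_comp, μₗ_associativity_assoc,
      actionHomRight_comp, Category.assoc, μₗ_naturality_right_assoc]
  μₗ_unitality m := by
    simp [← Functor.map_comp]

/-- A natural transformation between lax module functors is a morphism of lax module functors if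
it commutes with the structure morphisms. -/
def IsModuleNatTrans {F G : M ⥤ N} [F.LaxLeftLinear V] [G.LaxLeftLinear V] (α : F ⟶ G) : Prop :=
  ∀ (X : V) (m : M), μₗ F X m ≫ α.app (X ⊙ₗ m) = X ⊴ₗ α.app m ≫ μₗ G X m

variable (M N) in
/-- Two left module categories `M` and `N` over `V` are equivalent: there are lax module functors
`F : M ⥤ N` and `G : N ⥤ M` such that `G ∘ F` and `F ∘ G` are isomorphic to the identities as lax
module functors. -/
def ModuleCategoryEquivalent : Prop :=
  ∃ (F : M ⥤ N) (G : N ⥤ M) (_ : F.LaxLeftLinear V) (_ : G.LaxLeftLinear V)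
    (η : F ⋙ G ≅ 𝟭 M) (ε : G ⋙ F ≅ 𝟭 N),
    IsModuleNatTrans V η.hom ∧ IsModuleNatTrans V ε.hom

end ModuleFunctors

/-- Two left `H`-module coalgebras `C` and `D` are `H`-Morita–Takeuchi equivalent if their
categories of right comodules are equivalent as left module categories over the monoidal category
of right `H`-comodules. -/
def HMoritaTakeuchi (k H C D : Type u) [Field k] [Ring H] [Bialgebra k H]
    [AddCommGroup C] [Module k C] [Module H C] [IsScalarTower k H C]
    [Coalgebra k C] [IsModuleCoalgebra k H C]
    [AddCommGroup D] [Module k D] [Module H D] [IsScalarTower k H D]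
    [Coalgebra k D] [IsModuleCoalgebra k H D] : Prop :=
  ModuleCategoryEquivalent (Comod k H) (Comod k C) (Comod k D)

end MoritaTakeuchi

end

/-! Write `M^C` for the right `C`-comodules. Since `H` is finite-dimensional, a right `H^*`-comodule
is the same thing as a left `H`-module (`hact`, `Comod.colinear_iff`). Both sides of the theorem are
compared with Doi–Hopf modules: spaces `M` with an action of `H` and a coaction `ρ` of `C`
satisfying `ρ(hm) = h₁m₀ ⊗ h₂m₁`. This condition has two readings. Read as `H`-linearity of `ρ`, it
makes `M` a `C`-comodule inside `M^{H^*}`; such objects are the comodules over `H^* # C`, compatibly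
with tensoring by `M^{H^*}` on the left (`moduleCategoryEquivalent_cosmash`). Read as
`C`-colinearity of the action `H ⊗ M → M`, it makes `M` a module in `M^C` over the algebra `H` of
`M^H` (`DoiHopf.colinear_iff`). It remains to see that `M^C` and `M^D` are equivalent over `M^H`
exactly when the two categories of Doi–Hopf modules are equivalent over `M^{H^*}`.

From comodules to Doi–Hopf modules: a lax `M^H`-module functor `F` sends modules over the algebra
`H` to modules over it (`isAction_liftAction`). The comparison `X ⊗ F(M) → F(X ⊗ M)` for an
`H^*`-comodule `X` is the structure morphism of `F` at the vector space `X` with trivial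
`H`-coaction. It is `H`-linear because the diagonal action on `X ⊗ M` is built from the action on
`M` and the map `h ⊗ x ↦ h₁x ⊗ h₂`, which is a morphism of `M^H` (`twist`, `actionHom_act`);
naturality and associativity of the lax structure carry this across `F` (`μₗ_twist`).

From Doi–Hopf modules to comodules: let `F` and `G` be mutually inverse over `M^{H^*}`. Their
structure morphisms are invertible (`isIso_μₗ`), so `F` and `G` transport morphisms `m → X ⊗ s`
(`coactionMap`). Put `B = F(C)` and `B' = G(D)`. The comultiplication of `C`, transported by `F`, is
a left `C`-coaction on `B`, and the cotensor product `V ↦ V □ B` is a functor `M^C → M^D`. The map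
`y ⊗ (v ⊗ b) ↦ (y₀ ⊗ v) ⊗ y₁b` makes it a lax `M^H`-module functor (`theta`, `cotμ`). Every Doi–Hopf
module over `D` is the equalizer of two maps out of `M ⊗ D`; applying `G` to this for `M = F(C)` and
using `C ≅ G(F(C))` gives `C ≅ B □ B'` (`coactionMap_free_injective`, `presentation`). Therefore `(V
□ B) □ B' ≅ V □ C ≅ V`, as lax module functors (`Presentation.natIso`, `isModuleNatTrans_natIso`),
and the other composite is symmetric. -/

noncomputable section

namespace MoritaTakeuchi

/-! ### Right `H^*`-comodules as left `H`-modules -/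

namespace Comod

section ActionModule

variable {k H W : Type u} [Field k] [Ring H] [Algebra k H] [AddCommGroup W] [Module k W]
  (a : H →ₗ[k] W →ₗ[k] W) (h_one : ∀ w, a 1 w = w)
  (h_mul : ∀ h h' w, a (h * h') w = a h (a h' w))

/-- The `H`-module given by a unital and multiplicative bilinear map. -/
abbrev actionModule : Module H W where
  smul h w := a h w
  one_smul := h_one
  mul_smul := h_mul
  smul_zero h := map_zero (a h)
  smul_add h := map_add (a h)
  add_smul h h' w := by
    change a (h + h') w = a h w + a h' w
    rw [map_add, LinearMap.add_apply]
  zero_smul w := by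
    change a 0 w = 0
    rw [map_zero, LinearMap.zero_apply]

lemma actionModule_isScalarTower :
    letI := actionModule a h_one h_mul
    IsScalarTower k H W :=
  letI := actionModule a h_one h_mul
  ⟨fun c h w => by
    change a (c • h) w = c • a h w
    rw [map_smul, LinearMap.smul_apply]⟩

end ActionModule

section DualComodules

variable {k H : Type u} [Field k] [Ring H] [Bialgebra k H] [FiniteDimensional k H]

/-- The linear map `h ↦ h • x` attached to an element `x` of an `H^*`-comodule. -/
def ev (X : Comod k (DualBialg k H)) : X.carrier →ₗ[k] H →ₗ[k] X.carrier :=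
  evCoact k H X.carrier ∘ₗ X.coact

/-- The action of `H` on a right `H^*`-comodule: `h • x = x₍₁₎(h) x₍₀₎`. -/
def hact (X : Comod k (DualBialg k H)) : H →ₗ[k] X.carrier →ₗ[k] X.carrier :=
  X.ev.flip

lemma hact_eq (X : Comod k (DualBialg k H)) (h : H) (x : X.carrier) :
    X.hact h x = evCoact k H X.carrier (X.coact x) h := rfl

lemma hact_one (X : Comod k (DualBialg k H)) (x : X.carrier) : X.hact 1 x = x := by
  have h1 := LinearMap.congr_fun X.counit x
  rw [LinearMap.comp_apply, evCoact_one] at h1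
  simpa [hact_eq] using congrArg (TensorProduct.rid k _) h1

/-- This is coassociativity evaluated at `h ⊗ h'`: iterating the coaction gives the successive
actions, while comultiplying in `H^*` gives the action of the product, because that comultiplication
is dual to the multiplication of `H`. -/
lemma hact_mul (X : Comod k (DualBialg k H)) (h h' : H) (x : X.carrier) :
    X.hact (h * h') x = X.hact h (X.hact h' x) := by
  have h1 := LinearMap.congr_fun X.coassoc x
  have h2 : ∀ t : X.carrier ⊗[k] DualBialg k H,
      evCoactTwo k H X.carrier (TensorProduct.assoc k _ _ _ (X.coact.rTensor _ t)) (h ⊗ₜ h') =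
        X.hact h (evCoact k H X.carrier t h') := by
    intro t
    induction t with
    | zero => simp
    | add x y hx hy => simp only [map_add, LinearMap.add_apply, hx, hy]
    | tmul c f => simp [evCoactTwo_assoc, hact_eq]
  have h3 := h2 (X.coact x)
  have h4 := evCoactTwo_comul (X.coact x) h h'
  rw [hact_eq, hact_eq X h', ← h4, ← h3]
  exact congrArg (fun t => evCoactTwo k H X.carrier t (h ⊗ₜ h')) h1.symm

/-- An element of `Y ⊗ H^*` is determined by its evaluations at all `h`; this is where finite
dimension enters, through `evCoact_injective`. -/
lemma colinear_iff (X Y : Comod k (DualBialg k H)) (f : X.carrier →ₗ[k] Y.carrier) :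
    Y.coact ∘ₗ f = f.rTensor _ ∘ₗ X.coact ↔ ∀ h x, f (X.hact h x) = Y.hact h (f x) := by
  constructor
  · intro w h x
    have h1 := LinearMap.congr_fun w x
    rw [LinearMap.comp_apply, LinearMap.comp_apply] at h1
    rw [hact_eq, hact_eq, ← evCoact_rTensor, h1]
  · intro w
    ext x
    apply evCoact_injective
    ext h
    rw [LinearMap.comp_apply, LinearMap.comp_apply, evCoact_rTensor]
    exact (w h x).symm

lemma hom_hact {X Y : Comod k (DualBialg k H)} (f : X ⟶ Y) (h : H) (x : X.carrier) :
    Hom.lin f (X.hact h x) = Y.hact h (Hom.lin f x) :=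
  (colinear_iff X Y (Hom.lin f)).1 f.colinear h x

lemma hact_act_tmul (X Y : Comod k (DualBialg k H)) (h : H) (x : X.carrier) (y : Y.carrier) :
    (act X Y).hact h (x ⊗ₜ[k] y) =
      TensorProduct.map (X.ev x) (Y.ev y) (Coalgebra.comul (R := k) h) :=
  -- `evCoact_shuffle` presupposes an `H`-module structure on its first factor; the action read off
  -- from the coaction serves.
  letI := actionModule X.hact X.hact_one X.hact_mul
  haveI := actionModule_isScalarTower X.hact X.hact_one X.hact_mul
  evCoact_shuffle (X.coact x) (Y.coact y) h

/-- The action of `H ⊗ H` on a tensor product of `H^*`-comodules. -/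
def hact₂ (X Y : Comod k (DualBialg k H)) :
    H ⊗[k] H →ₗ[k] X.carrier ⊗[k] Y.carrier →ₗ[k] X.carrier ⊗[k] Y.carrier :=
  TensorProduct.homTensorHomMap (RingHom.id k) _ _ _ _ ∘ₗ TensorProduct.map X.hact Y.hact

/-- An operator form of the diagonal action `h(x ⊗ y) = h₁x ⊗ h₂y`. It is needed because the action
will be applied to values of coactions, which are not pure tensors. -/
lemma hact_act (X Y : Comod k (DualBialg k H)) (h : H) :
    (act X Y).hact h = hact₂ X Y (Coalgebra.comul (R := k) h) := by
  refine TensorProduct.ext' fun x y => (hact_act_tmul X Y h x y).trans ?_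
  have h1 : TensorProduct.map (X.ev x) (Y.ev y) =
      (hact₂ X Y).flip (x ⊗ₜ y) := TensorProduct.ext' fun _ _ => rfl
  exact LinearMap.congr_fun h1 _

section OfModule

variable (k H) (W : Type u) [AddCommGroup W] [Module k W] [Module H W] [IsScalarTower k H W]

/-- The right `H^*`-comodule given by a left `H`-module. -/
def ofMod : Comod k (DualBialg k H) where
  carrier := W
  coact := dualCoact k H W
  coassoc := LinearMap.ext dualCoact_coassoc
  counit := LinearMap.ext dualCoact_counit

@[simp] lemma hact_ofMod (h : H) (w : W) : (ofMod k H W).hact h w = h • w :=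
  evCoact_dualCoact (k := k) (H := H) (C := W) w h

end OfModule

section OfAction

variable {W : Type u} [AddCommGroup W] [Module k W] (a : H →ₗ[k] W →ₗ[k] W)
  (h_one : ∀ w, a 1 w = w) (h_mul : ∀ h h' w, a (h * h') w = a h (a h' w))

/-- The right `H^*`-comodule given by an action of `H`. -/
def ofAction : Comod k (DualBialg k H) :=
  letI := actionModule a h_one h_mul
  haveI := actionModule_isScalarTower a h_one h_mul
  { carrier := W
    coact := dualCoact k H W
    coassoc := LinearMap.ext dualCoact_coassoc
    counit := LinearMap.ext dualCoact_counit }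

lemma hact_ofAction (h : H) (w : W) : (ofAction a h_one h_mul).hact h w = a h w :=
  letI := actionModule a h_one h_mul
  haveI := actionModule_isScalarTower a h_one h_mul
  evCoact_dualCoact (k := k) (H := H) (C := W) w h

end OfAction

end DualComodules

end Comod

/-! ### Subcomodules, and tensoring a comodule with a vector space -/

namespace Comod

variable {k C : Type u} [Field k] [AddCommGroup C] [Module k C] [Coalgebra k C]

/-- The counit splits the coaction. -/
lemma coact_injective (M : Comod k C) : Function.Injective M.coact := by
  intro x y w
  have h1 : ∀ z, (Coalgebra.counit (R := k)).lTensor M.carrier (M.coact z) = z ⊗ₜ 1 :=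
    LinearMap.congr_fun M.counit
  have h2 := (h1 x).symm.trans ((congrArg _ w).trans (h1 y))
  simpa using congrArg (TensorProduct.rid k _) h2

/-- A subspace of a comodule to which the coaction restricts is a comodule. -/
def ofInjective (E : Comod k C) {W : Type u} [AddCommGroup W] [Module k W]
    (i : W →ₗ[k] E.carrier) (hi : Function.Injective i) (κ : W →ₗ[k] W ⊗[k] C)
    (hκ : E.coact ∘ₗ i = i.rTensor C ∘ₗ κ) : Comod k C where
  carrier := W
  coact := κ
  coassoc := by
    -- Tensoring over a field preserves injectivity, so the axiom may be tested inside `E ⊗ (C ⊗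
    -- C)`, where it follows from the axiom for `E`.
    have h0 : Function.Injective (i.rTensor (C ⊗[k] C)) :=
      Module.Flat.rTensor_preserves_injective_linearMap i hi
    refine LinearMap.ext fun w => h0 ?_
    have e1 : i.rTensor (C ⊗[k] C) ∘ₗ (TensorProduct.assoc k W C C).toLinearMap =
        (TensorProduct.assoc k E.carrier C C).toLinearMap ∘ₗ (i.rTensor C).rTensor C := by
      ext; rfl
    have e2 : i.rTensor (C ⊗[k] C) ∘ₗ Coalgebra.comul.lTensor W =
        Coalgebra.comul.lTensor E.carrier ∘ₗ i.rTensor C := by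
      ext; rfl
    have e3 : (i.rTensor C).rTensor C ∘ₗ κ.rTensor C = E.coact.rTensor C ∘ₗ i.rTensor C := by
      rw [← LinearMap.rTensor_comp, ← hκ, LinearMap.rTensor_comp]
    have e4 := LinearMap.congr_fun hκ w
    have e5 := LinearMap.congr_fun E.coassoc (i w)
    replace e1 := LinearMap.congr_fun e1 (κ.rTensor C (κ w))
    replace e2 := LinearMap.congr_fun e2 (κ w)
    replace e3 := LinearMap.congr_fun e3 (κ w)
    simp only [LinearMap.comp_apply] at e1 e2 e3 e4 e5 ⊢
    rw [e1, e2, e3, ← e4, e5]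
  counit := by
    have h0 : Function.Injective (i.rTensor k) :=
      Module.Flat.rTensor_preserves_injective_linearMap i hi
    refine LinearMap.ext fun w => h0 ?_
    have e2 : i.rTensor k ∘ₗ (Coalgebra.counit (R := k)).lTensor W =
        (Coalgebra.counit (R := k)).lTensor E.carrier ∘ₗ i.rTensor C := by
      ext; rfl
    have e3 : i.rTensor k ∘ₗ ((Coalgebra.counit (R := k)).lTensor W ∘ₗ κ) =
        i.rTensor k ∘ₗ (TensorProduct.mk k W k).flip 1 := by
      rw [← LinearMap.comp_assoc, e2, LinearMap.comp_assoc, ← hκ, ← LinearMap.comp_assoc, E.counit]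
      ext; rfl
    exact LinearMap.congr_fun e3 w

/-- The comodule `W ⊗ M` with coaction `w ⊗ m ↦ (w ⊗ m₍₀₎) ⊗ m₍₁₎`. -/
def vact (W : Type u) [AddCommGroup W] [Module k W] (M : Comod k C) : Comod k C where
  carrier := W ⊗[k] M.carrier
  coact := (TensorProduct.assoc k W M.carrier C).symm.toLinearMap ∘ₗ M.coact.lTensor W
  coassoc := by
    refine TensorProduct.ext' fun w m => ?_
    have e1 : (TensorProduct.assoc k (W ⊗[k] M.carrier) C C).toLinearMap ∘ₗ
        ((TensorProduct.assoc k W M.carrier C).symm.toLinearMap ∘ₗ M.coact.lTensor W).rTensor C ∘ₗ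
        (TensorProduct.assoc k W M.carrier C).symm.toLinearMap ∘ₗ TensorProduct.mk k W _ w =
        (TensorProduct.assoc k W M.carrier (C ⊗[k] C)).symm.toLinearMap ∘ₗ
        TensorProduct.mk k W _ w ∘ₗ
        (TensorProduct.assoc k M.carrier C C).toLinearMap ∘ₗ M.coact.rTensor C := by
      refine TensorProduct.ext' fun m c => ?_
      simp only [LinearMap.comp_apply, TensorProduct.mk_apply, LinearEquiv.coe_coe,
        TensorProduct.assoc_symm_tmul, LinearMap.rTensor_tmul, LinearMap.lTensor_tmul]
      induction M.coact m with
      | zero => simp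
      | add x y hx hy => simp only [TensorProduct.tmul_add, TensorProduct.add_tmul, map_add, hx, hy]
      | tmul => rfl
    have e2 : Coalgebra.comul.lTensor (W ⊗[k] M.carrier) ∘ₗ
        (TensorProduct.assoc k W M.carrier C).symm.toLinearMap ∘ₗ TensorProduct.mk k W _ w =
        (TensorProduct.assoc k W M.carrier (C ⊗[k] C)).symm.toLinearMap ∘ₗ
        TensorProduct.mk k W _ w ∘ₗ Coalgebra.comul.lTensor M.carrier := by
      ext; rfl
    have e3 := LinearMap.congr_fun e1 (M.coact m)
    have e4 := LinearMap.congr_fun e2 (M.coact m)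
    have e5 := LinearMap.congr_fun M.coassoc m
    simp only [LinearMap.comp_apply] at e3 e4 e5
    rw [e5] at e3
    exact e3.trans e4.symm
  counit := by
    refine TensorProduct.ext' fun w m => ?_
    have e2 : (Coalgebra.counit (R := k)).lTensor (W ⊗[k] M.carrier) ∘ₗ
        (TensorProduct.assoc k W M.carrier C).symm.toLinearMap ∘ₗ TensorProduct.mk k W _ w =
        (TensorProduct.assoc k W M.carrier k).symm.toLinearMap ∘ₗ
        TensorProduct.mk k W _ w ∘ₗ (Coalgebra.counit (R := k)).lTensor M.carrier := by
      ext; rfl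
    have e4 := LinearMap.congr_fun e2 (M.coact m)
    have e5 := LinearMap.congr_fun M.counit m
    simp only [LinearMap.comp_apply] at e4 e5
    rw [e5] at e4
    exact e4

/-- The comparison `(W ⊗ W') ⊗ M → W ⊗ (W' ⊗ M)`. -/
def vactAssoc (W W' : Type u) [AddCommGroup W] [Module k W] [AddCommGroup W'] [Module k W']
    (M : Comod k C) : vact (W ⊗[k] W') M ⟶ vact W (vact W' M) where
  lin := (TensorProduct.assoc k W W' M.carrier).toLinearMap
  colinear := by
    refine TensorProduct.ext_threefold fun w w' m => ?_
    have h1 : ∀ t : M.carrier ⊗[k] C,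
        (TensorProduct.assoc k W (W' ⊗[k] M.carrier) C).symm
          (w ⊗ₜ (TensorProduct.assoc k W' M.carrier C).symm (w' ⊗ₜ t)) =
        (TensorProduct.assoc k W W' M.carrier).toLinearMap.rTensor C
          ((TensorProduct.assoc k (W ⊗[k] W') M.carrier C).symm ((w ⊗ₜ w') ⊗ₜ t)) := by
      intro t
      induction t with
      | zero => simp
      | add x y hx hy => simp only [map_add, TensorProduct.tmul_add, hx, hy]
      | tmul => rfl
    exact h1 (M.coact m)

/-- The comparison `k ⊗ M → M`. -/
def vactUnit (M : Comod k C) : vact k M ⟶ M where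
  lin := (TensorProduct.lid k M.carrier).toLinearMap
  colinear := by
    refine TensorProduct.ext' fun (a : k) m => ?_
    have h1 : ∀ t : M.carrier ⊗[k] C, (TensorProduct.lid k M.carrier).toLinearMap.rTensor C
        ((TensorProduct.assoc k k M.carrier C).symm (a ⊗ₜ t)) = a • t := by
      intro t
      induction t with
      | zero => simp
      | add x y hx hy => simp only [map_add, TensorProduct.tmul_add, smul_add, hx, hy]
      | tmul => rfl
    exact (M.coact.map_smul a m).trans (h1 (M.coact m)).symm

end Comod

/-! ### Doi–Hopf modules as a module category over `M^{H^*}` -/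

/-- Doi–Hopf modules over a left `H`-module coalgebra `C`, `H` being finite-dimensional: right
`C`-comodules in the monoidal category of right `H^*`-comodules. -/
structure DoiHopf (k H C : Type u) [Field k] [Ring H] [Bialgebra k H] [FiniteDimensional k H]
    [AddCommGroup C] [Module k C] [Module H C] [IsScalarTower k H C] [Coalgebra k C]
    [IsModuleCoalgebra k H C] where
  /-- The underlying `H^*`-comodule. -/
  X : Comod k (DualBialg k H)
  /-- The coaction of `C`. -/
  ρ : X.carrier →ₗ[k] X.carrier ⊗[k] C
  coassoc : (TensorProduct.assoc k X.carrier C C).toLinearMap ∘ₗ ρ.rTensor C ∘ₗ ρ =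
    Coalgebra.comul.lTensor X.carrier ∘ₗ ρ
  counit : (Coalgebra.counit (R := k)).lTensor X.carrier ∘ₗ ρ =
    (TensorProduct.mk k X.carrier k).flip 1
  colinear : (Comod.act X (Comod.ofMod k H C)).coact ∘ₗ ρ = ρ.rTensor _ ∘ₗ X.coact

namespace DoiHopf

variable {k H C : Type u} [Field k] [Ring H] [Bialgebra k H] [FiniteDimensional k H]
    [AddCommGroup C] [Module k C] [Module H C] [IsScalarTower k H C] [Coalgebra k C]
    [IsModuleCoalgebra k H C]

/-- The coaction of `C` as a morphism of `H^*`-comodules. -/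
def ρHom (M : DoiHopf k H C) : M.X ⟶ Comod.act M.X (Comod.ofMod k H C) := ⟨M.ρ, M.colinear⟩

/-- The underlying `C`-comodule. -/
def toC (M : DoiHopf k H C) : Comod k C where
  carrier := M.X.carrier
  coact := M.ρ
  coassoc := M.coassoc
  counit := M.counit

/-- Morphisms of Doi–Hopf modules. -/
@[ext]
structure Hom (M N : DoiHopf k H C) where
  /-- The underlying linear map. -/
  lin : M.X.carrier →ₗ[k] N.X.carrier
  colinear : N.X.coact ∘ₗ lin = lin.rTensor _ ∘ₗ M.X.coact
  colinear' : N.ρ ∘ₗ lin = lin.rTensor C ∘ₗ M.ρ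

instance : Category (DoiHopf k H C) where
  Hom M N := Hom M N
  id M := ⟨LinearMap.id, by simp, by simp⟩
  comp f g := ⟨g.lin ∘ₗ f.lin, by
    rw [← LinearMap.comp_assoc, g.colinear, LinearMap.comp_assoc, f.colinear,
      ← LinearMap.comp_assoc, LinearMap.rTensor_comp], by
    rw [← LinearMap.comp_assoc, g.colinear', LinearMap.comp_assoc, f.colinear',
      ← LinearMap.comp_assoc, LinearMap.rTensor_comp]⟩

@[simp] lemma id_lin (M : DoiHopf k H C) : Hom.lin (𝟙 M) = LinearMap.id := rfl

@[simp] lemma comp_lin {L M N : DoiHopf k H C} (f : L ⟶ M) (g : M ⟶ N) :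
    Hom.lin (f ≫ g) = Hom.lin g ∘ₗ Hom.lin f := rfl

@[ext] lemma hom_ext {M N : DoiHopf k H C} {f g : M ⟶ N} (h : Hom.lin f = Hom.lin g) : f = g :=
  Hom.ext h

/-- The underlying morphism of `H^*`-comodules. -/
def Hom.toX {M N : DoiHopf k H C} (f : M ⟶ N) : M.X ⟶ N.X := ⟨Hom.lin f, Hom.colinear f⟩

/-- The underlying morphism of `C`-comodules. -/
def Hom.toC {M N : DoiHopf k H C} (f : M ⟶ N) : M.toC ⟶ N.toC := ⟨Hom.lin f, Hom.colinear' f⟩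

/-- A bijective morphism is an isomorphism. -/
def isoMk {M N : DoiHopf k H C} (e : M.X.carrier ≃ₗ[k] N.X.carrier)
    (h : N.X.coact ∘ₗ e.toLinearMap = e.toLinearMap.rTensor _ ∘ₗ M.X.coact)
    (h' : N.ρ ∘ₗ e.toLinearMap = e.toLinearMap.rTensor C ∘ₗ M.ρ) : M ≅ N where
  hom := ⟨e.toLinearMap, h, h'⟩
  inv := ⟨e.symm.toLinearMap, (Comod.isoMk (M := M.X) (N := N.X) e h).inv.colinear,
    (Comod.isoMk (M := M.toC) (N := N.toC) e h').inv.colinear⟩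
  hom_inv_id := by ext x; simp
  inv_hom_id := by ext x; simp

/-- The action of an `H^*`-comodule on a Doi–Hopf module. -/
def act (X : Comod k (DualBialg k H)) (M : DoiHopf k H C) : DoiHopf k H C where
  X := Comod.act X M.X
  ρ := (Comod.vact X.carrier M.toC).coact
  coassoc := (Comod.vact X.carrier M.toC).coassoc
  counit := (Comod.vact X.carrier M.toC).counit
  -- The coaction is the composite `X ⊗ M → X ⊗ (M ⊗ C) → (X ⊗ M) ⊗ C` of two morphisms of
  -- `M^{H^*}`.
  colinear := (Comod.actMap (𝟙 X) M.ρHom ≫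
    (Comod.actAssoc X M.X (Comod.ofMod k H C)).inv).colinear

/-- The action of a pair of morphisms. -/
def actMap {X X' : Comod k (DualBialg k H)} {M M' : DoiHopf k H C} (f : X ⟶ X') (g : M ⟶ M') :
    act X M ⟶ act X' M' where
  lin := TensorProduct.map (Comod.Hom.lin f) (Hom.lin g)
  colinear := (Comod.actMap f (Hom.toX g)).colinear
  colinear' := by
    refine TensorProduct.ext' fun x m => ?_
    have h1 : ∀ t : M.X.carrier ⊗[k] C,
        (TensorProduct.assoc k X'.carrier M'.X.carrier C).symm
          (Comod.Hom.lin f x ⊗ₜ (Hom.lin g).rTensor C t) =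
        (TensorProduct.map (Comod.Hom.lin f) (Hom.lin g)).rTensor C
          ((TensorProduct.assoc k X.carrier M.X.carrier C).symm (x ⊗ₜ t)) := by
      intro t
      induction t with
      | zero => simp
      | add x y hx hy => simp only [map_add, TensorProduct.tmul_add, hx, hy]
      | tmul => rfl
    refine Eq.trans ?_ (h1 (M.ρ m))
    rw [← LinearMap.comp_apply ((Hom.lin g).rTensor C), ← Hom.colinear' g]
    rfl

/-- The isomorphism `(X ⊗ Y) ⊗ M ≅ X ⊗ (Y ⊗ M)`. -/
def actAssoc (X Y : Comod k (DualBialg k H)) (M : DoiHopf k H C) :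
    act (Comod.act X Y) M ≅ act X (act Y M) :=
  isoMk (TensorProduct.assoc k X.carrier Y.carrier M.X.carrier)
    (Comod.actAssoc X Y M.X).hom.colinear (Comod.vactAssoc X.carrier Y.carrier M.toC).colinear

/-- The isomorphism `k ⊗ M ≅ M`. -/
def actUnit (M : DoiHopf k H C) : act (Comod.unitObj k (DualBialg k H)) M ≅ M :=
  isoMk (TensorProduct.lid k M.X.carrier)
    (Comod.actUnit (H := DualBialg k H) M.X).hom.colinear (Comod.vactUnit M.toC).colinear

instance : MonoidalLeftAction (Comod k (DualBialg k H)) (DoiHopf k H C) where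
  actionObj X M := act X M
  actionHomLeft f M := actMap f (𝟙 M)
  actionHomRight X _ _ f := actMap (𝟙 X) f
  actionHom f g := actMap f g
  actionAssocIso X Y M := actAssoc X Y M
  actionUnitIso M := actUnit M
  actionHom_def _ _ := hom_ext (TensorProduct.ext' fun _ _ => rfl)
  actionHomRight_id _ _ := hom_ext (TensorProduct.ext' fun _ _ => rfl)
  id_actionHomLeft _ _ := hom_ext (TensorProduct.ext' fun _ _ => rfl)
  actionHom_comp _ _ _ _ := hom_ext (TensorProduct.ext' fun _ _ => rfl)
  actionAssocIso_hom_naturality _ _ _ := hom_ext (TensorProduct.ext_threefold fun _ _ _ => rfl)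
  actionUnitIso_hom_naturality f := hom_ext (TensorProduct.ext' fun (a : k) x =>
    (Hom.lin f).map_smul a x)
  whiskerLeft_actionHomLeft _ _ _ _ _ := hom_ext (TensorProduct.ext_threefold fun _ _ _ => rfl)
  whiskerRight_actionHomLeft _ _ _ := hom_ext (TensorProduct.ext_threefold fun _ _ _ => rfl)
  associator_actionHom _ _ _ _ := hom_ext (TensorProduct.ext_fourfold fun _ _ _ _ => rfl)
  leftUnitor_actionHom _ _ := hom_ext (TensorProduct.ext_threefold fun (a : k) x m =>
    TensorProduct.smul_tmul' a x m)
  rightUnitor_actionHom _ _ := hom_ext (TensorProduct.ext_threefold fun x (a : k) m =>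
    TensorProduct.smul_tmul a x m)

end DoiHopf

/-! ### Lax module equivalences: symmetry, transitivity, invertible structure morphisms -/

section

open MonoidalLeftAction Functor.LaxLeftLinear

section ModuleFunctors


universe v₁ v₂ v₃ v₄ u₁ u₂ u₃ u₄

variable {V : Type u₁} [Category.{v₁} V] [MonoidalCategory V]
  {M : Type u₂} [Category.{v₂} M] [MonoidalLeftAction V M]
  {N : Type u₃} [Category.{v₃} N] [MonoidalLeftAction V N]
  {P : Type u₄} [Category.{v₄} P] [MonoidalLeftAction V P]

lemma ModuleCategoryEquivalent.symm (h : ModuleCategoryEquivalent V M N) :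
    ModuleCategoryEquivalent V N M := by
  obtain ⟨F, G, hF, hG, η, ε, hη, hε⟩ := h
  exact ⟨G, F, hG, hF, ε, η, hε, hη⟩

lemma comp_μₗ (F : M ⥤ N) (G : N ⥤ P) [F.LaxLeftLinear V] [G.LaxLeftLinear V] (X : V) (m : M) :
    μₗ (F ⋙ G) X m = μₗ G X (F.obj m) ≫ G.map (μₗ F X m) := rfl

lemma id_μₗ (X : V) (m : M) : μₗ (𝟭 M) X m = 𝟙 _ := rfl

/-- The isomorphism `(F₁ F₂) (G₂ G₁) ≅ F₁ G₁ ≅ 𝟭`. -/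
def compUnitIso {F₁ : M ⥤ N} {F₂ : N ⥤ P} {G₁ : N ⥤ M} {G₂ : P ⥤ N} (η₁ : F₁ ⋙ G₁ ≅ 𝟭 M)
    (η₂ : F₂ ⋙ G₂ ≅ 𝟭 N) : (F₁ ⋙ F₂) ⋙ (G₂ ⋙ G₁) ≅ 𝟭 M :=
  NatIso.ofComponents (fun m => G₁.mapIso (η₂.app (F₁.obj m)) ≪≫ η₁.app m) (by
    intro m m' f
    have h1 := η₂.hom.naturality (F₁.map f)
    have h2 := η₁.hom.naturality f
    simp only [Functor.comp_map, Functor.id_map] at h1 h2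
    simp only [Functor.comp_map, Functor.id_map, Iso.trans_hom, Functor.mapIso_hom, Iso.app_hom,
      Category.assoc]
    rw [← h2, ← Functor.map_comp_assoc, h1, Functor.map_comp_assoc])

/-- The compatibility and naturality of `η₂` absorb the structure morphisms of `F₂` and `G₂` inside
`G₁`; naturality of the structure of `G₁` then reduces the claim to the compatibility of `η₁`. -/
lemma isModuleNatTrans_compUnitIso {F₁ : M ⥤ N} {F₂ : N ⥤ P} {G₁ : N ⥤ M} {G₂ : P ⥤ N}
    [F₁.LaxLeftLinear V] [F₂.LaxLeftLinear V] [G₁.LaxLeftLinear V] [G₂.LaxLeftLinear V]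
    (η₁ : F₁ ⋙ G₁ ≅ 𝟭 M) (η₂ : F₂ ⋙ G₂ ≅ 𝟭 N)
    (h₁ : IsModuleNatTrans V η₁.hom) (h₂ : IsModuleNatTrans V η₂.hom) :
    IsModuleNatTrans V (compUnitIso η₁ η₂).hom := by
  intro X m
  have h1 := h₁ X m
  have h2 := h₂ X (F₁.obj m)
  have h3 := η₂.hom.naturality (μₗ F₁ X m)
  simp only [comp_μₗ, id_μₗ, Category.comp_id, Category.assoc, Functor.comp_map,
    Functor.id_map] at h1 h2 h3 ⊢
  have key : μₗ G₂ X (F₂.obj (F₁.obj m)) ≫ G₂.map (μₗ F₂ X (F₁.obj m) ≫ F₂.map (μₗ F₁ X m)) ≫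
      η₂.hom.app (F₁.obj (X ⊙ₗ m)) = X ⊴ₗ η₂.hom.app (F₁.obj m) ≫ μₗ F₁ X m := by
    rw [← h2, Functor.map_comp, Category.assoc, Category.assoc, Category.assoc]
    exact congrArg (fun f => _ ≫ _ ≫ f) h3
  have key₂ := μₗ_naturality_right G₁ X (η₂.hom.app (F₁.obj m))
  calc _ = μₗ G₁ X (G₂.obj (F₂.obj (F₁.obj m))) ≫ G₁.map (μₗ G₂ X (F₂.obj (F₁.obj m)) ≫
        G₂.map (μₗ F₂ X (F₁.obj m) ≫ F₂.map (μₗ F₁ X m)) ≫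
          η₂.hom.app (F₁.obj (X ⊙ₗ m))) ≫ η₁.hom.app (X ⊙ₗ m) := by
        simp [compUnitIso]
    _ = μₗ G₁ X (G₂.obj (F₂.obj (F₁.obj m))) ≫ G₁.map (X ⊴ₗ η₂.hom.app (F₁.obj m)) ≫
        G₁.map (μₗ F₁ X m) ≫ η₁.hom.app (X ⊙ₗ m) := by
      rw [key, Functor.map_comp, Category.assoc]
    _ = X ⊴ₗ G₁.map (η₂.hom.app (F₁.obj m)) ≫ X ⊴ₗ η₁.hom.app m := by
      rw [← h1]
      exact (Category.assoc _ _ _).symm.trans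
        ((congrArg (fun f => f ≫ _) key₂.symm).trans (Category.assoc _ _ _))
    _ = _ := by
      rw [← actionHomRight_comp]
      rfl

lemma ModuleCategoryEquivalent.trans (h : ModuleCategoryEquivalent V M N)
    (h' : ModuleCategoryEquivalent V N P) : ModuleCategoryEquivalent V M P := by
  obtain ⟨F, G, hF, hG, η, ε, hη, hε⟩ := h
  obtain ⟨F', G', hF', hG', η', ε', hη', hε'⟩ := h'
  exact ⟨F ⋙ F', G' ⋙ G, inferInstance, inferInstance, compUnitIso η η', compUnitIso ε' ε,
    isModuleNatTrans_compUnitIso η η' hη hη', isModuleNatTrans_compUnitIso ε' ε hε' hε⟩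

/-- Compatibility with `η` and `ε` makes the structure morphisms of both composites invertible. From
`G ⋙ F`, the structure morphism of `F` is mono at objects `G(n)`, hence at every object by
naturality along `η`. From `F ⋙ G`, its image under `G` is a split epimorphism. That image is thus
an isomorphism, and the equivalence `G` reflects it. So lax equivalences are automatically strong,
which the passage from Doi–Hopf modules back to comodules depends on. -/
lemma isIso_μₗ (F : M ⥤ N) (G : N ⥤ M) [F.LaxLeftLinear V] [G.LaxLeftLinear V]
    (η : F ⋙ G ≅ 𝟭 M) (ε : G ⋙ F ≅ 𝟭 N) (hη : IsModuleNatTrans V η.hom)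
    (hε : IsModuleNatTrans V ε.hom) (X : V) (m : M) : IsIso (μₗ F X m) := by
  have : F.IsEquivalence := (CategoryTheory.Equivalence.mk F G η.symm ε).isEquivalence_functor
  have : G.IsEquivalence := (CategoryTheory.Equivalence.mk F G η.symm ε).isEquivalence_inverse
  have iso1 : ∀ m, IsIso (μₗ (F ⋙ G) X m) := by
    intro m
    have h1 := hη X m
    rw [id_μₗ, Category.comp_id, ← IsIso.eq_comp_inv] at h1
    rw [h1]
    infer_instance
  have iso2 : ∀ n, IsIso (μₗ (G ⋙ F) X n) := by
    intro n
    have h1 := hε X n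
    rw [id_μₗ, Category.comp_id, ← IsIso.eq_comp_inv] at h1
    rw [h1]
    infer_instance
  have mono1 : ∀ n, Mono (μₗ F X (G.obj n)) := fun n => by
    have := iso2 n
    rw [comp_μₗ] at this
    exact mono_of_mono _ (F.map (μₗ G X n))
  have mono2 : Mono (μₗ F X m) := by
    have h1 := μₗ_naturality_right F X (η.inv.app m)
    have h2 : Mono (μₗ F X m ≫ F.map (X ⊴ₗ η.inv.app m)) := by
      have := mono1 (F.obj m)
      exact h1 ▸ mono_comp (X ⊴ₗ F.map (η.inv.app m)) (μₗ F X (G.obj (F.obj m)))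
    exact mono_of_mono _ (F.map (X ⊴ₗ η.inv.app m))
  have split : IsSplitEpi (G.map (μₗ F X m)) := by
    have := iso1 m
    rw [comp_μₗ] at this
    exact ⟨⟨⟨inv (μₗ G X (F.obj m) ≫ G.map (μₗ F X m)) ≫ μₗ G X (F.obj m), by simp⟩⟩⟩
  have := isIso_of_mono_of_isSplitEpi (G.map (μₗ F X m))
  exact isIso_of_reflects_iso _ G

end ModuleFunctors

end

/-! ### The two projections of the cosmash product -/

section CosmashProjections

variable (k H C : Type u) [Field k] [Ring H] [Bialgebra k H] [FiniteDimensional k H]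
  [AddCommGroup C] [Module k C] [Module H C] [IsScalarTower k H C] [Coalgebra k C]

/-- The projection `H^* # C → C`, `f ⊗ c ↦ f(1) c`. -/
def cosmashToC : DualBialg k H ⊗[k] C →ₗ[k] C :=
  (TensorProduct.lid k C).toLinearMap ∘ₗ (Coalgebra.counit (R := k)).rTensor C

/-- The projection `H^* # C → H^*`, `f ⊗ c ↦ ε(c) f`. -/
def cosmashToDual : DualBialg k H ⊗[k] C →ₗ[k] DualBialg k H :=
  (TensorProduct.rid k _).toLinearMap ∘ₗ (Coalgebra.counit (R := k)).lTensor _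

variable {k H C}

@[simp] lemma cosmashToC_tmul (f : DualBialg k H) (c : C) :
    cosmashToC k H C (f ⊗ₜ c) = Coalgebra.counit (R := k) f • c := rfl

@[simp] lemma cosmashToDual_tmul (f : DualBialg k H) (c : C) :
    cosmashToDual k H C (f ⊗ₜ c) = Coalgebra.counit (R := k) c • f := rfl

lemma cosmashToC_smul (f : DualBialg k H) (w : DualBialg k H ⊗[k] C) :
    cosmashToC k H C (f • w) = Coalgebra.counit (R := k) f • cosmashToC k H C w := by
  induction w with
  | zero => simp
  | add x y hx hy => simp only [smul_add, map_add, hx, hy]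
  | tmul g c => simp [TensorProduct.smul_tmul', mul_smul]

lemma cosmashToDual_smul (f : DualBialg k H) (w : DualBialg k H ⊗[k] C) :
    cosmashToDual k H C (f • w) = f * cosmashToDual k H C w := by
  induction w with
  | zero => simp
  | add x y hx hy => simp only [smul_add, map_add, mul_add, hx, hy]
  | tmul g c => simp [TensorProduct.smul_tmul']

lemma cosmashCounit_eq (z : DualBialg k H ⊗[k] C) :
    cosmashCounit k H C z = Coalgebra.counit (R := k) (cosmashToC k H C z) := by
  induction z with
  | zero => simp
  | add x y hx hy => simp only [map_add, hx, hy]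
  | tmul f c => simp [cosmashCounit]

lemma cosmashCounit_eq' (z : DualBialg k H ⊗[k] C) :
    cosmashCounit k H C z = Coalgebra.counit (R := k) (cosmashToDual k H C z) := by
  induction z with
  | zero => simp
  | add x y hx hy => simp only [map_add, hx, hy]
  | tmul f c => simp [cosmashCounit, mul_comm]

lemma lTensor_cosmashToC_assoc (s : C ⊗[k] DualBialg k H) (c : C) :
    (cosmashToC k H C).lTensor C (TensorProduct.assoc k C (DualBialg k H) C (s ⊗ₜ c)) =
      TensorProduct.rid k C ((Coalgebra.counit (R := k)).lTensor C s) ⊗ₜ c := by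
  induction s with
  | zero => simp
  | add x y hx hy => simp only [TensorProduct.add_tmul, map_add, hx, hy]
  | tmul p g => simp [TensorProduct.smul_tmul]

lemma lTensor_cosmashToDual_assoc (s : C ⊗[k] DualBialg k H) (c : C) :
    (cosmashToDual k H C).lTensor C (TensorProduct.assoc k C (DualBialg k H) C (s ⊗ₜ c)) =
      Coalgebra.counit (R := k) c • s := by
  induction s with
  | zero => simp
  | add x y hx hy => simp only [TensorProduct.add_tmul, map_add, smul_add, hx, hy]
  | tmul p g => simp

variable [IsModuleCoalgebra k H C]

lemma lTensor_cosmashToC_cosmashCoact (c : C) :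
    (cosmashToC k H C).lTensor C (cosmashCoact k H C c) = Coalgebra.comul (R := k) c := by
  simp only [cosmashCoact, LinearMap.comp_apply, LinearEquiv.coe_coe]
  induction Coalgebra.comul (R := k) c with
  | zero => simp
  | add x y hx hy => simp only [map_add, hx, hy]
  | tmul x z => rw [LinearMap.rTensor_tmul, lTensor_cosmashToC_assoc, dualCoact_counit]; simp

lemma lTensor_cosmashToDual_cosmashCoact (c : C) :
    (cosmashToDual k H C).lTensor C (cosmashCoact k H C c) = dualCoact k H C c := by
  have h0 := congrArg (TensorProduct.rid k C) (Coalgebra.lTensor_counit_comul (R := k) c)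
  rw [TensorProduct.rid_tmul, one_smul] at h0
  conv_rhs => rw [← h0]
  simp only [cosmashCoact, LinearMap.comp_apply, LinearEquiv.coe_coe]
  induction Coalgebra.comul (R := k) c with
  | zero => simp
  | add x y hx hy => simp only [map_add, hx, hy]
  | tmul x z => rw [LinearMap.rTensor_tmul, lTensor_cosmashToDual_assoc]; simp

lemma map_cosmashComul {A B : Type u} [AddCommGroup A] [Module k A] [AddCommGroup B] [Module k B]
    (α : DualBialg k H ⊗[k] C →ₗ[k] A) (β : DualBialg k H ⊗[k] C →ₗ[k] B) (f : DualBialg k H)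
    (c : C) :
    TensorProduct.map α β (cosmashComul k H C (f ⊗ₜ c)) =
      TensorProduct.map α β (Comod.shuffle k (DualBialg k H) (DualBialg k H ⊗[k] C)
        (DualBialg k H) C (Coalgebra.comul (R := k) f ⊗ₜ cosmashCoact k H C c)) := rfl

/-- The counit of `H^*` is multiplicative, so the projection discards `f₂` and `c_[1]` separately;
discarding `c_[1]` is evaluation at `1 ∈ H`, which acts as the identity. -/
lemma cosmashToC_comul (z : DualBialg k H ⊗[k] C) :
    TensorProduct.map (cosmashToC k H C) (cosmashToC k H C) (cosmashComul k H C z) =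
      Coalgebra.comul (R := k) (cosmashToC k H C z) := by
  induction z with
  | zero => simp
  | add x y hx hy => simp only [map_add, hx, hy]
  | tmul f c =>
    rw [map_cosmashComul]
    have h1 : ∀ (t : DualBialg k H ⊗[k] DualBialg k H) (s : C ⊗[k] (DualBialg k H ⊗[k] C)),
        TensorProduct.map (cosmashToC k H C) (cosmashToC k H C)
          (Comod.shuffle k (DualBialg k H) (DualBialg k H ⊗[k] C) (DualBialg k H) C (t ⊗ₜ s)) =
        Coalgebra.counit (R := k) (TensorProduct.lid k _ (Coalgebra.counit.rTensor _ t)) •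
          (cosmashToC k H C).lTensor C s := by
      intro t s
      induction t with
      | zero => simp
      | add x y hx hy => simp only [TensorProduct.add_tmul, map_add, add_smul, hx, hy]
      | tmul f g =>
        induction s with
        | zero => simp
        | add x y hx hy => simp only [TensorProduct.tmul_add, map_add, smul_add, hx, hy]
        | tmul c w =>
          rw [Comod.shuffle_tmul, TensorProduct.map_tmul, cosmashToC_smul, cosmashToC_tmul,
            TensorProduct.smul_tmul_smul]
          simp [TensorProduct.smul_tmul']
    rw [h1, lTensor_cosmashToC_cosmashCoact, Coalgebra.rTensor_counit_comul]
    simp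

/-- Applying the counit of `C` leaves `f₁ ⊗ f₂ ⋆ ε(c_[0])c_[1]`, and `ε(c_[0])c_[1] = ε(c)1` is the
dual form of `ε(hc) = ε(h)ε(c)`. -/
lemma cosmashToDual_comul (z : DualBialg k H ⊗[k] C) :
    TensorProduct.map (cosmashToDual k H C) (cosmashToDual k H C) (cosmashComul k H C z) =
      Coalgebra.comul (R := k) (cosmashToDual k H C z) := by
  induction z with
  | zero => simp
  | add x y hx hy => simp only [map_add, hx, hy]
  | tmul f c =>
    rw [map_cosmashComul]
    have h1 : ∀ (t : DualBialg k H ⊗[k] DualBialg k H) (s : C ⊗[k] (DualBialg k H ⊗[k] C)),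
        TensorProduct.map (cosmashToDual k H C) (cosmashToDual k H C)
          (Comod.shuffle k (DualBialg k H) (DualBialg k H ⊗[k] C) (DualBialg k H) C (t ⊗ₜ s)) =
        t * ((1 : DualBialg k H) ⊗ₜ[k] TensorProduct.lid k _ ((Coalgebra.counit (R := k)).rTensor _
          ((cosmashToDual k H C).lTensor C s))) := by
      intro t s
      induction t with
      | zero => simp
      | add x y hx hy => simp only [TensorProduct.add_tmul, map_add, add_mul, hx, hy]
      | tmul f g =>
        induction s with
        | zero => simp
        | add x y hx hy => simp only [TensorProduct.tmul_add, map_add, mul_add, hx, hy]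
        | tmul c w =>
          rw [Comod.shuffle_tmul, TensorProduct.map_tmul, cosmashToDual_smul, cosmashToDual_tmul]
          simp [TensorProduct.smul_tmul]
    rw [h1, lTensor_cosmashToDual_cosmashCoact, dualCoact_counit_left]
    simp [← Algebra.TensorProduct.one_def]

/-- The twist in the comultiplication disappears in this order, since the second projection kills
it. As a consequence a comodule over the cosmash product is determined by its two corestrictions, to
`H^*` and to `C`. -/
lemma cosmashToDual_cosmashToC_comul (z : DualBialg k H ⊗[k] C) :
    TensorProduct.map (cosmashToDual k H C) (cosmashToC k H C) (cosmashComul k H C z) = z := by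
  induction z with
  | zero => simp
  | add x y hx hy => simp only [map_add, hx, hy]
  | tmul f c =>
    rw [map_cosmashComul]
    have h1 : ∀ (t : DualBialg k H ⊗[k] DualBialg k H) (s : C ⊗[k] (DualBialg k H ⊗[k] C)),
        TensorProduct.map (cosmashToDual k H C) (cosmashToC k H C)
          (Comod.shuffle k (DualBialg k H) (DualBialg k H ⊗[k] C) (DualBialg k H) C (t ⊗ₜ s)) =
        TensorProduct.rid k _ (Coalgebra.counit.lTensor _ t) ⊗ₜ[k]
          TensorProduct.lid k _ ((Coalgebra.counit (R := k)).rTensor _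
          ((cosmashToC k H C).lTensor C s)) := by
      intro t s
      induction t with
      | zero => simp
      | add x y hx hy => simp only [TensorProduct.add_tmul, map_add, hx, hy]
      | tmul f g =>
        induction s with
        | zero => simp
        | add x y hx hy => simp only [TensorProduct.tmul_add, map_add, hx, hy]
        | tmul c w =>
          rw [Comod.shuffle_tmul, TensorProduct.map_tmul, cosmashToC_smul, cosmashToDual_tmul,
            TensorProduct.smul_tmul_smul]
          simp [TensorProduct.smul_tmul', mul_smul]
    rw [h1, lTensor_cosmashToC_cosmashCoact, Coalgebra.rTensor_counit_comul,
      Coalgebra.lTensor_counit_comul]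
    simp

variable (k H C) in
/-- The map `H^* ⊗ C → C ⊗ H^*`, `f ⊗ c ↦ c_[0] ⊗ f c_[1]`. -/
def cosmashSwap : DualBialg k H ⊗[k] C →ₗ[k] C ⊗[k] DualBialg k H :=
  (LinearMap.mul' k (DualBialg k H)).lTensor C ∘ₗ
    (TensorProduct.leftComm k (DualBialg k H) C (DualBialg k H)).toLinearMap ∘ₗ
    (dualCoact k H C).lTensor (DualBialg k H)

/-- In the opposite order the twist survives. Together with the previous identity this measures how
the two corestrictions of a comodule fail to commute, and that is the compatibility condition of a
Doi–Hopf module. -/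
lemma cosmashToC_cosmashToDual_comul (z : DualBialg k H ⊗[k] C) :
    TensorProduct.map (cosmashToC k H C) (cosmashToDual k H C) (cosmashComul k H C z) =
      cosmashSwap k H C z := by
  induction z with
  | zero => simp
  | add x y hx hy => simp only [map_add, hx, hy]
  | tmul f c =>
    rw [map_cosmashComul]
    have h1 : ∀ (t : DualBialg k H ⊗[k] DualBialg k H) (s : C ⊗[k] (DualBialg k H ⊗[k] C)),
        TensorProduct.map (cosmashToC k H C) (cosmashToDual k H C)
          (Comod.shuffle k (DualBialg k H) (DualBialg k H ⊗[k] C) (DualBialg k H) C (t ⊗ₜ s)) =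
        (LinearMap.mul' k (DualBialg k H)).lTensor C
          (TensorProduct.leftComm k (DualBialg k H) C (DualBialg k H)
            (TensorProduct.lid k _ (Coalgebra.counit.rTensor _ t) ⊗ₜ[k]
              (cosmashToDual k H C).lTensor C s)) := by
      intro t s
      induction t with
      | zero => simp
      | add x y hx hy => simp only [TensorProduct.add_tmul, map_add, hx, hy]
      | tmul f g =>
        induction s with
        | zero => simp
        | add x y hx hy => simp only [TensorProduct.tmul_add, map_add, hx, hy]
        | tmul c w =>
          rw [Comod.shuffle_tmul, TensorProduct.map_tmul, cosmashToDual_smul, cosmashToC_tmul]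
          simp [TensorProduct.smul_tmul]
    rw [h1, lTensor_cosmashToDual_cosmashCoact, Coalgebra.rTensor_counit_comul]
    simp [cosmashSwap]

end CosmashProjections

/-! ### Doi–Hopf modules and comodules over the cosmash product -/

namespace Comod

/-- The corestriction of a comodule along a coalgebra map. -/
def corestrict {k C D : Type u} [Field k] [AddCommGroup C] [Module k C] [Coalgebra k C]
    [AddCommGroup D] [Module k D] [Coalgebra k D] (φ : C →ₗ[k] D)
    (hΔ : TensorProduct.map φ φ ∘ₗ Coalgebra.comul (R := k) = Coalgebra.comul (R := k) ∘ₗ φ)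
    (hε : Coalgebra.counit (R := k) ∘ₗ φ = Coalgebra.counit (R := k)) (M : Comod k C) :
    Comod k D where
  carrier := M.carrier
  coact := φ.lTensor M.carrier ∘ₗ M.coact
  coassoc := by
    have e1 : (TensorProduct.assoc k M.carrier D D).toLinearMap ∘ₗ
        (φ.lTensor M.carrier).rTensor D ∘ₗ φ.lTensor _ =
        (TensorProduct.map φ φ).lTensor M.carrier ∘ₗ
          (TensorProduct.assoc k M.carrier C C).toLinearMap := by
      ext; rfl
    have e2 : M.coact.rTensor D ∘ₗ φ.lTensor M.carrier =
        φ.lTensor _ ∘ₗ M.coact.rTensor C := by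
      ext; rfl
    calc _ = (TensorProduct.assoc k M.carrier D D).toLinearMap ∘ₗ
          (φ.lTensor M.carrier).rTensor D ∘ₗ (M.coact.rTensor D ∘ₗ φ.lTensor M.carrier) ∘ₗ
            M.coact := by
          rw [LinearMap.rTensor_comp]; rfl
      _ = ((TensorProduct.assoc k M.carrier D D).toLinearMap ∘ₗ
          (φ.lTensor M.carrier).rTensor D ∘ₗ φ.lTensor _) ∘ₗ M.coact.rTensor C ∘ₗ M.coact := by
          rw [e2]; rfl
      _ = (TensorProduct.map φ φ).lTensor M.carrier ∘ₗ
          (TensorProduct.assoc k M.carrier C C).toLinearMap ∘ₗ M.coact.rTensor C ∘ₗ M.coact := by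
          rw [e1]; rfl
      _ = _ := by
          rw [M.coassoc, ← LinearMap.comp_assoc, ← LinearMap.lTensor_comp, hΔ,
            LinearMap.lTensor_comp, LinearMap.comp_assoc]
  counit := by
    rw [← LinearMap.comp_assoc, ← LinearMap.lTensor_comp, hε, M.counit]

end Comod

namespace DoiHopf

variable (k H C : Type u) [Field k] [Ring H] [Bialgebra k H] [FiniteDimensional k H]
    [AddCommGroup C] [Module k C] [Module H C] [IsScalarTower k H C] [Coalgebra k C]
    [IsModuleCoalgebra k H C]

/-- The projection `H^* # C → C` on the type of the cosmash product. -/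
def projC : Cosmash k H C →ₗ[k] C := cosmashToC k H C

/-- The projection `H^* # C → H^*` on the type of the cosmash product. -/
def projDual : Cosmash k H C →ₗ[k] DualBialg k H := cosmashToDual k H C

lemma map_projC_comul : TensorProduct.map (projC k H C) (projC k H C) ∘ₗ
    Coalgebra.comul (R := k) = Coalgebra.comul (R := k) ∘ₗ projC k H C :=
  LinearMap.ext cosmashToC_comul

lemma counit_projC : Coalgebra.counit (R := k) ∘ₗ projC k H C = Coalgebra.counit (R := k) :=
  LinearMap.ext fun z => (cosmashCounit_eq z).symm

lemma map_projDual_comul : TensorProduct.map (projDual k H C) (projDual k H C) ∘ₗ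
    Coalgebra.comul (R := k) = Coalgebra.comul (R := k) ∘ₗ projDual k H C :=
  LinearMap.ext cosmashToDual_comul

lemma counit_projDual :
    Coalgebra.counit (R := k) ∘ₗ projDual k H C = Coalgebra.counit (R := k) :=
  LinearMap.ext fun z => (cosmashCounit_eq' z).symm

/-- `C` as a right comodule over the cosmash product. -/
def selfCosmash : Comod k (Cosmash k H C) where
  carrier := C
  coact := cosmashCoact k H C
  coassoc := LinearMap.ext cosmashCoact_coassoc
  counit := LinearMap.ext cosmashCoact_counit

variable {k H C}

/-- The coaction of the cosmash product on a Doi–Hopf module: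
`m ↦ m₍₀₎[0] ⊗ (m₍₀₎[1] ⊗ m₍₁₎)`. -/
def cosmashCoaction (M : DoiHopf k H C) : M.X.carrier →ₗ[k] M.X.carrier ⊗[k] Cosmash k H C :=
  (TensorProduct.assoc k M.X.carrier (DualBialg k H) C).toLinearMap ∘ₗ M.X.coact.rTensor C ∘ₗ M.ρ

/-- Both sides are `x₀ ⊗ c₁[0] ⊗ x₁c₁[1] ⊗ c₂`, because `H^*` acts on the cosmash product through
its first factor. This brings in the `H^*`-comodule `X ⊗ C`, into which the coaction of a Doi–Hopf
module is a morphism. -/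
lemma act_selfCosmash_coact (X : Comod k (DualBialg k H)) :
    (Comod.act X (selfCosmash k H C)).coact =
      (TensorProduct.assoc k (X.carrier ⊗[k] C) (DualBialg k H) C).toLinearMap ∘ₗ
        (Comod.act X (Comod.ofMod k H C)).coact.rTensor C ∘ₗ
        (TensorProduct.assoc k X.carrier C C).symm.toLinearMap ∘ₗ
        Coalgebra.comul.lTensor X.carrier := by
  refine TensorProduct.ext' fun x c => ?_
  have e1 : ∀ (t : X.carrier ⊗[k] DualBialg k H) (s : C ⊗[k] DualBialg k H) (d : C),
      Comod.shuffle k (DualBialg k H) (DualBialg k H ⊗[k] C) X.carrier C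
        (t ⊗ₜ TensorProduct.assoc k C (DualBialg k H) C (s ⊗ₜ d)) =
      TensorProduct.assoc k (X.carrier ⊗[k] C) (DualBialg k H) C
        (Comod.shuffle k (DualBialg k H) (DualBialg k H) X.carrier C (t ⊗ₜ s) ⊗ₜ d) := by
    intro t s d
    induction t with
    | zero => simp
    | add x y hx hy => simp only [TensorProduct.add_tmul, map_add, hx, hy]
    | tmul x f =>
      induction s with
      | zero => simp
      | add x y hx hy => simp only [TensorProduct.tmul_add, TensorProduct.add_tmul, map_add, hx, hy]
      | tmul c g => simp [TensorProduct.smul_tmul']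
  have e2 : ∀ r : C ⊗[k] C,
      Comod.shuffle k (DualBialg k H) (DualBialg k H ⊗[k] C) X.carrier C
        (X.coact x ⊗ₜ TensorProduct.assoc k C (DualBialg k H) C ((dualCoact k H C).rTensor C r)) =
      TensorProduct.assoc k (X.carrier ⊗[k] C) (DualBialg k H) C
        ((Comod.shuffle k (DualBialg k H) (DualBialg k H) X.carrier C ∘ₗ
          TensorProduct.map X.coact (dualCoact k H C)).rTensor C
          ((TensorProduct.assoc k X.carrier C C).symm (x ⊗ₜ r))) := by
    intro r
    induction r with
    | zero => simp
    | add x y hx hy => simp only [TensorProduct.tmul_add, map_add, hx, hy]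
    | tmul c d => exact e1 _ _ _
  exact e2 (Coalgebra.comul (R := k) c)

/-- Coassociativity of `ρ` and its `H^*`-colinearity are both used here. The lemma exhibits `M`,
through the injective `ρ`, inside the known comodule `X ⊗ C`, so that `toCosmash` inherits the
comodule axioms from `ofInjective`. -/
lemma act_selfCosmash_coact_comp (M : DoiHopf k H C) :
    (Comod.act M.X (selfCosmash k H C)).coact ∘ₗ M.ρ =
      M.ρ.rTensor _ ∘ₗ M.cosmashCoaction := by
  have e1 : (TensorProduct.assoc k (M.X.carrier ⊗[k] C) (DualBialg k H) C).toLinearMap ∘ₗ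
      (M.ρ.rTensor (DualBialg k H)).rTensor C = M.ρ.rTensor (DualBialg k H ⊗[k] C) ∘ₗ
        (TensorProduct.assoc k M.X.carrier (DualBialg k H) C).toLinearMap := by
    ext; rfl
  have e2 : (TensorProduct.assoc k M.X.carrier C C).symm.toLinearMap ∘ₗ
      Coalgebra.comul.lTensor M.X.carrier ∘ₗ M.ρ = M.ρ.rTensor C ∘ₗ M.ρ := by
    rw [← M.coassoc, ← LinearMap.comp_assoc]
    simp
  have key : ∀ α : M.X.carrier ⊗[k] C →ₗ[k] (M.X.carrier ⊗[k] C) ⊗[k] DualBialg k H,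
      α ∘ₗ M.ρ = M.ρ.rTensor _ ∘ₗ M.X.coact →
      ((TensorProduct.assoc k (M.X.carrier ⊗[k] C) (DualBialg k H) C).toLinearMap ∘ₗ
        α.rTensor C ∘ₗ (TensorProduct.assoc k M.X.carrier C C).symm.toLinearMap ∘ₗ
        Coalgebra.comul.lTensor M.X.carrier) ∘ₗ M.ρ = M.ρ.rTensor _ ∘ₗ M.cosmashCoaction := by
    intro α hα
    calc _ = (TensorProduct.assoc k (M.X.carrier ⊗[k] C) (DualBialg k H) C).toLinearMap ∘ₗ
          α.rTensor C ∘ₗ ((TensorProduct.assoc k M.X.carrier C C).symm.toLinearMap ∘ₗ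
          Coalgebra.comul.lTensor M.X.carrier ∘ₗ M.ρ) := rfl
      _ = (TensorProduct.assoc k (M.X.carrier ⊗[k] C) (DualBialg k H) C).toLinearMap ∘ₗ
          (α ∘ₗ M.ρ).rTensor C ∘ₗ M.ρ := by
          rw [e2, LinearMap.rTensor_comp]; rfl
      _ = ((TensorProduct.assoc k (M.X.carrier ⊗[k] C) (DualBialg k H) C).toLinearMap ∘ₗ
          (M.ρ.rTensor (DualBialg k H)).rTensor C) ∘ₗ M.X.coact.rTensor C ∘ₗ M.ρ := by
          rw [hα, LinearMap.rTensor_comp]; rfl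
      _ = _ := by rw [e1]; rfl
  exact (congrArg (fun f => f ∘ₗ M.ρ) (act_selfCosmash_coact M.X)).trans (key _ M.colinear)

lemma ρ_injective (M : DoiHopf k H C) : Function.Injective M.ρ := M.toC.coact_injective

/-- The comodule over the cosmash product given by a Doi–Hopf module. -/
def toCosmash (M : DoiHopf k H C) : Comod k (Cosmash k H C) :=
  Comod.ofInjective (Comod.act M.X (selfCosmash k H C)) M.ρ M.ρ_injective M.cosmashCoaction
    M.act_selfCosmash_coact_comp

/-- The Doi–Hopf module given by a comodule over the cosmash product. -/
def ofCosmash (M : Comod k (Cosmash k H C)) : DoiHopf k H C where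
  X := M.corestrict (projDual k H C) (map_projDual_comul k H C) (counit_projDual k H C)
  ρ := (projC k H C).lTensor M.carrier ∘ₗ M.coact
  coassoc := (M.corestrict (projC k H C) (map_projC_comul k H C) (counit_projC k H C)).coassoc
  counit := (M.corestrict (projC k H C) (map_projC_comul k H C) (counit_projC k H C)).counit
  colinear := by
    have e1 : (Comod.shuffle k (DualBialg k H) (DualBialg k H) M.carrier C) ∘ₗ
        TensorProduct.map ((projDual k H C).lTensor M.carrier) (dualCoact k H C ∘ₗ projC k H C) =
        (TensorProduct.assoc k M.carrier C (DualBialg k H)).symm.toLinearMap ∘ₗ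
        (cosmashSwap k H C ∘ₗ TensorProduct.map (projDual k H C) (projC k H C)).lTensor _ ∘ₗ
        (TensorProduct.assoc k M.carrier (Cosmash k H C) (Cosmash k H C)).toLinearMap := by
      refine TensorProduct.ext_threefold fun m z z' => ?_
      have h1 : ∀ s : C ⊗[k] DualBialg k H,
          (Comod.shuffle k (DualBialg k H) (DualBialg k H) M.carrier C)
            ((m ⊗ₜ projDual k H C z) ⊗ₜ s) =
          (TensorProduct.assoc k M.carrier C (DualBialg k H)).symm
            (m ⊗ₜ ((LinearMap.mul' k (DualBialg k H)).lTensor C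
              (TensorProduct.leftComm k (DualBialg k H) C (DualBialg k H)
              (projDual k H C z ⊗ₜ s)))) := by
        intro s
        induction s with
        | zero => simp
        | add x y hx hy => simp only [TensorProduct.tmul_add, map_add, hx, hy]
        | tmul c g => rfl
      exact h1 _
    -- Coacting first by `C` and then diagonally by `H^*` is, by `e1`, the swap applied to the two
    -- projections of the iterated coaction; coassociativity of `M` makes them the projections of a
    -- comultiplied element, on which the swap reverses their order.
    have e2 : cosmashSwap k H C ∘ₗ TensorProduct.map (projDual k H C) (projC k H C) ∘ₗ
        Coalgebra.comul (R := k) (A := Cosmash k H C) =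
        TensorProduct.map (projC k H C) (projDual k H C) ∘ₗ Coalgebra.comul (R := k) := by
      refine LinearMap.ext fun z => ?_
      refine Eq.trans (congrArg (cosmashSwap k H C) (cosmashToDual_cosmashToC_comul z)) ?_
      exact (cosmashToC_cosmashToDual_comul z).symm
    have e3 : (TensorProduct.assoc k M.carrier C (DualBialg k H)).symm.toLinearMap ∘ₗ
        (TensorProduct.map (projC k H C) (projDual k H C)).lTensor _ ∘ₗ
        (TensorProduct.assoc k M.carrier (Cosmash k H C) (Cosmash k H C)).toLinearMap =
        TensorProduct.map ((projC k H C).lTensor M.carrier) (projDual k H C) := by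
      ext; rfl
    calc _ = ((Comod.shuffle k (DualBialg k H) (DualBialg k H) M.carrier C) ∘ₗ
        TensorProduct.map ((projDual k H C).lTensor M.carrier) (dualCoact k H C ∘ₗ projC k H C)) ∘ₗ
        M.coact.rTensor _ ∘ₗ M.coact := by
          have h1 : TensorProduct.map ((projDual k H C).lTensor M.carrier ∘ₗ M.coact)
              (dualCoact k H C) ∘ₗ (projC k H C).lTensor M.carrier =
              TensorProduct.map ((projDual k H C).lTensor M.carrier)
                (dualCoact k H C ∘ₗ projC k H C) ∘ₗ M.coact.rTensor _ := by
            ext; rfl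
          exact congrArg (fun f => Comod.shuffle k (DualBialg k H) (DualBialg k H) M.carrier C ∘ₗ
            f ∘ₗ M.coact) h1
      _ = (TensorProduct.assoc k M.carrier C (DualBialg k H)).symm.toLinearMap ∘ₗ
        (cosmashSwap k H C ∘ₗ TensorProduct.map (projDual k H C) (projC k H C)).lTensor _ ∘ₗ
        (TensorProduct.assoc k M.carrier (Cosmash k H C) (Cosmash k H C)).toLinearMap ∘ₗ
        M.coact.rTensor _ ∘ₗ M.coact := by rw [e1]; rfl
      _ = (TensorProduct.assoc k M.carrier C (DualBialg k H)).symm.toLinearMap ∘ₗ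
        (TensorProduct.map (projC k H C) (projDual k H C)).lTensor _ ∘ₗ
        (TensorProduct.assoc k M.carrier (Cosmash k H C) (Cosmash k H C)).toLinearMap ∘ₗ
        M.coact.rTensor _ ∘ₗ M.coact := by
          rw [M.coassoc]
          have h1 := congrArg (LinearMap.lTensor M.carrier) e2
          rw [← LinearMap.comp_assoc, LinearMap.lTensor_comp, LinearMap.lTensor_comp _ _
            (Coalgebra.comul (R := k))] at h1
          exact congrArg (fun f => (TensorProduct.assoc k M.carrier C
            (DualBialg k H)).symm.toLinearMap ∘ₗ f ∘ₗ M.coact) h1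
      _ = TensorProduct.map ((projC k H C).lTensor M.carrier) (projDual k H C) ∘ₗ
          M.coact.rTensor _ ∘ₗ M.coact := by rw [← e3]; rfl
      _ = _ := by
          have h1 : TensorProduct.map ((projC k H C).lTensor M.carrier) (projDual k H C) ∘ₗ
              M.coact.rTensor _ = ((projC k H C).lTensor M.carrier ∘ₗ M.coact).rTensor _ ∘ₗ
              (projDual k H C).lTensor M.carrier := by
            ext; rfl
          exact congrArg (fun f => f ∘ₗ M.coact) h1

end DoiHopf

namespace Comod

/-- The corestriction of a morphism of comodules along a coalgebra map. -/
def corestrictMap {k C D : Type u} [Field k] [AddCommGroup C] [Module k C] [Coalgebra k C]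
    [AddCommGroup D] [Module k D] [Coalgebra k D] (φ : C →ₗ[k] D)
    (hΔ : TensorProduct.map φ φ ∘ₗ Coalgebra.comul (R := k) = Coalgebra.comul (R := k) ∘ₗ φ)
    (hε : Coalgebra.counit (R := k) ∘ₗ φ = Coalgebra.counit (R := k)) {M N : Comod k C}
    (f : M ⟶ N) : M.corestrict φ hΔ hε ⟶ N.corestrict φ hΔ hε :=
  ⟨Hom.lin (M := M) (N := N) f, by
    have h1 : φ.lTensor N.carrier ∘ₗ (Hom.lin f).rTensor _ =
      (Hom.lin f).rTensor _ ∘ₗ φ.lTensor M.carrier := by ext; rfl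
    refine (congrArg (fun g => φ.lTensor N.carrier ∘ₗ g) (Hom.colinear f)).trans ?_
    exact congrArg (fun g => g ∘ₗ M.coact) h1⟩

end Comod

lemma id_colinear {k C W : Type u} [Field k] [AddCommGroup C] [Module k C] [AddCommGroup W]
    [Module k W] {a b : W →ₗ[k] W ⊗[k] C} (h : b = a) :
    b ∘ₗ LinearMap.id = LinearMap.id.rTensor C ∘ₗ a := by
  rw [LinearMap.comp_id, LinearMap.rTensor_id, LinearMap.id_comp, h]

namespace DoiHopf

open MonoidalLeftAction Functor.LaxLeftLinear

variable {k H C : Type u} [Field k] [Ring H] [Bialgebra k H] [FiniteDimensional k H]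
    [AddCommGroup C] [Module k C] [Module H C] [IsScalarTower k H C] [Coalgebra k C]
    [IsModuleCoalgebra k H C]

lemma cosmashCoaction_natural {M N : DoiHopf k H C} (f : M ⟶ N) :
    N.cosmashCoaction ∘ₗ Hom.lin f = (Hom.lin f).rTensor _ ∘ₗ M.cosmashCoaction := by
  have e1 : (TensorProduct.assoc k N.X.carrier (DualBialg k H) C).toLinearMap ∘ₗ
      ((Hom.lin f).rTensor (DualBialg k H)).rTensor C =
        (Hom.lin f).rTensor (DualBialg k H ⊗[k] C) ∘ₗ
        (TensorProduct.assoc k M.X.carrier (DualBialg k H) C).toLinearMap := by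
    ext; rfl
  calc _ = (TensorProduct.assoc k N.X.carrier (DualBialg k H) C).toLinearMap ∘ₗ
        N.X.coact.rTensor C ∘ₗ (N.ρ ∘ₗ Hom.lin f) := rfl
    _ = (TensorProduct.assoc k N.X.carrier (DualBialg k H) C).toLinearMap ∘ₗ
        (N.X.coact ∘ₗ Hom.lin f).rTensor C ∘ₗ M.ρ := by
        rw [Hom.colinear', LinearMap.rTensor_comp]; rfl
    _ = ((TensorProduct.assoc k N.X.carrier (DualBialg k H) C).toLinearMap ∘ₗ
      ((Hom.lin f).rTensor (DualBialg k H)).rTensor C) ∘ₗ M.X.coact.rTensor C ∘ₗ M.ρ := by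
        rw [Hom.colinear, LinearMap.rTensor_comp]; rfl
    _ = _ := by rw [e1]; rfl

lemma projC_cosmashCoaction (M : DoiHopf k H C) :
    (projC k H C).lTensor M.X.carrier ∘ₗ M.cosmashCoaction = M.ρ := by
  have h1 : ∀ (t : M.X.carrier ⊗[k] DualBialg k H) (c : C),
      (cosmashToC k H C).lTensor M.X.carrier (TensorProduct.assoc k _ _ _ (t ⊗ₜ c)) =
        TensorProduct.rid k _ ((Coalgebra.counit (R := k)).lTensor _ t) ⊗ₜ c := by
    intro t c
    induction t with
    | zero => simp
    | add x y hx hy => simp only [TensorProduct.add_tmul, map_add, hx, hy]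
    | tmul x f =>
      change x ⊗ₜ[k] (Coalgebra.counit (R := k) f • c) = (Coalgebra.counit (R := k) f • x) ⊗ₜ[k] c
      rw [TensorProduct.smul_tmul]
  have h2 : (projC k H C).lTensor M.X.carrier ∘ₗ
      (TensorProduct.assoc k M.X.carrier (DualBialg k H) C).toLinearMap ∘ₗ M.X.coact.rTensor C =
        LinearMap.id := by
    refine TensorProduct.ext' fun x c => (h1 (M.X.coact x) c).trans ?_
    have h3 := LinearMap.congr_fun M.X.counit x
    simp only [LinearMap.comp_apply] at h3
    rw [h3]
    simp
  calc _ = ((projC k H C).lTensor M.X.carrier ∘ₗ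
      (TensorProduct.assoc k M.X.carrier (DualBialg k H) C).toLinearMap ∘ₗ
      M.X.coact.rTensor C) ∘ₗ M.ρ := rfl
    _ = _ := by rw [h2]; rfl

lemma projDual_cosmashCoaction (M : DoiHopf k H C) :
    (projDual k H C).lTensor M.X.carrier ∘ₗ M.cosmashCoaction = M.X.coact := by
  have h1 : ∀ (t : M.X.carrier ⊗[k] DualBialg k H) (c : C),
      (cosmashToDual k H C).lTensor M.X.carrier (TensorProduct.assoc k _ _ _ (t ⊗ₜ c)) =
        Coalgebra.counit (R := k) c • t := by
    intro t c
    induction t with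
    | zero => simp
    | add x y hx hy => simp only [TensorProduct.add_tmul, map_add, smul_add, hx, hy]
    | tmul x f =>
      change x ⊗ₜ[k] (Coalgebra.counit (R := k) c • f) = Coalgebra.counit (R := k) c • (x ⊗ₜ[k] f)
      rw [TensorProduct.tmul_smul]
  have h2 : (projDual k H C).lTensor M.X.carrier ∘ₗ
      (TensorProduct.assoc k M.X.carrier (DualBialg k H) C).toLinearMap ∘ₗ M.X.coact.rTensor C =
        M.X.coact ∘ₗ (TensorProduct.rid k M.X.carrier).toLinearMap ∘ₗ
          (Coalgebra.counit (R := k)).lTensor _ := by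
    refine TensorProduct.ext' fun x c => (h1 (M.X.coact x) c).trans ?_
    simp
  calc _ = ((projDual k H C).lTensor M.X.carrier ∘ₗ
      (TensorProduct.assoc k M.X.carrier (DualBialg k H) C).toLinearMap ∘ₗ
      M.X.coact.rTensor C) ∘ₗ M.ρ := rfl
    _ = M.X.coact ∘ₗ (TensorProduct.rid k M.X.carrier).toLinearMap ∘ₗ
          (Coalgebra.counit (R := k)).lTensor _ ∘ₗ M.ρ := by rw [h2]; rfl
    _ = _ := by
      rw [M.counit]
      ext m
      simp

/-- Coassociativity turns the nested corestrictions into the two projections applied after one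
comultiplication, and these recover the element by `cosmashToDual_cosmashToC_comul`. -/
lemma cosmashCoaction_ofCosmash (M : Comod k (Cosmash k H C)) :
    (ofCosmash M).cosmashCoaction = M.coact := by
  have e1 : (TensorProduct.assoc k M.carrier (DualBialg k H) C).toLinearMap ∘ₗ
      ((projDual k H C).lTensor M.carrier ∘ₗ M.coact).rTensor C ∘ₗ
        (projC k H C).lTensor M.carrier =
      (TensorProduct.map (projDual k H C) (projC k H C)).lTensor M.carrier ∘ₗ
        (TensorProduct.assoc k M.carrier (Cosmash k H C) (Cosmash k H C)).toLinearMap ∘ₗ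
          M.coact.rTensor _ := by
    refine TensorProduct.ext' fun m z => ?_
    have h1 : ∀ t : M.carrier ⊗[k] Cosmash k H C,
        TensorProduct.assoc k M.carrier (DualBialg k H) C
          ((projDual k H C).lTensor M.carrier t ⊗ₜ projC k H C z) =
        (TensorProduct.map (projDual k H C) (projC k H C)).lTensor M.carrier
          (TensorProduct.assoc k M.carrier (Cosmash k H C) (Cosmash k H C) (t ⊗ₜ z)) := by
      intro t
      induction t with
      | zero => simp
      | add x y hx hy => simp only [TensorProduct.add_tmul, map_add, hx, hy]
      | tmul => rfl
    exact h1 (M.coact m)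
  have e2 : TensorProduct.map (projDual k H C) (projC k H C) ∘ₗ
      Coalgebra.comul (R := k) (A := Cosmash k H C) = LinearMap.id :=
    LinearMap.ext cosmashToDual_cosmashToC_comul
  calc _ = ((TensorProduct.assoc k M.carrier (DualBialg k H) C).toLinearMap ∘ₗ
      ((projDual k H C).lTensor M.carrier ∘ₗ M.coact).rTensor C ∘ₗ
        (projC k H C).lTensor M.carrier) ∘ₗ M.coact := rfl
    _ = (TensorProduct.map (projDual k H C) (projC k H C)).lTensor M.carrier ∘ₗ
        (TensorProduct.assoc k M.carrier (Cosmash k H C) (Cosmash k H C)).toLinearMap ∘ₗ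
          M.coact.rTensor _ ∘ₗ M.coact := by rw [e1]; rfl
    _ = ((TensorProduct.map (projDual k H C) (projC k H C)).lTensor M.carrier ∘ₗ
        Coalgebra.comul.lTensor M.carrier) ∘ₗ M.coact := by rw [M.coassoc]; rfl
    _ = _ := by
      rw [← LinearMap.lTensor_comp]
      exact (congrArg (fun f => LinearMap.lTensor M.carrier f ∘ₗ M.coact) e2).trans (by
        exact congrArg (fun f => f ∘ₗ M.coact) (LinearMap.lTensor_id M.carrier (Cosmash k H C)))

variable (k H C) in
/-- The functor from Doi–Hopf modules to comodules over the cosmash product. -/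
def toCosmashFunctor : DoiHopf k H C ⥤ Comod k (Cosmash k H C) where
  obj M := M.toCosmash
  map f := ⟨Hom.lin f, cosmashCoaction_natural f⟩

variable (k H C) in
/-- The functor from comodules over the cosmash product to Doi–Hopf modules. -/
def ofCosmashFunctor : Comod k (Cosmash k H C) ⥤ DoiHopf k H C where
  obj M := ofCosmash M
  map {M N} f :=
    { lin := Comod.Hom.lin (M := M) (N := N) f
      colinear := (Comod.corestrictMap _ (map_projDual_comul k H C)
        (counit_projDual k H C) f).colinear
      colinear' := (Comod.corestrictMap _ (map_projC_comul k H C)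
        (counit_projC k H C) f).colinear }

lemma act_cosmashCoaction (X : Comod k (DualBialg k H)) (M : DoiHopf k H C) :
    (act X M).cosmashCoaction = (Comod.act X M.toCosmash).coact := by
  refine TensorProduct.ext' fun x m => ?_
  have e1 : ∀ (t : X.carrier ⊗[k] DualBialg k H) (s : M.X.carrier ⊗[k] DualBialg k H) (d : C),
      Comod.shuffle k (DualBialg k H) (DualBialg k H ⊗[k] C) X.carrier M.X.carrier
        (t ⊗ₜ TensorProduct.assoc k M.X.carrier (DualBialg k H) C (s ⊗ₜ d)) =
      TensorProduct.assoc k (X.carrier ⊗[k] M.X.carrier) (DualBialg k H) C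
        (Comod.shuffle k (DualBialg k H) (DualBialg k H) X.carrier M.X.carrier (t ⊗ₜ s) ⊗ₜ d) := by
    intro t s d
    induction t with
    | zero => simp
    | add x y hx hy => simp only [TensorProduct.add_tmul, map_add, hx, hy]
    | tmul x f =>
      induction s with
      | zero => simp
      | add x y hx hy => simp only [TensorProduct.tmul_add, TensorProduct.add_tmul, map_add, hx, hy]
      | tmul c g => simp [TensorProduct.smul_tmul']
  have e2 : ∀ r : M.X.carrier ⊗[k] C,
      TensorProduct.assoc k (X.carrier ⊗[k] M.X.carrier) (DualBialg k H) C
        ((Comod.shuffle k (DualBialg k H) (DualBialg k H) X.carrier M.X.carrier ∘ₗ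
          TensorProduct.map X.coact M.X.coact).rTensor C
          ((TensorProduct.assoc k X.carrier M.X.carrier C).symm (x ⊗ₜ r))) =
      Comod.shuffle k (DualBialg k H) (DualBialg k H ⊗[k] C) X.carrier M.X.carrier
        (X.coact x ⊗ₜ TensorProduct.assoc k M.X.carrier (DualBialg k H) C
          (M.X.coact.rTensor C r)) := by
    intro r
    induction r with
    | zero => simp
    | add x y hx hy => simp only [TensorProduct.tmul_add, map_add, hx, hy]
    | tmul c d => exact (e1 _ _ _).symm
  exact e2 (M.ρ m)

/-- The two coactions on `X ⊗ M` are equal (`act_cosmashCoaction`), so the identity map serves as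
structure morphism and every axiom holds on pure tensors by definition. -/
instance : (toCosmashFunctor k H C).LaxLeftLinear (Comod k (DualBialg k H)) where
  μₗ X M := ⟨LinearMap.id, id_colinear (act_cosmashCoaction X M)⟩
  μₗ_naturality_left _ _ := Comod.hom_ext (TensorProduct.ext' fun _ _ => rfl)
  μₗ_naturality_right _ _ _ _ := Comod.hom_ext (TensorProduct.ext' fun _ _ => rfl)
  μₗ_associativity _ _ _ := Comod.hom_ext (TensorProduct.ext_threefold fun _ _ _ => rfl)
  μₗ_unitality _ := Comod.hom_ext (TensorProduct.ext' fun _ _ => rfl)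

lemma cosmashCoaction_act_ofCosmash (X : Comod k (DualBialg k H))
    (M : Comod k (Cosmash k H C)) :
    (act X (ofCosmash M)).cosmashCoaction = (Comod.act X M).coact :=
  (act_cosmashCoaction X (ofCosmash M)).trans
    (congrArg (fun f => Comod.shuffle k (DualBialg k H) (Cosmash k H C) X.carrier M.carrier ∘ₗ
      TensorProduct.map X.coact f) (cosmashCoaction_ofCosmash M))

lemma act_ofCosmash_coact (X : Comod k (DualBialg k H)) (M : Comod k (Cosmash k H C)) :
    (ofCosmash (Comod.act X M)).X.coact = (act X (ofCosmash M)).X.coact :=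
  (congrArg (fun f => (projDual k H C).lTensor (X.carrier ⊗[k] M.carrier) ∘ₗ f)
    (cosmashCoaction_act_ofCosmash X M).symm).trans (projDual_cosmashCoaction (act X (ofCosmash M)))

lemma act_ofCosmash_ρ (X : Comod k (DualBialg k H)) (M : Comod k (Cosmash k H C)) :
    (ofCosmash (Comod.act X M)).ρ = (act X (ofCosmash M)).ρ :=
  (congrArg (fun f => (projC k H C).lTensor (X.carrier ⊗[k] M.carrier) ∘ₗ f)
    (cosmashCoaction_act_ofCosmash X M).symm).trans (projC_cosmashCoaction (act X (ofCosmash M)))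

instance : (ofCosmashFunctor k H C).LaxLeftLinear (Comod k (DualBialg k H)) where
  μₗ X M := ⟨LinearMap.id, id_colinear (act_ofCosmash_coact X M),
    id_colinear (act_ofCosmash_ρ X M)⟩
  μₗ_naturality_left _ _ := hom_ext (TensorProduct.ext' fun _ _ => rfl)
  μₗ_naturality_right _ _ _ _ := hom_ext (TensorProduct.ext' fun _ _ => rfl)
  μₗ_associativity _ _ _ := hom_ext (TensorProduct.ext_threefold fun _ _ _ => rfl)
  μₗ_unitality _ := hom_ext (TensorProduct.ext' fun _ _ => rfl)

variable (k H C) in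
/-- Doi–Hopf modules and comodules over the cosmash product are equivalent as module categories
over the monoidal category of `H^*`-comodules. -/
lemma moduleCategoryEquivalent_cosmash :
    ModuleCategoryEquivalent (Comod k (DualBialg k H)) (DoiHopf k H C)
      (Comod k (Cosmash k H C)) := by
  refine ⟨toCosmashFunctor k H C, ofCosmashFunctor k H C, inferInstance, inferInstance,
    NatIso.ofComponents (fun M => isoMk (M := ofCosmash M.toCosmash) (N := M)
      (LinearEquiv.refl k M.X.carrier) (id_colinear (projDual_cosmashCoaction M).symm)
      (id_colinear (projC_cosmashCoaction M).symm)) (fun f => hom_ext rfl),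
    NatIso.ofComponents (fun M => Comod.isoMk (M := (ofCosmash M).toCosmash) (N := M)
      (LinearEquiv.refl k M.carrier) (id_colinear (cosmashCoaction_ofCosmash M).symm))
      (fun f => Comod.hom_ext rfl), ?_, ?_⟩
  · intro X M
    exact hom_ext (TensorProduct.ext' fun _ _ => rfl)
  · intro X M
    exact Comod.hom_ext (TensorProduct.ext' fun _ _ => rfl)

end DoiHopf

/-! ### Doi–Hopf modules as modules over the algebra `H` of `M^H` -/

section

open MonoidalLeftAction Functor.LaxLeftLinear

namespace Comod

variable (k H : Type u) [Field k] [Ring H] [Bialgebra k H]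

/-- The regular comodule. -/
def reg : Comod k H where
  carrier := H
  coact := Coalgebra.comul
  coassoc := Coalgebra.coassoc
  counit := Coalgebra.lTensor_counit_comp_comul

/-- The unit of the algebra `reg k H`. -/
def regUnit : 𝟙_ (Comod k H) ⟶ reg k H where
  lin := (Algebra.linearMap k H : k →ₗ[k] H)
  colinear := by
    have h1 : ∀ c : k, Coalgebra.comul (R := k) (algebraMap k H c) =
        algebraMap k H c ⊗ₜ[k] (1 : H) := fun c => by
      rw [Bialgebra.comul_algebraMap, Algebra.TensorProduct.algebraMap_apply]
    exact LinearMap.ext h1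

/-- The multiplication of the algebra `reg k H`. -/
def regMul : reg k H ⊗ reg k H ⟶ reg k H where
  lin := LinearMap.mul' k H
  colinear := by
    have h1 : ∀ s t : H ⊗[k] H, s * t =
        (LinearMap.mul' k H).rTensor H (shuffle k H H H H (s ⊗ₜ t)) := by
      intro s t
      induction s with
      | zero => simp
      | add x y hx hy => simp only [TensorProduct.add_tmul, map_add, add_mul, hx, hy]
      | tmul a b =>
        induction t with
        | zero => simp
        | add x y hx hy => simp only [TensorProduct.tmul_add, map_add, mul_add, hx, hy]
        | tmul c d => simp
    exact TensorProduct.ext' fun (x y : H) => (Bialgebra.comul_mul (R := k) x y).trans (h1 _ _)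

variable (W W' : Type u) [AddCommGroup W] [Module k W] [AddCommGroup W'] [Module k W']

/-- The trivial comodule `w ↦ w ⊗ 1`. -/
def triv : Comod k H where
  carrier := W
  coact := (TensorProduct.mk k W H).flip 1
  coassoc := by ext; simp [Algebra.TensorProduct.one_def]
  counit := by ext; simp

variable {k W W'} in
/-- A linear map as a morphism of trivial comodules. -/
def trivMap (f : W →ₗ[k] W') : triv k H W ⟶ triv k H W' := ⟨f, by ext; rfl⟩

/-- The comparison of the trivial comodule on a tensor product with the tensor product of trivial
comodules. -/
def trivTensor : triv k H (W ⊗[k] W') ⟶ triv k H W ⊗ triv k H W' where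
  lin := LinearMap.id
  colinear := by
    refine TensorProduct.ext' fun x y => ?_
    change (x ⊗ₜ[k] y) ⊗ₜ[k] ((1 : H) • (1 : H)) = (x ⊗ₜ[k] y) ⊗ₜ[k] (1 : H)
    rw [one_smul]

variable {k} {C : Type u} [AddCommGroup C] [Module k C] [Module H C] [IsScalarTower k H C]
  [Coalgebra k C] [IsModuleCoalgebra k H C]

variable {W W'} in
/-- The functoriality of `vact`. -/
def vactMap (g : W →ₗ[k] W') {M N : Comod k C} (f : M ⟶ N) : vact W M ⟶ vact W' N where
  lin := TensorProduct.map g (Hom.lin f)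
  colinear := by
    refine TensorProduct.ext' fun w m => ?_
    have h1 : ∀ t : M.carrier ⊗[k] C,
        (TensorProduct.assoc k W' N.carrier C).symm (g w ⊗ₜ (Hom.lin f).rTensor C t) =
        (TensorProduct.map g (Hom.lin f)).rTensor C
          ((TensorProduct.assoc k W M.carrier C).symm (w ⊗ₜ t)) := by
      intro t
      induction t with
      | zero => simp
      | add x y hx hy => simp only [map_add, TensorProduct.tmul_add, hx, hy]
      | tmul => rfl
    refine Eq.trans ?_ (h1 (M.coact m))
    exact congrArg (fun t => (TensorProduct.assoc k W' N.carrier C).symm (g w ⊗ₜ t))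
      (LinearMap.congr_fun (Hom.colinear f) m)

/-- The trivial coaction contributes only `1 ∈ H`, which acts as the identity on `C`. So tensoring
with a bare vector space is part of the `M^H`-action, and a lax `M^H`-module functor has comparison
morphisms for it. -/
lemma act_triv_coact (M : Comod k C) : (act (triv k H W) M).coact = (vact W M).coact := by
  refine TensorProduct.ext' fun (w : W) m => ?_
  have h1 : ∀ t : M.carrier ⊗[k] C, shuffle k H C W M.carrier ((w ⊗ₜ (1 : H)) ⊗ₜ t) =
      (TensorProduct.assoc k W M.carrier C).symm (w ⊗ₜ t) := by
    intro t
    induction t with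
    | zero => simp
    | add x y hx hy => simp only [map_add, TensorProduct.tmul_add, hx, hy]
    | tmul m c => simp
  exact h1 (M.coact m)

/-- The action of a trivial comodule. -/
def trivIso (M : Comod k C) : triv k H W ⊙ₗ M ≅ vact W M :=
  isoMk (M := act (triv k H W) M) (N := vact W M) (LinearEquiv.refl k (W ⊗[k] M.carrier))
    (id_colinear (act_triv_coact H W M).symm)

variable {W W' H}

lemma trivIso_inv_naturality {M N : Comod k C} (g : W →ₗ[k] W') (f : M ⟶ N) :
    vactMap g f ≫ (trivIso H W' N).inv =
      (trivIso H W M).inv ≫ (trivMap H g ⊵ₗ M) ≫ (triv k H W' ⊴ₗ f) :=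
  hom_ext (TensorProduct.ext' fun _ _ => rfl)

lemma trivIso_hom_naturality {M N : Comod k C} (g : W →ₗ[k] W') (f : M ⟶ N) :
    (trivIso H W M).hom ≫ vactMap g f =
      (trivMap H g ⊵ₗ M) ≫ (triv k H W' ⊴ₗ f) ≫ (trivIso H W' N).hom :=
  hom_ext (TensorProduct.ext' fun _ _ => rfl)

end Comod

namespace DoiHopf

variable {k H C : Type u} [Field k] [Ring H] [Bialgebra k H] [FiniteDimensional k H]
    [AddCommGroup C] [Module k C] [Module H C] [IsScalarTower k H C] [Coalgebra k C]
    [IsModuleCoalgebra k H C]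

lemma hom_ext_toC {M N : DoiHopf k H C} {f g : M ⟶ N} (h : Hom.toC f = Hom.toC g) : f = g :=
  hom_ext (congrArg Comod.Hom.lin h)

lemma hact₂_ofMod (X : Comod k (DualBialg k H)) (t : H ⊗[k] H) (s : X.carrier ⊗[k] C) :
    Comod.hact₂ X (Comod.ofMod k H C) t s =
      (TensorProduct.lift X.hact).rTensor C (Comod.shuffle k H C H X.carrier (t ⊗ₜ s)) := by
  have h1 : Comod.hact₂ X (Comod.ofMod k H C) =
      TensorProduct.curry ((TensorProduct.lift X.hact).rTensor C ∘ₗ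
        Comod.shuffle k H C H X.carrier) := by
    refine TensorProduct.ext' fun a b => TensorProduct.ext' fun x c => ?_
    exact congrArg (fun d => X.hact a x ⊗ₜ[k] d) (Comod.hact_ofMod k H C b c)
  exact LinearMap.congr_fun (LinearMap.congr_fun h1 t) s

/-- The change of viewpoint on which the proof turns: `ρ(hx) = h₁x₀ ⊗ h₂x₁` says that `ρ` is
`H`-linear, and equally that the action `H ⊗ X → X` is `C`-colinear for the diagonal coaction. -/
lemma colinear_iff (X : Comod k (DualBialg k H)) (ρ : X.carrier →ₗ[k] X.carrier ⊗[k] C) :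
    ((Comod.act X (Comod.ofMod k H C)).coact ∘ₗ ρ = ρ.rTensor _ ∘ₗ X.coact) ↔
      ρ ∘ₗ TensorProduct.lift X.hact = (TensorProduct.lift X.hact).rTensor C ∘ₗ
        Comod.shuffle k H C H X.carrier ∘ₗ TensorProduct.map Coalgebra.comul ρ := by
  have h1 : ∀ h x, (Comod.act X (Comod.ofMod k H C)).hact h (ρ x) =
      (TensorProduct.lift X.hact).rTensor C (Comod.shuffle k H C H X.carrier
        (Coalgebra.comul (R := k) h ⊗ₜ ρ x)) := fun h x =>
    (LinearMap.congr_fun (Comod.hact_act X (Comod.ofMod k H C) h) (ρ x)).trans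
      (hact₂_ofMod X _ (ρ x))
  refine (Comod.colinear_iff X (Comod.act X (Comod.ofMod k H C)) ρ).trans ⟨fun w => ?_, fun w => ?_⟩
  · exact TensorProduct.ext' fun h x => (w h x).trans (h1 h x)
  · exact fun h x => (LinearMap.congr_fun w (h ⊗ₜ x)).trans (h1 h x).symm

/-- The action of `H` on a Doi–Hopf module as a morphism of `C`-comodules. -/
def actionHom (M : DoiHopf k H C) : Comod.reg k H ⊙ₗ M.toC ⟶ M.toC :=
  ⟨TensorProduct.lift M.X.hact, (colinear_iff M.X M.ρ).1 M.colinear⟩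

/-- An action of the algebra `reg k H` on a comodule. -/
structure IsAction {V : Comod k C} (a : Comod.reg k H ⊙ₗ V ⟶ V) : Prop where
  unit : Comod.regUnit k H ⊵ₗ V ≫ a = (λₗ V).hom
  assoc : Comod.regMul k H ⊵ₗ V ≫ a =
    (αₗ _ _ V).hom ≫ Comod.reg k H ⊴ₗ a ≫ a

lemma isAction_actionHom (M : DoiHopf k H C) : IsAction M.actionHom where
  unit := by
    refine Comod.hom_ext (TensorProduct.ext' fun (c : k) m => ?_)
    have h1 : ∀ m : M.X.carrier, M.X.hact (algebraMap k H c) m = c • m := fun m => by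
      rw [Algebra.algebraMap_eq_smul_one, map_smul, LinearMap.smul_apply, M.X.hact_one]
    exact h1 m
  assoc := Comod.hom_ext (TensorProduct.ext_threefold fun h h' m => M.X.hact_mul h h' m)

lemma Hom.actionHom_comp {M N : DoiHopf k H C} (f : M ⟶ N) :
    M.actionHom ≫ Hom.toC f = Comod.reg k H ⊴ₗ Hom.toC f ≫ N.actionHom :=
  Comod.hom_ext (TensorProduct.ext' fun h m => Comod.hom_hact (Hom.toX f) h m)

/-- A morphism of `C`-comodules that commutes with the actions of `H`. -/
def homMk {M N : DoiHopf k H C} (f : M.toC ⟶ N.toC)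
    (w : M.actionHom ≫ f = Comod.reg k H ⊴ₗ f ≫ N.actionHom) : M ⟶ N where
  lin := Comod.Hom.lin (M := M.toC) (N := N.toC) f
  colinear := (Comod.colinear_iff M.X N.X _).2 fun h m =>
    LinearMap.congr_fun (congrArg Comod.Hom.lin w) (h ⊗ₜ[k] m)
  colinear' := Comod.Hom.colinear f

/-- An isomorphism of `C`-comodules that commutes with the actions of `H`. -/
def isoOfToC {M N : DoiHopf k H C} (e : M.toC ≅ N.toC)
    (w : M.actionHom ≫ e.hom = Comod.reg k H ⊴ₗ e.hom ≫ N.actionHom) : M ≅ N where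
  hom := homMk e.hom w
  inv := homMk e.inv (by
    rw [Iso.comp_inv_eq, Category.assoc, w, actionHomRight_inv_hom_assoc])
  hom_inv_id := hom_ext_toC e.hom_inv_id
  inv_hom_id := hom_ext_toC e.inv_hom_id

section OfIsAction

variable {V : Comod k C} {a : Comod.reg k H ⊙ₗ V ⟶ V}

/-- The bilinear map underlying an action. -/
def bilin (a : Comod.reg k H ⊙ₗ V ⟶ V) : H →ₗ[k] V.carrier →ₗ[k] V.carrier :=
  TensorProduct.curry (M := H) (N := V.carrier) (Comod.Hom.lin a)

lemma IsAction.bilin_one (ha : IsAction a) (v : V.carrier) : bilin a 1 v = v := by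
  have h1 : bilin a (algebraMap k H 1) v = (1 : k) • v :=
    LinearMap.congr_fun (congrArg Comod.Hom.lin ha.unit) ((1 : k) ⊗ₜ[k] v)
  rwa [map_one, one_smul] at h1

lemma IsAction.bilin_mul (ha : IsAction a) (h h' : H) (v : V.carrier) :
    bilin a (h * h') v = bilin a h (bilin a h' v) :=
  LinearMap.congr_fun (congrArg Comod.Hom.lin ha.assoc) ((h ⊗ₜ[k] h') ⊗ₜ[k] v)

/-- The `H^*`-comodule given by an action of `reg k H`. -/
def IsAction.dualComod (ha : IsAction a) : Comod k (DualBialg k H) :=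
  Comod.ofAction (bilin a) ha.bilin_one ha.bilin_mul

lemma IsAction.lift_hact (ha : IsAction a) :
    TensorProduct.lift ha.dualComod.hact = Comod.Hom.lin a :=
  TensorProduct.ext' fun h v => Comod.hact_ofAction (bilin a) ha.bilin_one ha.bilin_mul h v

/-- The action recovered from the reconstructed `H^*`-comodule equals the given one by a theorem;
with `b` a variable, this equality can be substituted into the colinearity condition. -/
lemma colinear_of_lift_hact (X : Comod k (DualBialg k H)) {ρ : X.carrier →ₗ[k] X.carrier ⊗[k] C}
    {b : H ⊗[k] X.carrier →ₗ[k] X.carrier} (hb : TensorProduct.lift X.hact = b)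
    (w : ρ ∘ₗ b = b.rTensor C ∘ₗ Comod.shuffle k H C H X.carrier ∘ₗ
      TensorProduct.map Coalgebra.comul ρ) :
    (Comod.act X (Comod.ofMod k H C)).coact ∘ₗ ρ = ρ.rTensor _ ∘ₗ X.coact := by
  subst hb
  exact (colinear_iff X ρ).2 w

/-- The Doi–Hopf module given by a comodule with an action of `reg k H`. -/
def ofIsAction (ha : IsAction a) : DoiHopf k H C where
  X := ha.dualComod
  ρ := V.coact
  coassoc := V.coassoc
  counit := V.counit
  colinear := colinear_of_lift_hact ha.dualComod ha.lift_hact (Comod.Hom.colinear a)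

lemma actionHom_ofIsAction (ha : IsAction a) : (ofIsAction ha).actionHom = a :=
  Comod.hom_ext ha.lift_hact

end OfIsAction

end DoiHopf

end

/-! ### Lifting lax `M^H`-module functors to Doi–Hopf modules -/

section

open MonoidalLeftAction Functor.LaxLeftLinear

section Abstract

universe v₁ v₂ v₃ u₁ u₂ u₃

variable {V : Type u₁} [Category.{v₁} V] [MonoidalCategory V]
  {M : Type u₂} [Category.{v₂} M] [MonoidalLeftAction V M]
  {N : Type u₃} [Category.{v₃} N] [MonoidalLeftAction V N]
  (F : M ⥤ N) [F.LaxLeftLinear V]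

/-- The twist `s` is a morphism of `V`, so naturality of the lax structure in its first variable
carries it across `F`, while the associativity axiom regroups the factors on either side. It serves
with `A` the regular comodule and `T` a trivial one, and yields the `H`-linearity of the comparison.
-/
lemma μₗ_twist {A T : V} {m w : M} {w' : N} (s : A ⊗ T ⟶ T ⊗ A) (a : A ⊙ₗ m ⟶ m)
    (e : T ⊙ₗ m ≅ w) (e' : T ⊙ₗ F.obj m ≅ w') :
    (A ⊴ₗ e'.inv ≫ (αₗ A T (F.obj m)).inv ≫ s ⊵ₗ F.obj m ≫ (αₗ T A (F.obj m)).hom ≫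
      T ⊴ₗ (μₗ F A m ≫ F.map a) ≫ e'.hom) ≫ e'.inv ≫ μₗ F T m ≫ F.map e.hom =
    A ⊴ₗ (e'.inv ≫ μₗ F T m ≫ F.map e.hom) ≫ μₗ F A w ≫
      F.map (A ⊴ₗ e.inv ≫ (αₗ A T m).inv ≫ s ⊵ₗ m ≫ (αₗ T A m).hom ≫ T ⊴ₗ a ≫ e.hom) := by
  have h1 : A ⊴ₗ F.map e.hom ≫ μₗ F A w ≫ F.map (A ⊴ₗ e.inv) = μₗ F A (T ⊙ₗ m) := by
    rw [← μₗ_naturality_right, ← actionHomRight_comp_assoc, ← F.map_comp]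
    simp
  simp only [actionHomRight_comp, F.map_comp, Category.assoc, Iso.hom_inv_id_assoc]
  rw [reassoc_of% h1, μₗ_associativity_inv_assoc, ← μₗ_naturality_left_assoc,
    μₗ_associativity_assoc, μₗ_naturality_right_assoc]

/-- Lax associativity of `F` at `S` and `T`, pulled back along `t` and read through the chosen
identifications; in the application these replace the action of a trivial comodule by the tensor
product with its underlying space. -/
lemma μₗ_comparison_associativity {S T P : V} {m w z z' : M} {w' u₁ u₂ u' : N} (t : P ⟶ S ⊗ T)
    (eT : T ⊙ₗ m ≅ w) (eS : S ⊙ₗ w ≅ z) (eP : P ⊙ₗ m ≅ z') (a : z' ⟶ z)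
    (ha : eP.hom ≫ a = t ⊵ₗ m ≫ (αₗ S T m).hom ≫ S ⊴ₗ eT.hom ≫ eS.hom)
    (eT' : T ⊙ₗ F.obj m ≅ w') (eS₁ : S ⊙ₗ w' ≅ u₁) (eS₂ : S ⊙ₗ F.obj w ≅ u₂)
    (eP' : P ⊙ₗ F.obj m ≅ u') (a' : u' ⟶ u₁)
    (ha' : eP'.hom ≫ a' = t ⊵ₗ F.obj m ≫ (αₗ S T (F.obj m)).hom ≫ S ⊴ₗ eT'.hom ≫ eS₁.hom)
    (b : u₁ ⟶ u₂) (hb : eS₁.hom ≫ b = S ⊴ₗ (eT'.inv ≫ μₗ F T m ≫ F.map eT.hom) ≫ eS₂.hom) :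
    (eP'.inv ≫ μₗ F P m ≫ F.map eP.hom) ≫ F.map a =
      a' ≫ b ≫ eS₂.inv ≫ μₗ F S w ≫ F.map eS.hom := by
  rw [← cancel_epi eP'.hom, reassoc_of% ha', reassoc_of% hb]
  simp only [Category.assoc, Iso.hom_inv_id_assoc, ← F.map_comp]
  rw [ha]
  simp only [F.map_comp]
  rw [← μₗ_naturality_left_assoc, μₗ_associativity_assoc, ← μₗ_naturality_right_assoc,
    ← actionHomRight_comp_assoc]
  simp

lemma μₗ_comparison_unitality {P : V} {m w : M} {w' : N} (i : P ⟶ 𝟙_ V) (e : P ⊙ₗ m ≅ w)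
    (l : w ⟶ m) (hl : e.hom ≫ l = i ⊵ₗ m ≫ (λₗ m).hom) (e' : P ⊙ₗ F.obj m ≅ w')
    (l' : w' ⟶ F.obj m) (hl' : e'.hom ≫ l' = i ⊵ₗ F.obj m ≫ (λₗ (F.obj m)).hom) :
    l' = (e'.inv ≫ μₗ F P m ≫ F.map e.hom) ≫ F.map l := by
  rw [← cancel_epi e'.hom, hl', μₗ_unitality, Category.assoc, Category.assoc,
    Iso.hom_inv_id_assoc, ← F.map_comp, hl, F.map_comp, μₗ_naturality_left_assoc]

variable {F} {G : N ⥤ M} [G.LaxLeftLinear V] {η : F ⋙ G ⟶ 𝟭 M}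

/-- Naturality of `η` at `a`, combined with its compatibility with the structure morphisms. With `A`
the regular comodule it makes the components of `η` commute with `H`; with `A` trivial it makes the
lifted transformation compatible with the comparisons. -/
lemma IsModuleNatTrans.action_naturality (hη : IsModuleNatTrans V η) {A : V} {m n : M}
    (a : A ⊙ₗ m ⟶ n) :
    (μₗ G A (F.obj m) ≫ G.map (μₗ F A m ≫ F.map a)) ≫ η.app n = A ⊴ₗ η.app m ≫ a := by
  have h1 := hη A m
  have h2 := η.naturality a
  rw [comp_μₗ, id_μₗ, Category.comp_id] at h1
  rw [← h1, G.map_comp]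
  simp only [Category.assoc]
  exact congrArg (fun f => μₗ G A (F.obj m) ≫ G.map (μₗ F A m) ≫ f) h2

lemma IsModuleNatTrans.comparison (hη : IsModuleNatTrans V η) {T : V} {m w : M} {w' : N}
    {w'' : M} (e : T ⊙ₗ m ≅ w) (e' : T ⊙ₗ F.obj m ≅ w') (e'' : T ⊙ₗ G.obj (F.obj m) ≅ w'') :
    ((e''.inv ≫ μₗ G T (F.obj m) ≫ G.map e'.hom) ≫ G.map (e'.inv ≫ μₗ F T m ≫ F.map e.hom)) ≫
      η.app w = e''.inv ≫ T ⊴ₗ η.app m ≫ e.hom := by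
  rw [← hη.action_naturality e.hom]
  simp only [Category.assoc, ← G.map_comp_assoc, Iso.hom_inv_id_assoc]

end Abstract

section Twist

variable {k H C : Type u} [Field k] [Ring H] [Bialgebra k H] [FiniteDimensional k H]
    [AddCommGroup C] [Module k C] [Module H C] [IsScalarTower k H C] [Coalgebra k C]
    [IsModuleCoalgebra k H C]

/-- The map `h ⊗ x ↦ h₍₁₎ x ⊗ h₍₂₎`. -/
def twistLin (X : Comod k (DualBialg k H)) : H ⊗[k] X.carrier →ₗ[k] X.carrier ⊗[k] H :=
  TensorProduct.lift (LinearMap.lcomp k (X.carrier ⊗[k] H) (Coalgebra.comul (R := k) (A := H)) ∘ₗ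
    LinearMap.rTensorHom H ∘ₗ X.ev).flip

lemma twistLin_tmul (X : Comod k (DualBialg k H)) (h : H) (x : X.carrier) :
    twistLin X (h ⊗ₜ x) = (X.ev x).rTensor H (Coalgebra.comul (R := k) h) := rfl

/-- The morphism `H ⊗ X → X ⊗ H`, `h ⊗ x ↦ h₍₁₎ x ⊗ h₍₂₎`, where `X` on both sides is
the trivial `H`-comodule. -/
def twist (X : Comod k (DualBialg k H)) :
    Comod.reg k H ⊗ Comod.triv k H X.carrier ⟶ Comod.triv k H X.carrier ⊗ Comod.reg k H where
  lin := twistLin X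
  colinear := by
    refine TensorProduct.ext' fun (h : H) (x : X.carrier) => ?_
    have h1 : ∀ t : H ⊗[k] H,
        (TensorProduct.assoc k X.carrier H H).symm
          ((Coalgebra.comul (R := k) (A := H)).lTensor X.carrier ((X.ev x).rTensor H t)) =
        ((X.ev x).rTensor H).rTensor H ((TensorProduct.assoc k H H H).symm
          ((Coalgebra.comul (R := k) (A := H)).lTensor H t)) := by
      intro t
      induction t with
      | zero => simp
      | add x y hx hy => simp only [map_add, hx, hy]
      | tmul a b =>
        simp only [LinearMap.rTensor_tmul, LinearMap.lTensor_tmul]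
        induction Coalgebra.comul (R := k) b with
        | zero => simp
        | add x y hx hy => simp only [map_add, TensorProduct.tmul_add, hx, hy]
        | tmul => rfl
    have h2 : ∀ t : H ⊗[k] H,
        (twistLin X).rTensor H (Comod.shuffle k H H H X.carrier (t ⊗ₜ (x ⊗ₜ (1 : H)))) =
        ((X.ev x).rTensor H).rTensor H ((Coalgebra.comul (R := k) (A := H)).rTensor H t) := by
      intro t
      induction t with
      | zero => simp
      | add x y hx hy => simp only [map_add, TensorProduct.add_tmul, hx, hy]
      | tmul a b => simp [twistLin_tmul]
    -- Both sides are `h₁x ⊗ h₂ ⊗ h₃`: the trivial coaction does not touch `x`, and what remains is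
    -- coassociativity of `H`.
    have h3 := LinearMap.congr_fun
      (Comod.act_triv_coact H X.carrier (Comod.reg k H)) (twistLin X (h ⊗ₜ x))
    refine h3.trans ((h1 (Coalgebra.comul (R := k) h)).trans ?_)
    refine Eq.trans ?_ (h2 (Coalgebra.comul (R := k) h)).symm
    rw [Coalgebra.coassoc_symm_apply]

/-- The diagonal action `h(x ⊗ m) = h₁x ⊗ h₂m` first moves `h` past `x` by the twist and then acts
on `m`. In this form it consists of morphisms that a lax module functor can transport. -/
lemma actionHom_act (X : Comod k (DualBialg k H)) (M : DoiHopf k H C) :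
    (DoiHopf.act X M).actionHom =
      Comod.reg k H ⊴ₗ (Comod.trivIso H X.carrier M.toC).inv ≫
        (αₗ (Comod.reg k H) (Comod.triv k H X.carrier) M.toC).inv ≫ twist X ⊵ₗ M.toC ≫
        (αₗ (Comod.triv k H X.carrier) (Comod.reg k H) M.toC).hom ≫
        Comod.triv k H X.carrier ⊴ₗ M.actionHom ≫ (Comod.trivIso H X.carrier M.toC).hom := by
  refine Comod.hom_ext (TensorProduct.ext_threefold' fun (h : H) (x : X.carrier) m => ?_)
  have h1 : ∀ t : H ⊗[k] H,
      TensorProduct.map (X.ev x) (M.X.ev m) t =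
      (TensorProduct.lift M.X.hact).lTensor X.carrier
        (TensorProduct.assoc k X.carrier H M.X.carrier ((X.ev x).rTensor H t ⊗ₜ m)) := by
    intro t
    induction t with
    | zero => simp
    | add x y hx hy => simp only [map_add, TensorProduct.add_tmul, hx, hy]
    | tmul a b => rfl
  exact (Comod.hact_act_tmul X M.X h x m).trans (h1 (Coalgebra.comul (R := k) h))

variable (k H) in
/-- The trivial comodule on the ground field is the unit object. -/
def trivUnit : Comod.triv k H k ⟶ 𝟙_ (Comod k H) := ⟨LinearMap.id, by ext; rfl⟩

lemma trivIso_vactMap_id {W : Type u} [AddCommGroup W] [Module k W] {M N : Comod k C}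
    (f : M ⟶ N) : (Comod.trivIso H W M).hom ≫ Comod.vactMap LinearMap.id f =
      Comod.triv k H W ⊴ₗ f ≫ (Comod.trivIso H W N).hom :=
  Comod.hom_ext (TensorProduct.ext' fun _ _ => rfl)

lemma trivIso_inv_vactMap_id {W : Type u} [AddCommGroup W] [Module k W] {M N : Comod k C}
    (f : M ⟶ N) : (Comod.trivIso H W M).inv ≫ Comod.triv k H W ⊴ₗ f ≫ (Comod.trivIso H W N).hom =
      Comod.vactMap LinearMap.id f :=
  Comod.hom_ext (TensorProduct.ext' fun _ _ => rfl)

lemma trivIso_vactUnit (M : Comod k C) :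
    (Comod.trivIso H k M).hom ≫ Comod.vactUnit M = trivUnit k H ⊵ₗ M ≫ (λₗ M).hom :=
  Comod.hom_ext (TensorProduct.ext' fun (_ : k) _ => rfl)

lemma trivIso_vactAssoc (W W' : Type u) [AddCommGroup W] [Module k W] [AddCommGroup W']
    [Module k W'] (M : Comod k C) :
    (Comod.trivIso H (W ⊗[k] W') M).hom ≫ Comod.vactAssoc W W' M =
      Comod.trivTensor k H W W' ⊵ₗ M ≫
        (αₗ (Comod.triv k H W) (Comod.triv k H W') M).hom ≫
        Comod.triv k H W ⊴ₗ (Comod.trivIso H W' M).hom ≫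
        (Comod.trivIso H W (Comod.vact W' M)).hom :=
  Comod.hom_ext (TensorProduct.ext_threefold fun _ _ _ => rfl)

end Twist

section LiftFunctor

variable {k H C D E : Type u} [Field k] [Ring H] [Bialgebra k H] [FiniteDimensional k H]
    [AddCommGroup C] [Module k C] [Module H C] [IsScalarTower k H C] [Coalgebra k C]
    [IsModuleCoalgebra k H C]
    [AddCommGroup D] [Module k D] [Module H D] [IsScalarTower k H D] [Coalgebra k D]
    [IsModuleCoalgebra k H D]

section Objects

variable (F : Comod k C ⥤ Comod k D) [F.LaxLeftLinear (Comod k H)]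

/-- The action of `reg k H` on the image of a Doi–Hopf module. -/
def liftAction (M : DoiHopf k H C) : Comod.reg k H ⊙ₗ F.obj M.toC ⟶ F.obj M.toC :=
  μₗ F (Comod.reg k H) M.toC ≫ F.map M.actionHom

/-- A lax module functor preserves modules over an algebra: its unitality gives the unit axiom and
its associativity the other. -/
lemma isAction_liftAction (M : DoiHopf k H C) : DoiHopf.IsAction (liftAction F M) where
  unit := by
    rw [liftAction, μₗ_naturality_left_assoc, ← F.map_comp, M.isAction_actionHom.unit,
      ← μₗ_unitality]
  assoc := by
    rw [liftAction, μₗ_naturality_left_assoc, ← F.map_comp, M.isAction_actionHom.assoc,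
      F.map_comp, F.map_comp, μₗ_associativity_assoc, actionHomRight_comp, Category.assoc,
      μₗ_naturality_right_assoc]

lemma map_liftAction {M N : DoiHopf k H C} (f : M ⟶ N) :
    liftAction F M ≫ F.map (DoiHopf.Hom.toC f) =
      Comod.reg k H ⊴ₗ F.map (DoiHopf.Hom.toC f) ≫ liftAction F N := by
  rw [liftAction, liftAction, Category.assoc, ← F.map_comp, DoiHopf.Hom.actionHom_comp,
    F.map_comp, μₗ_naturality_right_assoc]

/-- The functor on Doi–Hopf modules induced by a lax module functor. -/
def liftFunctor : DoiHopf k H C ⥤ DoiHopf k H D where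
  obj M := DoiHopf.ofIsAction (isAction_liftAction F M)
  map {M N} f := DoiHopf.homMk (F.map (DoiHopf.Hom.toC f)) (by
    rw [DoiHopf.actionHom_ofIsAction, DoiHopf.actionHom_ofIsAction]
    exact map_liftAction F f)
  map_id M := DoiHopf.hom_ext_toC (F.map_id _)
  map_comp f g := DoiHopf.hom_ext_toC
    (F.map_comp (DoiHopf.Hom.toC f) (DoiHopf.Hom.toC g))

lemma actionHom_liftFunctor (M : DoiHopf k H C) :
    ((liftFunctor F).obj M).actionHom = liftAction F M := DoiHopf.actionHom_ofIsAction _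

/-- The comparison `W ⊗ F(V) → F(W ⊗ V)` for a vector space `W`. -/
def vComparison (W : Type u) [AddCommGroup W] [Module k W] (V : Comod k C) :
    Comod.vact W (F.obj V) ⟶ F.obj (Comod.vact W V) :=
  (Comod.trivIso H W (F.obj V)).inv ≫ μₗ F (Comod.triv k H W) V ≫
    F.map (Comod.trivIso H W V).hom

variable (H) in
lemma vComparison_naturality {W W' : Type u} [AddCommGroup W] [Module k W] [AddCommGroup W']
    [Module k W'] (g : W →ₗ[k] W') {V V' : Comod k C} (f : V ⟶ V') :
    Comod.vactMap g (F.map f) ≫ vComparison (H := H) F W' V' =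
      vComparison (H := H) F W V ≫ F.map (Comod.vactMap g f) := by
  have h1 := Comod.trivIso_inv_naturality (H := H) g (F.map f)
  have h2 := Comod.trivIso_hom_naturality (H := H) g f
  rw [vComparison, vComparison, reassoc_of% h1]
  simp only [Category.assoc, ← F.map_comp]
  rw [h2, F.map_comp, F.map_comp,
    ← μₗ_naturality_left_assoc, μₗ_naturality_right_assoc]

/-- The comparison morphism commutes with the actions of `H`. -/
lemma vComparison_action (X : Comod k (DualBialg k H)) (M : DoiHopf k H C) :
    (DoiHopf.act X ((liftFunctor F).obj M)).actionHom ≫ vComparison (H := H) F X.carrier M.toC =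
      Comod.reg k H ⊴ₗ vComparison (H := H) F X.carrier M.toC ≫
        liftAction F (DoiHopf.act X M) := by
  have h1 := μₗ_twist F (twist X) M.actionHom (Comod.trivIso H X.carrier M.toC)
    (Comod.trivIso H X.carrier (F.obj M.toC))
  rw [liftAction, actionHom_act, actionHom_act, actionHom_liftFunctor]
  exact h1

lemma vComparison_associativity (X Y : Comod k (DualBialg k H)) (M : DoiHopf k H C) :
    vComparison (H := H) F (X.carrier ⊗[k] Y.carrier) M.toC ≫
        F.map (Comod.vactAssoc X.carrier Y.carrier M.toC) =
      Comod.vactAssoc X.carrier Y.carrier (F.obj M.toC) ≫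
        Comod.vactMap LinearMap.id (vComparison (H := H) F Y.carrier M.toC) ≫
          vComparison (H := H) F X.carrier (Comod.vact Y.carrier M.toC) :=
  μₗ_comparison_associativity F (Comod.trivTensor k H X.carrier Y.carrier)
      (Comod.trivIso H Y.carrier M.toC) (Comod.trivIso H X.carrier (Comod.vact Y.carrier M.toC))
      (Comod.trivIso H (X.carrier ⊗[k] Y.carrier) M.toC)
      (Comod.vactAssoc X.carrier Y.carrier M.toC)
      (trivIso_vactAssoc _ _ _)
      (Comod.trivIso H Y.carrier (F.obj M.toC))
      (Comod.trivIso H X.carrier (Comod.vact Y.carrier (F.obj M.toC)))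
      (Comod.trivIso H X.carrier (F.obj (Comod.vact Y.carrier M.toC)))
      (Comod.trivIso H (X.carrier ⊗[k] Y.carrier) (F.obj M.toC))
      (Comod.vactAssoc X.carrier Y.carrier (F.obj M.toC))
      (trivIso_vactAssoc _ _ _)
      (Comod.vactMap LinearMap.id (vComparison (H := H) F Y.carrier M.toC))
      (by rw [trivIso_vactMap_id, vComparison])

lemma vComparison_unitality (M : DoiHopf k H C) :
    Comod.vactUnit (F.obj M.toC) = vComparison (H := H) F k M.toC ≫ F.map (Comod.vactUnit M.toC) :=
  μₗ_comparison_unitality F (trivUnit k H) (Comod.trivIso H k M.toC)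
    (Comod.vactUnit M.toC) (trivIso_vactUnit M.toC)
    (Comod.trivIso H k (F.obj M.toC))
    (Comod.vactUnit (F.obj M.toC)) (trivIso_vactUnit (F.obj M.toC))

/-- The lax structure of `liftFunctor`. -/
instance : (liftFunctor (H := H) F).LaxLeftLinear (Comod k (DualBialg k H)) where
  μₗ X M := DoiHopf.homMk (M := DoiHopf.act X ((liftFunctor F).obj M))
    (N := (liftFunctor F).obj (DoiHopf.act X M)) (vComparison (H := H) F X.carrier M.toC)
    ((vComparison_action F X M).trans (by rw [actionHom_liftFunctor]; rfl))
  μₗ_naturality_left f M := DoiHopf.hom_ext_toC (by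
    have h1 := vComparison_naturality H F (Comod.Hom.lin f) (𝟙 M.toC)
    rw [F.map_id] at h1
    exact h1)
  μₗ_naturality_right X _ _ f := DoiHopf.hom_ext_toC
    (vComparison_naturality H F (LinearMap.id (R := k) (M := X.carrier)) (DoiHopf.Hom.toC f))
  μₗ_associativity X Y M := DoiHopf.hom_ext_toC (vComparison_associativity F X Y M)
  μₗ_unitality M := DoiHopf.hom_ext_toC (vComparison_unitality F M)

end Objects

section Equivalence

variable {F : Comod k C ⥤ Comod k D} [F.LaxLeftLinear (Comod k H)]
  {G : Comod k D ⥤ Comod k C} [G.LaxLeftLinear (Comod k H)]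
  (η : F ⋙ G ≅ 𝟭 (Comod k C))

/-- The isomorphism on Doi–Hopf modules induced by `η`. -/
def liftUnitIso (hη : IsModuleNatTrans (Comod k H) η.hom) :
    liftFunctor (H := H) F ⋙ liftFunctor (H := H) G ≅ 𝟭 (DoiHopf k H C) :=
  NatIso.ofComponents (fun M => DoiHopf.isoOfToC
    (M := (liftFunctor G).obj ((liftFunctor F).obj M)) (N := M) (η.app M.toC) (by
      rw [actionHom_liftFunctor, liftAction, actionHom_liftFunctor]
      exact hη.action_naturality M.actionHom))
    (fun f => DoiHopf.hom_ext_toC (η.hom.naturality (DoiHopf.Hom.toC f)))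

/-- The lifted structure morphisms come from those at trivial comodules, so this is the
compatibility of `η` at the trivial comodule on `X`. -/
lemma isModuleNatTrans_liftUnitIso (hη : IsModuleNatTrans (Comod k H) η.hom) :
    IsModuleNatTrans (Comod k (DualBialg k H)) (liftUnitIso η hη).hom := by
  intro X M
  refine DoiHopf.hom_ext_toC ?_
  exact (hη.comparison (Comod.trivIso H X.carrier M.toC)
    (Comod.trivIso H X.carrier (F.obj M.toC))
    (Comod.trivIso H X.carrier (G.obj (F.obj M.toC)))).trans
    ((trivIso_inv_vactMap_id (η.hom.app M.toC)).trans (Category.comp_id _).symm)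

end Equivalence

lemma ModuleCategoryEquivalent.doiHopf
    (h : ModuleCategoryEquivalent (Comod k H) (Comod k C) (Comod k D)) :
    ModuleCategoryEquivalent (Comod k (DualBialg k H)) (DoiHopf k H C) (DoiHopf k H D) := by
  obtain ⟨F, G, _, _, η, ε, hη, hε⟩ := h
  exact ⟨liftFunctor F, liftFunctor G, inferInstance, inferInstance, liftUnitIso η hη,
    liftUnitIso ε hε, isModuleNatTrans_liftUnitIso η hη, isModuleNatTrans_liftUnitIso ε hε⟩

end LiftFunctor

end

/-! ### Transport of coactions through strong module functors -/

section

open MonoidalLeftAction Functor.LaxLeftLinear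

section CoactionMap

universe v₁ v₂ v₃ u₁ u₂ u₃

variable {V : Type u₁} [Category.{v₁} V] [MonoidalCategory V]
  {M : Type u₂} [Category.{v₂} M] [MonoidalLeftAction V M]
  {N : Type u₃} [Category.{v₃} N] [MonoidalLeftAction V N]
  (F : M ⥤ N) [F.LaxLeftLinear V] [∀ (X : V) (m : M), IsIso (μₗ F X m)]

/-- The image of a morphism `m → X ⊗ s` under a strong module functor. -/
def coactionMap {X : V} {m s : M} (f : m ⟶ X ⊙ₗ s) : F.obj m ⟶ X ⊙ₗ F.obj s :=
  F.map f ≫ inv (μₗ F X s)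

lemma coactionMap_comp_left {X Y : V} {m s : M} (f : m ⟶ X ⊙ₗ s) (g : X ⟶ Y) :
    coactionMap F (f ≫ g ⊵ₗ s) = coactionMap F f ≫ g ⊵ₗ F.obj s := by
  rw [coactionMap, coactionMap, IsIso.comp_inv_eq, Category.assoc, Category.assoc,
    μₗ_naturality_left, IsIso.inv_hom_id_assoc, F.map_comp]

/-- Associativity of the structure morphisms, with the inverses moved to the other side. By this and
`coactionMap_comp_left`, the functor carries identities such as coassociativity to identities
between the transported coactions. -/
lemma coactionMap_coactionMap {X Y : V} {m n s : M} (p : n ⟶ Y ⊙ₗ m) (f : m ⟶ X ⊙ₗ s) :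
    coactionMap F (p ≫ Y ⊴ₗ f ≫ (αₗ Y X s).inv) =
      coactionMap F p ≫ Y ⊴ₗ coactionMap F f ≫ (αₗ Y X (F.obj s)).inv := by
  have h1 : Y ⊴ₗ inv (μₗ F X s) ≫ (αₗ Y X (F.obj s)).inv ≫ μₗ F (Y ⊗ X) s =
      μₗ F Y (X ⊙ₗ s) ≫ F.map (αₗ Y X s).inv := by
    rw [← μₗ_associativity_inv, ← actionHomRight_comp_assoc, IsIso.inv_hom_id,
      actionHomRight_id, Category.id_comp]
  rw [coactionMap, coactionMap, coactionMap, IsIso.comp_inv_eq]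
  simp only [Category.assoc, actionHomRight_comp, F.map_comp]
  rw [h1, μₗ_naturality_right_assoc, IsIso.inv_hom_id_assoc]

variable {F} {G : N ⥤ M} [G.LaxLeftLinear V] [∀ (X : V) (n : N), IsIso (μₗ G X n)]
  (η : F ⋙ G ≅ 𝟭 M)

/-- Transporting by `F` and then by `G` divides `G(F(f))` by the structure morphism of the
composite, which `η` identifies with the identity. -/
lemma coactionMap_unit (hη : IsModuleNatTrans V η.hom) {X : V} {m s : M} (f : m ⟶ X ⊙ₗ s) :
    η.inv.app m ≫ coactionMap G (coactionMap F f) = f ≫ X ⊴ₗ η.inv.app s := by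
  have h1 := hη X s
  have h2 := η.inv.naturality f
  rw [comp_μₗ, id_μₗ, Category.comp_id] at h1
  rw [coactionMap, coactionMap, G.map_comp, Functor.map_inv, Category.assoc, ← IsIso.inv_comp,
    ← Category.assoc, IsIso.comp_inv_eq]
  refine h2.symm.trans ?_
  rw [Category.assoc, Functor.id_map]
  congr 1
  rw [← cancel_mono (η.hom.app (X ⊙ₗ s)), Category.assoc, h1, Iso.inv_hom_id_app,
    ← actionHomRight_comp, Iso.inv_hom_id_app]
  exact (actionHomRight_id _ _).symm

end CoactionMap

namespace DoiHopf

variable {k H C : Type u} [Field k] [Ring H] [Bialgebra k H] [FiniteDimensional k H]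
    [AddCommGroup C] [Module k C] [Module H C] [IsScalarTower k H C] [Coalgebra k C]
    [IsModuleCoalgebra k H C]

variable (k H C) in
/-- The coalgebra `C` as a Doi–Hopf module. -/
def regular : DoiHopf k H C where
  X := Comod.ofMod k H C
  ρ := (Coalgebra.comul : C →ₗ[k] C ⊗[k] C)
  coassoc := (Coalgebra.coassoc : (TensorProduct.assoc k C C C).toLinearMap ∘ₗ
    Coalgebra.comul.rTensor C ∘ₗ Coalgebra.comul = Coalgebra.comul.lTensor C ∘ₗ Coalgebra.comul)
  counit := (Coalgebra.lTensor_counit_comp_comul :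
    (Coalgebra.counit (R := k) (A := C)).lTensor C ∘ₗ Coalgebra.comul = _)
  colinear := LinearMap.ext fun c => (dualCoact_comul (k := k) (H := H) (C := C) c).symm

/-- The coaction of a Doi–Hopf module as a morphism to a cofree Doi–Hopf module. -/
def free (M : DoiHopf k H C) : M ⟶ M.X ⊙ₗ regular k H C :=
  show M ⟶ act M.X (regular k H C) from
  { lin := M.ρ
    colinear := M.colinear
    colinear' := by
      have h1 := congrArg
        (fun f => (TensorProduct.assoc k M.X.carrier C C).symm.toLinearMap ∘ₗ f) M.coassoc
      simp only [← LinearMap.comp_assoc, LinearEquiv.symm_comp, LinearMap.id_comp] at h1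
      exact h1.symm }

lemma free_lin (M : DoiHopf k H C) : Hom.lin M.free = M.ρ := rfl

/-- The morphism of `H^*`-comodules underlying a morphism to `X ⊗ M`. -/
def toAct {X : Comod k (DualBialg k H)} {M N : DoiHopf k H C} (f : N ⟶ X ⊙ₗ M) :
    N.X ⟶ X ⊗ M.X := Hom.toX (N := act X M) f

/-- This is the `C`-colinearity of `f`, written inside the module category with the coactions as
morphisms `free`, so that functors can be applied to it. -/
lemma free_naturality {X : Comod k (DualBialg k H)} {M N : DoiHopf k H C} (f : N ⟶ X ⊙ₗ M) :
    f ≫ X ⊴ₗ M.free ≫ (αₗ X M.X (regular k H C)).inv =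
      N.free ≫ toAct f ⊵ₗ regular k H C := by
  refine hom_ext ?_
  have h1 : ∀ t : X.carrier ⊗[k] M.X.carrier,
      (TensorProduct.assoc k X.carrier M.X.carrier C).symm (M.ρ.lTensor X.carrier t) =
      Hom.lin (X ⊴ₗ M.free ≫ (αₗ X M.X (regular k H C)).inv) t := fun t => rfl
  exact (LinearMap.ext fun n => (h1 (Hom.lin f n)).symm).trans (Hom.colinear' (N := act X M) f)

lemma free_coassoc (M : DoiHopf k H C) :
    M.free ≫ toAct M.free ⊵ₗ regular k H C =
      M.free ≫ M.X ⊴ₗ (regular k H C).free ≫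
        (αₗ M.X (regular k H C).X (regular k H C)).inv :=
  (free_naturality M.free).symm

section Transport

variable {D : Type u} [AddCommGroup D] [Module k D] [Module H D] [IsScalarTower k H D]
    [Coalgebra k D] [IsModuleCoalgebra k H D]
  (F : DoiHopf k H C ⥤ DoiHopf k H D) (G : DoiHopf k H D ⥤ DoiHopf k H C)
  [F.LaxLeftLinear (Comod k (DualBialg k H))] [G.LaxLeftLinear (Comod k (DualBialg k H))]
  [∀ (X : Comod k (DualBialg k H)) M, IsIso (μₗ F X M)]
  [∀ (X : Comod k (DualBialg k H)) M, IsIso (μₗ G X M)]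

lemma coactionMap_free (M : DoiHopf k H C) :
    coactionMap F M.free ≫ toAct M.free ⊵ₗ F.obj (regular k H C) =
      coactionMap F M.free ≫ M.X ⊴ₗ coactionMap F (regular k H C).free ≫
        (αₗ M.X (regular k H C).X (F.obj (regular k H C))).inv := by
  rw [← coactionMap_comp_left, free_coassoc, coactionMap_coactionMap]

variable {F G} (η : F ⋙ G ≅ 𝟭 (DoiHopf k H C))

/-- The morphism `C → F(C) ⊗ G(D)` induced by `C ≅ G(F(C))`. -/
def unitTransport : regular k H C ⟶ (F.obj (regular k H C)).X ⊙ₗ G.obj (regular k H D) :=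
  η.inv.app (regular k H C) ≫ coactionMap G (F.obj (regular k H C)).free

/-- The transported left coaction on `F(C)` is itself a morphism of Doi–Hopf modules, hence
compatible with `free`; applying `G` and undoing `G(F(-))` by `coactionMap_unit` recovers the
comultiplication of `C`. The inclusion of `C` into `F(C) ⊗ G(D)` therefore respects the left
coactions of `C`. -/
lemma unitTransport_comul (hη : IsModuleNatTrans (Comod k (DualBialg k H)) η.hom) :
    unitTransport η ≫
        toAct (coactionMap F (regular k H C).free) ⊵ₗ G.obj (regular k H D) =
      (regular k H C).free ≫ (regular k H C).X ⊴ₗ unitTransport η ≫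
        (αₗ (regular k H C).X (F.obj (regular k H C)).X (G.obj (regular k H D))).inv := by
  have h1 := coactionMap_unit η hη (regular k H C).free
  rw [unitTransport, Category.assoc, ← coactionMap_comp_left, ← free_naturality,
    coactionMap_coactionMap, reassoc_of% h1, actionHomRight_comp, Category.assoc]

end Transport

end DoiHopf

end

/-! ### Equalizers, and a Doi–Hopf module as the equalizer of its coaction -/

section

open MonoidalLeftAction Functor.LaxLeftLinear

section LinearAlgebra

variable {k A B Z : Type u} [Field k] [AddCommGroup A] [Module k A] [AddCommGroup B] [Module k B]
  [AddCommGroup Z] [Module k Z]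

/-- The factorization of a linear map through an injective one. -/
def factor (j : A →ₗ[k] B) (hj : Function.Injective j) (h : Z →ₗ[k] B)
    (hr : ∀ z, ∃ a, j a = h z) : Z →ₗ[k] A :=
  (LinearEquiv.ofInjective j hj).symm.toLinearMap ∘ₗ h.codRestrict (LinearMap.range j) hr

lemma comp_factor (j : A →ₗ[k] B) (hj : Function.Injective j) (h : Z →ₗ[k] B)
    (hr : ∀ z, ∃ a, j a = h z) : j ∘ₗ factor j hj h hr = h := by
  refine LinearMap.ext fun z => ?_
  exact congrArg Subtype.val ((LinearEquiv.ofInjective j hj).apply_symm_apply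
    (h.codRestrict (LinearMap.range j) hr z))

lemma exact_subtype_eqLocus (f g : A →ₗ[k] B) :
    Function.Exact (LinearMap.eqLocus f g).subtype (f - g) := by
  intro x
  simp [sub_eq_zero]

/-- Flatness over a field: tensoring with `Q` keeps the kernel of `f - g`. -/
lemma exists_rTensor_eqLocus (Q : Type u) [AddCommGroup Q] [Module k Q] (f g : A →ₗ[k] B)
    (t : A ⊗[k] Q) (ht : f.rTensor Q t = g.rTensor Q t) :
    ∃ s, (LinearMap.eqLocus f g).subtype.rTensor Q s = t :=
  (Module.Flat.rTensor_exact Q (exact_subtype_eqLocus f g) t).1 (by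
    rw [LinearMap.rTensor_sub, LinearMap.sub_apply, ht, sub_self])

lemma exists_lTensor (Q : Type u) [AddCommGroup Q] [Module k Q] (f g : A →ₗ[k] B)
    (j : Z →ₗ[k] A) (hj : ∀ a, f a = g a → ∃ z, j z = a) (hj' : f ∘ₗ j = g ∘ₗ j)
    (t : Q ⊗[k] A) (ht : f.lTensor Q t = g.lTensor Q t) : ∃ s, j.lTensor Q s = t := by
  have h1 : Function.Exact j (f - g) := fun a => by
    rw [LinearMap.sub_apply, sub_eq_zero]
    refine ⟨hj a, ?_⟩
    rintro ⟨z, rfl⟩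
    exact LinearMap.congr_fun hj' z
  exact (Module.Flat.lTensor_exact Q h1 t).1 (by
    rw [LinearMap.lTensor_sub, LinearMap.sub_apply, ht, sub_self])

end LinearAlgebra

namespace Comod

variable {k C : Type u} [Field k] [AddCommGroup C] [Module k C] [Coalgebra k C]

/-- A linear map whose composition with an injective morphism is a morphism. -/
lemma colinear_of_comp {T M N : Comod k C} (i : M ⟶ N) (hi : Function.Injective (Hom.lin i))
    (s : T ⟶ N) (l : T.carrier →ₗ[k] M.carrier) (h : Hom.lin i ∘ₗ l = Hom.lin s) :
    M.coact ∘ₗ l = l.rTensor C ∘ₗ T.coact := by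
  have h0 : Function.Injective ((Hom.lin i).rTensor C) :=
    Module.Flat.rTensor_preserves_injective_linearMap _ hi
  have e1 : (Hom.lin i).rTensor C ∘ₗ M.coact ∘ₗ l =
      (Hom.lin i).rTensor C ∘ₗ l.rTensor C ∘ₗ T.coact := by
    rw [← LinearMap.comp_assoc, ← LinearMap.comp_assoc, ← LinearMap.rTensor_comp, h,
      ← Hom.colinear i, ← Hom.colinear s, LinearMap.comp_assoc, h]
  exact LinearMap.ext fun t => h0 (LinearMap.congr_fun e1 t)

/-- Applying the counit to the last factor of the hypothesis gives the two sides. Hence the image of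
the coaction is the equalizer of `ρ ⊗ C` and `M ⊗ Δ`. -/
lemma coact_counit_eq (M : Comod k C) (t : M.carrier ⊗[k] C)
    (ht : M.coact.rTensor C t =
      (TensorProduct.assoc k M.carrier C C).symm (Coalgebra.comul.lTensor M.carrier t)) :
    M.coact (TensorProduct.rid k M.carrier ((Coalgebra.counit (R := k)).lTensor M.carrier t)) =
      t := by
  have h1 : ∀ t : M.carrier ⊗[k] C,
      M.coact (TensorProduct.rid k M.carrier ((Coalgebra.counit (R := k)).lTensor M.carrier t)) =
      TensorProduct.rid k (M.carrier ⊗[k] C)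
        ((Coalgebra.counit (R := k)).lTensor _ (M.coact.rTensor C t)) := by
    intro t
    induction t with
    | zero => simp
    | add x y hx hy => simp only [map_add, hx, hy]
    | tmul => simp
  have h2 : ∀ t : M.carrier ⊗[k] C,
      TensorProduct.rid k (M.carrier ⊗[k] C) ((Coalgebra.counit (R := k)).lTensor _
        ((TensorProduct.assoc k M.carrier C C).symm (Coalgebra.comul.lTensor M.carrier t))) =
      t := by
    intro t
    induction t with
    | zero => simp
    | add x y hx hy => simp only [map_add, hx, hy]
    | tmul m c =>
      have h3 : ∀ s : C ⊗[k] C, TensorProduct.rid k (M.carrier ⊗[k] C)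
          ((Coalgebra.counit (R := k)).lTensor _
            ((TensorProduct.assoc k M.carrier C C).symm (m ⊗ₜ s))) =
          m ⊗ₜ TensorProduct.rid k C ((Coalgebra.counit (R := k)).lTensor C s) := by
        intro s
        induction s with
        | zero => simp
        | add x y hx hy => simp only [map_add, TensorProduct.tmul_add, hx, hy]
        | tmul => simp [TensorProduct.tmul_smul]
      rw [LinearMap.lTensor_tmul, h3, Coalgebra.lTensor_counit_comul]
      simp
  rw [h1, ht, h2]

section Equalizer

variable {M N : Comod k C} (f g : M ⟶ N)

/-- Colinearity of `f` and `g` shows that the coaction of `w` is equalized after tensoring with `C`,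
and flatness places it in the equalizer tensored with `C`. -/
lemma eqz_aux (w : LinearMap.eqLocus (Hom.lin f) (Hom.lin g)) :
    ∃ s, (LinearMap.eqLocus (Hom.lin f) (Hom.lin g)).subtype.rTensor C s = M.coact w := by
  refine exists_rTensor_eqLocus C _ _ _ ?_
  rw [← LinearMap.comp_apply, ← LinearMap.comp_apply, ← Hom.colinear f, ← Hom.colinear g,
    LinearMap.comp_apply, LinearMap.comp_apply]
  exact congrArg _ w.2

/-- The restriction of the coaction to an equalizer. -/
def eqzCoact : LinearMap.eqLocus (Hom.lin f) (Hom.lin g) →ₗ[k]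
    LinearMap.eqLocus (Hom.lin f) (Hom.lin g) ⊗[k] C :=
  factor ((LinearMap.eqLocus (Hom.lin f) (Hom.lin g)).subtype.rTensor C)
    (Module.Flat.rTensor_preserves_injective_linearMap _ (Submodule.subtype_injective _))
    (M.coact ∘ₗ (LinearMap.eqLocus (Hom.lin f) (Hom.lin g)).subtype) (eqz_aux f g)

lemma eqzCoact_spec : M.coact ∘ₗ (LinearMap.eqLocus (Hom.lin f) (Hom.lin g)).subtype =
    (LinearMap.eqLocus (Hom.lin f) (Hom.lin g)).subtype.rTensor C ∘ₗ eqzCoact f g :=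
  (comp_factor _ _ _ _).symm

/-- The equalizer of two morphisms of comodules. -/
def eqz : Comod k C :=
  ofInjective M (LinearMap.eqLocus (Hom.lin f) (Hom.lin g)).subtype
    (Submodule.subtype_injective _) (eqzCoact f g) (eqzCoact_spec f g)

/-- The inclusion of the equalizer. -/
def eqzι : eqz f g ⟶ M :=
  ⟨(LinearMap.eqLocus (Hom.lin f) (Hom.lin g)).subtype, eqzCoact_spec f g⟩

lemma eqzι_injective : Function.Injective (Hom.lin (eqzι f g)) := Subtype.val_injective

lemma eqz_condition : eqzι f g ≫ f = eqzι f g ≫ g := hom_ext (LinearMap.ext fun w => w.2)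

lemma exists_eqzι (m : M.carrier) (h : Hom.lin f m = Hom.lin g m) :
    ∃ e, Hom.lin (eqzι f g) e = m := ⟨⟨m, h⟩, rfl⟩

variable {f g} in
/-- The factorization of a morphism through an equalizer. -/
def eqzLift {T : Comod k C} (s : T ⟶ M) (h : s ≫ f = s ≫ g) : T ⟶ eqz f g :=
  have e : ∀ t, Hom.lin f (Hom.lin s t) = Hom.lin g (Hom.lin s t) :=
    fun t => LinearMap.congr_fun (congrArg Hom.lin h) t
  ⟨(Hom.lin s).codRestrict (LinearMap.eqLocus (Hom.lin f) (Hom.lin g)) e,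
    colinear_of_comp (eqzι f g) (eqzι_injective f g) s _ rfl⟩

lemma hom_ext_of_injective {T M N : Comod k C} {i : M ⟶ N}
    (hi : Function.Injective (Hom.lin i)) {f g : T ⟶ M} (h : f ≫ i = g ≫ i) : f = g :=
  hom_ext (LinearMap.ext fun t => hi (LinearMap.congr_fun (congrArg Hom.lin h) t))

end Equalizer

end Comod

namespace DoiHopf

variable {k H C : Type u} [Field k] [Ring H] [Bialgebra k H] [FiniteDimensional k H]
    [AddCommGroup C] [Module k C] [Module H C] [IsScalarTower k H C] [Coalgebra k C]
    [IsModuleCoalgebra k H C]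

/-- A linear map whose composition with an injective morphism is a morphism. -/
def homOfComp {T M N : DoiHopf k H C} (i : M ⟶ N) (hi : Function.Injective (Hom.lin i))
    (s : T ⟶ N) (l : T.X.carrier →ₗ[k] M.X.carrier) (h : Hom.lin i ∘ₗ l = Hom.lin s) : T ⟶ M where
  lin := l
  colinear := Comod.colinear_of_comp (Hom.toX i) hi (Hom.toX s) l h
  colinear' := Comod.colinear_of_comp (Hom.toC i) hi (Hom.toC s) l h

section Equalizer

variable {M N : DoiHopf k H C} (f g : M ⟶ N)

/-- The equalizer of two morphisms of Doi–Hopf modules. -/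
def eqz : DoiHopf k H C where
  X := Comod.eqz (Hom.toX f) (Hom.toX g)
  ρ := (Comod.eqz (Hom.toC f) (Hom.toC g)).coact
  coassoc := (Comod.eqz (Hom.toC f) (Hom.toC g)).coassoc
  counit := (Comod.eqz (Hom.toC f) (Hom.toC g)).counit
  colinear := by
    -- After the injective `i ⊗ C` the restricted coaction becomes `i ≫ ρ`, a morphism of
    -- `H^*`-comodules; so it is one already.
    have h0 := Comod.eqzι_injective (Hom.toX f) (Hom.toX g)
    let i := Comod.eqzι (Hom.toX f) (Hom.toX g)
    exact Comod.colinear_of_comp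
      (Comod.actMap i (𝟙 (Comod.ofMod k H C)))
      (Module.Flat.rTensor_preserves_injective_linearMap (M := C) (Comod.Hom.lin i) h0)
      (i ≫ M.ρHom) _ (Comod.eqzCoact_spec (Hom.toC f) (Hom.toC g)).symm

/-- The inclusion of the equalizer. -/
def eqzι : eqz f g ⟶ M where
  lin := Comod.Hom.lin (Comod.eqzι (Hom.toX f) (Hom.toX g))
  colinear := (Comod.eqzι (Hom.toX f) (Hom.toX g)).colinear
  colinear' := (Comod.eqzι (Hom.toC f) (Hom.toC g)).colinear

lemma eqzι_injective : Function.Injective (Hom.lin (eqzι f g)) := Subtype.val_injective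

lemma eqz_condition : eqzι f g ≫ f = eqzι f g ≫ g := hom_ext (LinearMap.ext fun w => w.2)

lemma exists_eqzι (m : M.X.carrier) (h : Hom.lin f m = Hom.lin g m) :
    ∃ e, Hom.lin (eqzι f g) e = m := ⟨⟨m, h⟩, rfl⟩

variable {f g} in
/-- The factorization of a morphism through an equalizer. -/
def eqzLift {T : DoiHopf k H C} (s : T ⟶ M) (h : s ≫ f = s ≫ g) : T ⟶ eqz f g :=
  homOfComp (eqzι f g) (eqzι_injective f g) s (Comod.Hom.lin
    (Comod.eqzLift (f := Hom.toX f) (g := Hom.toX g) (Hom.toX s) (congrArg Hom.toX h))) rfl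

lemma mono_of_injective (hf : Function.Injective (Hom.lin f)) : Mono f :=
  ⟨fun _ _ h => hom_ext (LinearMap.ext fun t => hf (LinearMap.congr_fun (congrArg Hom.lin h) t))⟩

end Equalizer

lemma free_injective (M : DoiHopf k H C) : Function.Injective (Hom.lin M.free) :=
  M.toC.coact_injective

/-- The coaction is an equalizer. -/
lemma exists_comp_free {T M : DoiHopf k H C} (s : T ⟶ M.X ⊙ₗ regular k H C)
    (h : s ≫ toAct M.free ⊵ₗ regular k H C = s ≫ M.X ⊴ₗ (regular k H C).free ≫
      (αₗ M.X (regular k H C).X (regular k H C)).inv) : ∃ l : T ⟶ M, l ≫ M.free = s := by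
  -- The counit of `C` is a left inverse of the coaction, so this is the only candidate for a
  -- factorization.
  let l : T.X.carrier →ₗ[k] M.X.carrier := (TensorProduct.rid k M.X.carrier).toLinearMap ∘ₗ
    (Coalgebra.counit (R := k) (A := C)).lTensor M.X.carrier ∘ₗ
      Hom.lin (N := act M.X (regular k H C)) s
  have h1 : Hom.lin M.free ∘ₗ l = Hom.lin s := LinearMap.ext fun t =>
    M.toC.coact_counit_eq (Hom.lin (N := act M.X (regular k H C)) s t)
      (LinearMap.congr_fun (congrArg Hom.lin h) t)
  exact ⟨homOfComp M.free M.free_injective s l h1, hom_ext h1⟩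

section Transport

variable {D : Type u} [AddCommGroup D] [Module k D] [Module H D] [IsScalarTower k H D]
    [Coalgebra k D] [IsModuleCoalgebra k H D]
  (G : DoiHopf k H C ⥤ DoiHopf k H D) [G.LaxLeftLinear (Comod k (DualBialg k H))]
  [∀ (X : Comod k (DualBialg k H)) M, IsIso (μₗ G X M)] [G.IsEquivalence]

/-- An equivalence preserves the equalizer property of the coaction: `T` is replaced by an object
`G(T')`, `s` is lifted to a morphism out of `T'` by fullness, and faithfulness lifts the equation it
satisfies. -/
lemma exists_comp_coactionMap_free {T : DoiHopf k H D} {M : DoiHopf k H C}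
    (s : T ⟶ M.X ⊙ₗ G.obj (regular k H C))
    (h : s ≫ toAct M.free ⊵ₗ G.obj (regular k H C) =
      s ≫ M.X ⊴ₗ coactionMap G (regular k H C).free ≫
        (αₗ M.X (regular k H C).X (G.obj (regular k H C))).inv) :
    ∃ l : T ⟶ G.obj M, l ≫ coactionMap G M.free = s := by
  let p := G.preimage ((G.objObjPreimageIso T).hom ≫ s ≫ μₗ G M.X (regular k H C))
  have hp : coactionMap G p = (G.objObjPreimageIso T).hom ≫ s := by
    rw [coactionMap, Functor.map_preimage, Category.assoc, Category.assoc, IsIso.hom_inv_id,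
      Category.comp_id]
  have inj : ∀ {Y : Comod k (DualBialg k H)} {m n : DoiHopf k H C} (a b : m ⟶ Y ⊙ₗ n),
      coactionMap G a = coactionMap G b → a = b := by
    intro Y m n a b hab
    rw [coactionMap, coactionMap, cancel_mono] at hab
    exact G.map_injective hab
  obtain ⟨l, hl⟩ := exists_comp_free p (inj _ _ (by
    rw [coactionMap_comp_left, coactionMap_coactionMap, hp, Category.assoc, h, Category.assoc]))
  refine ⟨(G.objObjPreimageIso T).inv ≫ G.map l, ?_⟩
  have h2 : G.map l ≫ coactionMap G M.free = coactionMap G p := by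
    rw [← hl, coactionMap, coactionMap, G.map_comp, Category.assoc]
  rw [Category.assoc, h2, hp, Iso.inv_hom_id_assoc]

/-- The equalizer property is categorical and the conclusion concerns elements. Testing it on `eqz a
b`, whose elements are exactly those on which the two maps agree, gives `e`; since the transported
coaction is mono, `e` is a retraction of the comparison `p`, which yields injectivity. -/
lemma coactionMap_free_injective (M : DoiHopf k H C) :
    Function.Injective (Hom.lin (coactionMap G M.free)) ∧
    ∀ t, Hom.lin (toAct M.free ⊵ₗ G.obj (regular k H C)) t =
      Hom.lin (M.X ⊴ₗ coactionMap G (regular k H C).free ≫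
        (αₗ M.X (regular k H C).X (G.obj (regular k H C))).inv) t →
      ∃ m, Hom.lin (coactionMap G M.free) m = t := by
  let a := toAct M.free ⊵ₗ G.obj (regular k H C)
  let b := M.X ⊴ₗ coactionMap G (regular k H C).free ≫
        (αₗ M.X (regular k H C).X (G.obj (regular k H C))).inv
  obtain ⟨e, he⟩ := exists_comp_coactionMap_free G (eqzι a b) (eqz_condition a b)
  let p := eqzLift (coactionMap G M.free) (coactionMap_free G M)
  have hp : p ≫ eqzι a b = coactionMap G M.free := rfl
  have : Mono M.free := mono_of_injective _ M.free_injective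
  have : Mono (coactionMap G M.free) := by
    rw [coactionMap]
    infer_instance
  have hpe : p ≫ e = 𝟙 _ := by
    rw [← cancel_mono (coactionMap G M.free), Category.assoc, he, hp, Category.id_comp]
  constructor
  · rw [← hp]
    refine (eqzι_injective a b).comp (Function.LeftInverse.injective (g := Hom.lin e) fun x => ?_)
    exact LinearMap.congr_fun (congrArg Hom.lin hpe) x
  · intro t ht
    obtain ⟨w, rfl⟩ := exists_eqzι a b t ht
    exact ⟨Hom.lin e w, LinearMap.congr_fun (congrArg Hom.lin he) w⟩

end Transport

end DoiHopf

end

/-! ### The morphism `Y ⊗ (V ⊗ M) → (Y ⊗ V) ⊗ M` -/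

section

open MonoidalLeftAction Functor.LaxLeftLinear

section Mixed

variable {k H A B Q Q' : Type u} [Field k] [AddCommGroup H] [Module k H] [AddCommGroup A]
  [Module k A] [AddCommGroup B] [Module k B] [AddCommGroup Q] [Module k Q] [AddCommGroup Q']
  [Module k Q'] {Y Y' V V' : Type u} [AddCommGroup Y] [Module k Y] [AddCommGroup Y'] [Module k Y']
  [AddCommGroup V] [Module k V] [AddCommGroup V'] [Module k V']

/-- The map `(y ⊗ h) ⊗ (v ⊗ q) ↦ (y ⊗ v) ⊗ a(h ⊗ q)`. -/
def mixed (a : H ⊗[k] Q →ₗ[k] Q) (Y V : Type u) [AddCommGroup Y] [Module k Y] [AddCommGroup V]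
    [Module k V] : (Y ⊗[k] H) ⊗[k] (V ⊗[k] Q) →ₗ[k] (Y ⊗[k] V) ⊗[k] Q :=
  a.lTensor (Y ⊗[k] V) ∘ₗ (TensorProduct.tensorTensorTensorComm k Y H V Q).toLinearMap

@[simp] lemma mixed_tmul (a : H ⊗[k] Q →ₗ[k] Q) (y : Y) (h : H) (v : V) (q : Q) :
    mixed a Y V ((y ⊗ₜ h) ⊗ₜ (v ⊗ₜ q)) = (y ⊗ₜ v) ⊗ₜ a (h ⊗ₜ q) := rfl

lemma mixed_map (a : H ⊗[k] Q →ₗ[k] Q) (f : Y →ₗ[k] Y') (g : V →ₗ[k] V') :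
    mixed a Y' V' ∘ₗ TensorProduct.map (f.rTensor H) (g.rTensor Q) =
      (TensorProduct.map f g).rTensor Q ∘ₗ mixed a Y V :=
  TensorProduct.ext_fourfold' fun _ _ _ _ => rfl

/-- The diagonal action `(h ⊗ h') ⊗ (x ⊗ y) ↦ a(h ⊗ x) ⊗ b(h' ⊗ y)`. -/
def diag (a : H ⊗[k] A →ₗ[k] A) (b : H ⊗[k] B →ₗ[k] B) :
    (H ⊗[k] H) ⊗[k] (A ⊗[k] B) →ₗ[k] A ⊗[k] B :=
  TensorProduct.map a b ∘ₗ (TensorProduct.tensorTensorTensorComm k H H A B).toLinearMap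

lemma mixed_assoc (a : H ⊗[k] A →ₗ[k] A) (b : H ⊗[k] B →ₗ[k] B) (Y V : Type u) [AddCommGroup Y]
    [Module k Y] [AddCommGroup V] [Module k V] :
    (mixed a Y V).rTensor B ∘ₗ mixed b (Y ⊗[k] H) (V ⊗[k] A) =
      (TensorProduct.assoc k (Y ⊗[k] V) A B).symm.toLinearMap ∘ₗ
        (diag a b).lTensor (Y ⊗[k] V) ∘ₗ
        (TensorProduct.tensorTensorTensorComm k Y (H ⊗[k] H) V (A ⊗[k] B)).toLinearMap ∘ₗ
        TensorProduct.map (TensorProduct.assoc k Y H H).toLinearMap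
          (TensorProduct.assoc k V A B).toLinearMap := by
  ext
  rfl

end Mixed

section MixedCoaction

variable {k H A B Q : Type u} [Field k] [Ring H] [Bialgebra k H] [AddCommGroup A]
  [Module k A] [AddCommGroup B] [Module k B] [AddCommGroup Q] [Module k Q]
  (V : Type u) [AddCommGroup V] [Module k V]

/-- The map `y ⊗ (v ⊗ q) ↦ (y₍₀₎ ⊗ v) ⊗ a(y₍₁₎ ⊗ q)`. -/
def mixedCoact (Y : Comod k H) (a : H ⊗[k] Q →ₗ[k] Q) :
    Y.carrier ⊗[k] (V ⊗[k] Q) →ₗ[k] (Y.carrier ⊗[k] V) ⊗[k] Q :=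
  mixed a Y.carrier V ∘ₗ Y.coact.rTensor (V ⊗[k] Q)

lemma mixedCoact_tmul (Y : Comod k H) (a : H ⊗[k] Q →ₗ[k] Q) (y : Y.carrier) (t : V ⊗[k] Q) :
    mixedCoact V Y a (y ⊗ₜ t) = mixed a Y.carrier V (Y.coact y ⊗ₜ t) := rfl

lemma mixedCoact_naturality {Y Y' : Comod k H} (f : Y ⟶ Y') {a : H ⊗[k] Q →ₗ[k] Q}
    {b : H ⊗[k] A →ₗ[k] A} {V V' : Type u} [AddCommGroup V] [Module k V] [AddCommGroup V']
    [Module k V'] (g : V →ₗ[k] V') (q : Q →ₗ[k] A) (hq : q ∘ₗ a = b ∘ₗ q.lTensor H) :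
    mixedCoact V' Y' b ∘ₗ TensorProduct.map (Comod.Hom.lin f) (TensorProduct.map g q) =
      TensorProduct.map (TensorProduct.map (Comod.Hom.lin f) g) q ∘ₗ mixedCoact V Y a := by
  refine TensorProduct.ext' fun y t => ?_
  have h1 : mixed b Y'.carrier V' ∘ₗ TensorProduct.map ((Comod.Hom.lin f).rTensor H)
      (TensorProduct.map g q) =
      TensorProduct.map (TensorProduct.map (Comod.Hom.lin f) g) q ∘ₗ mixed a Y.carrier V := by
    refine TensorProduct.ext_fourfold' fun y h v x => ?_
    exact congrArg (fun s => (Comod.Hom.lin f y ⊗ₜ[k] g v) ⊗ₜ[k] s)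
      (LinearMap.congr_fun hq (h ⊗ₜ x)).symm
  have h2 := LinearMap.congr_fun h1 (Y.coact y ⊗ₜ t)
  have h3 := LinearMap.congr_fun (Comod.Hom.colinear f) y
  simp only [LinearMap.comp_apply, TensorProduct.map_tmul] at h2 h3 ⊢
  rw [mixedCoact_tmul, mixedCoact_tmul, h3, h2]

lemma mixedCoact_act (Y : Comod k H) {C : Type u} [AddCommGroup C] [Module k C] [Module H C]
    [IsScalarTower k H C] [Coalgebra k C] [IsModuleCoalgebra k H C] (M : Comod k C) :
    mixedCoact M.carrier Y (actionMap k H C) ∘ₗ M.coact.lTensor Y.carrier =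
      (Comod.act Y M).coact :=
  TensorProduct.ext' fun _ _ => rfl

/-- With `δ(q) = α ⊗ β` in Sweedler fashion, both sides are `(y₀ ⊗ v) ⊗ y₁α ⊗ y₂β`: on the left by
the `H`-linearity `hδ`, on the right by acting twice, and the two agree by coassociativity of `Y`.
It is applied with `δ` the coaction of a Doi–Hopf module, the left coaction `l` on `B`, and the
identity. -/
lemma mixedCoact_assoc (Y : Comod k H) {a : H ⊗[k] Q →ₗ[k] Q} {b : H ⊗[k] A →ₗ[k] A}
    {c : H ⊗[k] B →ₗ[k] B} {δ : Q →ₗ[k] A ⊗[k] B}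
    (hδ : δ ∘ₗ a = diag b c ∘ₗ TensorProduct.map Coalgebra.comul δ) :
    ((TensorProduct.assoc k (Y.carrier ⊗[k] V) A B).symm.toLinearMap ∘ₗ
        δ.lTensor (Y.carrier ⊗[k] V)) ∘ₗ mixedCoact V Y a =
      (mixedCoact V Y b).rTensor B ∘ₗ mixedCoact (V ⊗[k] A) Y c ∘ₗ
        ((TensorProduct.assoc k V A B).symm.toLinearMap ∘ₗ δ.lTensor V).lTensor Y.carrier := by
  refine TensorProduct.ext' fun y t => ?_
  have h1 : δ.lTensor (Y.carrier ⊗[k] V) ∘ₗ mixed a Y.carrier V =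
      (diag b c).lTensor (Y.carrier ⊗[k] V) ∘ₗ (TensorProduct.tensorTensorTensorComm k Y.carrier
        (H ⊗[k] H) V (A ⊗[k] B)).toLinearMap ∘ₗ
        TensorProduct.map (Coalgebra.comul.lTensor Y.carrier) (δ.lTensor V) := by
    refine TensorProduct.ext_fourfold' fun y h v q => ?_
    exact congrArg (fun s => (y ⊗ₜ[k] v) ⊗ₜ[k] s) (LinearMap.congr_fun hδ (h ⊗ₜ q))
  have h2 : (mixedCoact V Y b).rTensor B ∘ₗ mixedCoact (V ⊗[k] A) Y c =
      ((mixed b Y.carrier V).rTensor B ∘ₗ mixed c (Y.carrier ⊗[k] H) (V ⊗[k] A)) ∘ₗ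
        (Y.coact.rTensor H ∘ₗ Y.coact).rTensor _ := by
    have h3 := mixed_map c Y.coact (LinearMap.id : V ⊗[k] A →ₗ[k] V ⊗[k] A)
    rw [LinearMap.rTensor_id] at h3
    unfold mixedCoact
    rw [LinearMap.rTensor_comp, LinearMap.rTensor_comp, LinearMap.comp_assoc, LinearMap.comp_assoc]
    congr 1
    rw [← LinearMap.comp_assoc, ← LinearMap.comp_assoc]
    congr 1
    exact h3.symm
  have h4 := LinearMap.congr_fun Y.coassoc y
  have h5 := LinearMap.congr_fun h1 (Y.coact y ⊗ₜ t)
  have h6 := LinearMap.congr_fun h2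
    (y ⊗ₜ (TensorProduct.assoc k V A B).symm (δ.lTensor V t))
  rw [mixed_assoc] at h6
  simp only [LinearMap.comp_apply, LinearMap.rTensor_tmul, LinearMap.lTensor_tmul,
    TensorProduct.map_tmul, LinearEquiv.coe_coe, LinearEquiv.apply_symm_apply] at h4 h5 h6 ⊢
  rw [h6, h4, mixedCoact, LinearMap.comp_apply, LinearMap.rTensor_tmul, h5]

end MixedCoaction

namespace DoiHopf

variable {k H C D : Type u} [Field k] [Ring H] [Bialgebra k H] [FiniteDimensional k H]
    [AddCommGroup C] [Module k C] [Module H C] [IsScalarTower k H C] [Coalgebra k C]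
    [IsModuleCoalgebra k H C]
    [AddCommGroup D] [Module k D] [Module H D] [IsScalarTower k H D]
    [Coalgebra k D] [IsModuleCoalgebra k H D]

lemma lift_hact_act (X X' : Comod k (DualBialg k H)) :
    TensorProduct.lift (Comod.act X X').hact =
      diag (TensorProduct.lift X.hact) (TensorProduct.lift X'.hact) ∘ₗ
        (Coalgebra.comul (R := k) (A := H)).rTensor (X.carrier ⊗[k] X'.carrier) := by
  have h1 : Comod.hact₂ X X' =
      TensorProduct.curry (diag (TensorProduct.lift X.hact) (TensorProduct.lift X'.hact)) :=
    TensorProduct.ext' fun _ _ => TensorProduct.ext' fun _ _ => rfl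
  refine TensorProduct.ext' fun h (t : X.carrier ⊗[k] X'.carrier) => ?_
  exact (LinearMap.congr_fun (Comod.hact_act X X' h) t).trans
    (LinearMap.congr_fun (LinearMap.congr_fun h1 (Coalgebra.comul (R := k) h)) t)

lemma lift_hact_ofMod : TensorProduct.lift (Comod.ofMod k H C).hact = actionMap k H C :=
  TensorProduct.ext' fun h c => Comod.hact_ofMod k H C h c

lemma toAct_hact {X : Comod k (DualBialg k H)} {M N : DoiHopf k H C} (f : N ⟶ X ⊙ₗ M) :
    Hom.lin (N := act X M) f ∘ₗ TensorProduct.lift N.X.hact =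
      diag (TensorProduct.lift X.hact) (TensorProduct.lift M.X.hact) ∘ₗ
        TensorProduct.map (Coalgebra.comul (R := k) (A := H)) (Hom.lin (N := act X M) f) := by
  refine TensorProduct.ext' fun h n => ?_
  exact (Comod.hom_hact (toAct f) h n).trans
    (LinearMap.congr_fun (lift_hact_act X M.X) (h ⊗ₜ Hom.lin (N := act X M) f n))

lemma ρ_hact (M : DoiHopf k H C) : M.ρ ∘ₗ TensorProduct.lift M.X.hact =
    diag (TensorProduct.lift M.X.hact) (actionMap k H C) ∘ₗ
      TensorProduct.map (Coalgebra.comul (R := k) (A := H)) M.ρ := by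
  have h1 := toAct_hact M.free
  rw [free_lin] at h1
  exact h1.trans (congrArg (fun b => diag (TensorProduct.lift M.X.hact) b ∘ₗ
      TensorProduct.map (Coalgebra.comul (R := k) (A := H)) M.ρ) lift_hact_ofMod)

/-- The morphism `Y ⊗ (V ⊗ M) → (Y ⊗ V) ⊗ M`, `y ⊗ (v ⊗ m) ↦ (y₍₀₎ ⊗ v) ⊗ y₍₁₎ m`. -/
def theta (Y : Comod k H) (V : Type u) [AddCommGroup V] [Module k V] (M : DoiHopf k H C) :
    Y ⊙ₗ Comod.vact V M.toC ⟶ Comod.vact (Y.carrier ⊗[k] V) M.toC :=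
  show Comod.act Y (Comod.vact V M.toC) ⟶ Comod.vact (Y.carrier ⊗[k] V) M.toC from
  { lin := mixedCoact V Y (TensorProduct.lift M.X.hact)
    colinear := by
      rw [← mixedCoact_act]
      exact mixedCoact_assoc V Y M.ρ_hact }

section ThetaProperties

variable (Y Y' : Comod k H) (V V' : Type u) [AddCommGroup V] [Module k V] [AddCommGroup V']
  [Module k V'] (M N : DoiHopf k H C)

variable {Y Y'} in
lemma theta_naturality_left (f : Y ⟶ Y') :
    f ⊵ₗ Comod.vact V M.toC ≫ theta Y' V M =
      theta Y V M ≫ Comod.vactMap ((Comod.Hom.lin f).rTensor V) (𝟙 M.toC) := by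
  have h1 := mixedCoact_naturality f (LinearMap.id (R := k) (M := V))
    (a := TensorProduct.lift M.X.hact) (b := TensorProduct.lift M.X.hact) LinearMap.id
    (by rw [LinearMap.lTensor_id]; rfl)
  rw [TensorProduct.map_id] at h1
  exact Comod.hom_ext h1

variable {V V' M N} in
lemma theta_naturality_right (g : V →ₗ[k] V') (f : M ⟶ N) :
    Y ⊴ₗ Comod.vactMap g (Hom.toC f) ≫ theta Y V' N =
      theta Y V M ≫ Comod.vactMap (g.lTensor Y.carrier) (Hom.toC f) := by
  have h2 : Hom.lin f ∘ₗ TensorProduct.lift M.X.hact =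
      TensorProduct.lift N.X.hact ∘ₗ (Hom.lin f).lTensor H :=
    TensorProduct.ext' fun h m => Comod.hom_hact (Hom.toX f) h m
  exact Comod.hom_ext (mixedCoact_naturality (𝟙 Y) g (Hom.lin f) h2)

/-- It rests on the module axiom `(hh')m = h(h'm)`, as the coaction of `Y ⊗ Y'` multiplies the
`H`-components. -/
lemma theta_assoc : theta (Y ⊗ Y') V M ≫
    Comod.vactMap (TensorProduct.assoc k Y.carrier Y'.carrier V).toLinearMap (𝟙 M.toC) =
      (αₗ Y Y' (Comod.vact V M.toC)).hom ≫ Y ⊴ₗ theta Y' V M ≫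
        theta Y (Y'.carrier ⊗[k] V) M := by
  have h1 : TensorProduct.map (TensorProduct.assoc k Y.carrier Y'.carrier V).toLinearMap
        (LinearMap.id (R := k) (M := M.X.carrier)) ∘ₗ
        mixed (TensorProduct.lift M.X.hact) (Y.carrier ⊗[k] Y'.carrier) V ∘ₗ
          (Comod.shuffle k H H Y.carrier Y'.carrier).rTensor _ =
      mixed (TensorProduct.lift M.X.hact) Y.carrier (Y'.carrier ⊗[k] V) ∘ₗ
        (mixed (TensorProduct.lift M.X.hact) Y'.carrier V).lTensor _ ∘ₗ
          (TensorProduct.assoc k (Y.carrier ⊗[k] H) (Y'.carrier ⊗[k] H)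
            (V ⊗[k] M.X.carrier)).toLinearMap := by
    ext y h y' h' v m
    simp [M.X.hact_mul]
  refine Comod.hom_ext (TensorProduct.ext_threefold fun y y' t => ?_)
  exact LinearMap.congr_fun h1 ((Y.coact y ⊗ₜ Y'.coact y') ⊗ₜ t)

lemma theta_unit : theta (𝟙_ (Comod k H)) V M ≫
    Comod.vactMap (TensorProduct.lid k V).toLinearMap (𝟙 M.toC) =
      (λₗ (Comod.vact V M.toC)).hom := by
  have h1 : ∀ (c : k) (t : V ⊗[k] M.X.carrier),
      TensorProduct.map (TensorProduct.lid k V).toLinearMap (LinearMap.id (R := k))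
        (mixed (TensorProduct.lift M.X.hact) k V ((c ⊗ₜ (1 : H)) ⊗ₜ t)) = c • t := by
    intro c t
    induction t with
    | zero => simp
    | add x y hx hy => simp only [TensorProduct.tmul_add, map_add, smul_add, hx, hy]
    | tmul v m => simp [M.X.hact_one, TensorProduct.smul_tmul']
  exact Comod.hom_ext (TensorProduct.ext' fun (c : k) t => h1 c t)

end ThetaProperties

end DoiHopf

end

/-! ### The cotensor product as a lax `M^H`-module functor -/

section

open MonoidalLeftAction Functor.LaxLeftLinear

namespace Comod

variable {k D : Type u} [Field k] [AddCommGroup D] [Module k D] [Coalgebra k D]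
  {W W' W'' : Type u} [AddCommGroup W] [Module k W] [AddCommGroup W'] [Module k W']
  [AddCommGroup W''] [Module k W'']

variable (W W') in
/-- The isomorphism `(W ⊗ W') ⊗ M ≅ W ⊗ (W' ⊗ M)`. -/
def vactAssocIso (M : Comod k D) : vact (W ⊗[k] W') M ≅ vact W (vact W' M) :=
  isoMk (M := vact (W ⊗[k] W') M) (N := vact W (vact W' M))
    (TensorProduct.assoc k W W' M.carrier) (vactAssoc W W' M).colinear

end Comod

namespace DoiHopf

variable {k H C D : Type u} [Field k] [Ring H] [Bialgebra k H] [FiniteDimensional k H]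
    [AddCommGroup C] [Module k C] [Module H C] [IsScalarTower k H C] [Coalgebra k C]
    [IsModuleCoalgebra k H C]
    [AddCommGroup D] [Module k D] [Module H D] [IsScalarTower k H D]
    [Coalgebra k D] [IsModuleCoalgebra k H D]
  {B : DoiHopf k H D} (l : B ⟶ Comod.ofMod k H C ⊙ₗ B)

variable (B) in
/-- The map `V ⊗ B → V ⊗ C ⊗ B` given by the coaction of `V`. -/
def cotLeft (V : Comod k C) :
    Comod.vact V.carrier B.toC ⟶ Comod.vact (V.carrier ⊗[k] C) B.toC :=
  Comod.vactMap V.coact (𝟙 B.toC)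

/-- The map `V ⊗ B → V ⊗ C ⊗ B` given by `l`. -/
def cotRight (V : Type u) [AddCommGroup V] [Module k V] :
    Comod.vact V B.toC ⟶ Comod.vact (V ⊗[k] C) B.toC :=
  Comod.vactMap LinearMap.id (Hom.toC (N := act (Comod.ofMod k H C) B) l) ≫
    (Comod.vactAssocIso V C B.toC).inv

lemma cotLeft_naturality {V V' : Comod k C} (f : V ⟶ V') :
    Comod.vactMap (Comod.Hom.lin f) (𝟙 B.toC) ≫ cotLeft B V' =
      cotLeft B V ≫ Comod.vactMap ((Comod.Hom.lin f).rTensor C) (𝟙 B.toC) := by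
  refine Comod.hom_ext (TensorProduct.ext' fun v b => ?_)
  exact congrArg (fun t => t ⊗ₜ[k] b) (LinearMap.congr_fun (Comod.Hom.colinear f) v)

lemma cotRight_naturality {V V' : Type u} [AddCommGroup V] [Module k V] [AddCommGroup V']
    [Module k V'] (f : V →ₗ[k] V') :
    Comod.vactMap f (𝟙 B.toC) ≫ cotRight l V' =
      cotRight l V ≫ Comod.vactMap (f.rTensor C) (𝟙 B.toC) := by
  refine Comod.hom_ext (TensorProduct.ext' fun v b => ?_)
  have h1 : ∀ t : C ⊗[k] B.X.carrier,
      (TensorProduct.assoc k V' C B.X.carrier).symm (f v ⊗ₜ t) =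
      TensorProduct.map (f.rTensor C) LinearMap.id
        ((TensorProduct.assoc k V C B.X.carrier).symm (v ⊗ₜ t)) := by
    intro t
    induction t with
    | zero => simp
    | add x y hx hy => simp only [TensorProduct.tmul_add, map_add, hx, hy]
    | tmul => rfl
  exact h1 (Hom.lin (N := act (Comod.ofMod k H C) B) l b)

section

variable (B)

/-- The morphism `theta` for a comodule `V`. -/
def cotTheta (Y : Comod k H) (V : Comod k C) :
    Y ⊙ₗ Comod.vact V.carrier B.toC ⟶ Comod.vact (Y ⊙ₗ V).carrier B.toC :=
  theta Y V.carrier B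

lemma cotTheta_naturality_left {Y Y' : Comod k H} (f : Y ⟶ Y') (V : Comod k C) :
    f ⊵ₗ Comod.vact V.carrier B.toC ≫ cotTheta B Y' V =
      cotTheta B Y V ≫ Comod.vactMap (Comod.Hom.lin (f ⊵ₗ V)) (𝟙 B.toC) :=
  theta_naturality_left V.carrier B f

lemma cotTheta_naturality_right (Y : Comod k H) {V V' : Comod k C} (f : V ⟶ V') :
    Y ⊴ₗ Comod.vactMap (Comod.Hom.lin f) (𝟙 B.toC) ≫ cotTheta B Y V' =
      cotTheta B Y V ≫ Comod.vactMap (Comod.Hom.lin (Y ⊴ₗ f)) (𝟙 B.toC) :=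
  theta_naturality_right Y (Comod.Hom.lin f) (𝟙 B)

lemma cotTheta_assoc (Y Y' : Comod k H) (V : Comod k C) : cotTheta B (Y ⊗ Y') V ≫
    Comod.vactMap (Comod.Hom.lin (αₗ Y Y' V).hom) (𝟙 B.toC) =
      (αₗ Y Y' (Comod.vact V.carrier B.toC)).hom ≫ Y ⊴ₗ cotTheta B Y' V ≫
        cotTheta B Y (Y' ⊙ₗ V) :=
  theta_assoc Y Y' V.carrier B

lemma cotTheta_unit (V : Comod k C) : cotTheta B (𝟙_ (Comod k H)) V ≫
    Comod.vactMap (Comod.Hom.lin (λₗ V).hom) (𝟙 B.toC) =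
      (λₗ (Comod.vact V.carrier B.toC)).hom :=
  theta_unit V.carrier B

end

-- The coaction of `Y ⊗ V` is that of `V` followed by `y ⊗ (v ⊗ c) ↦ (y₀ ⊗ v) ⊗ y₁c`
-- (`mixedCoact_act`). The companion `theta_cotRight` brings out the same outer map, so `theta`
-- carries the equalizer defining `V □ B` into the one for `Y ⊗ V`.
variable (B) in
lemma theta_cotLeft (Y : Comod k H) (V : Comod k C) :
    Comod.Hom.lin (cotTheta B Y V ≫ cotLeft B (Y ⊙ₗ V)) =
      (mixedCoact V.carrier Y (actionMap k H C)).rTensor B.X.carrier ∘ₗ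
        Comod.Hom.lin (Y ⊴ₗ cotLeft B V ≫ theta Y (V.carrier ⊗[k] C) B) := by
  have h1 := theta_naturality_right (M := B) Y V.coact (𝟙 B)
  refine Eq.trans ?_ (congrArg (fun f => (mixedCoact V.carrier Y (actionMap k H C)).rTensor
    B.X.carrier ∘ₗ Comod.Hom.lin f) h1.symm)
  have h2 := (LinearMap.rTensor_comp B.X.carrier (mixedCoact V.carrier Y (actionMap k H C))
    (V.coact.lTensor Y.carrier)).symm.trans (congrArg (fun f => LinearMap.rTensor B.X.carrier f)
      (mixedCoact_act Y V))
  exact congrArg (fun f => f ∘ₗ Comod.Hom.lin (theta Y V.carrier B)) h2.symm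

/-- The left coaction `l` is a morphism of Doi–Hopf modules, hence `H`-linear for the diagonal
action, which is the hypothesis of `mixedCoact_assoc`. -/
lemma theta_cotRight (Y : Comod k H) (V : Comod k C) :
    Comod.Hom.lin (cotTheta B Y V ≫ cotRight l (Y ⊙ₗ V).carrier) =
      (mixedCoact V.carrier Y (actionMap k H C)).rTensor B.X.carrier ∘ₗ
        Comod.Hom.lin (Y ⊴ₗ cotRight l V.carrier ≫ theta Y (V.carrier ⊗[k] C) B) := by
  have h1 := toAct_hact l
  rw [lift_hact_ofMod] at h1
  exact mixedCoact_assoc V.carrier Y h1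

/-- The cotensor product of a `C`-comodule and `B`. -/
def cotensor (V : Comod k C) : Comod k D := Comod.eqz (cotLeft B V) (cotRight l V.carrier)

/-- The inclusion `V □ B → V ⊗ B`. -/
def cotι (V : Comod k C) : cotensor l V ⟶ Comod.vact V.carrier B.toC :=
  Comod.eqzι (cotLeft B V) (cotRight l V.carrier)

lemma cotι_injective (V : Comod k C) : Function.Injective (Comod.Hom.lin (cotι l V)) :=
  Comod.eqzι_injective _ _

lemma cotι_condition (V : Comod k C) :
    cotι l V ≫ cotLeft B V = cotι l V ≫ cotRight l V.carrier := Comod.eqz_condition _ _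

/-- The factorization through a cotensor product. -/
def cotLift {V : Comod k C} {T : Comod k D} (s : T ⟶ Comod.vact V.carrier B.toC)
    (h : s ≫ cotLeft B V = s ≫ cotRight l V.carrier) : T ⟶ cotensor l V := Comod.eqzLift s h

lemma hom_ext_cotι {V : Comod k C} {T : Comod k D} {f g : T ⟶ cotensor l V}
    (h : f ≫ cotι l V = g ≫ cotι l V) : f = g := Comod.hom_ext_of_injective (cotι_injective l V) h

/-- The functoriality of the cotensor product. -/
def cotMap {V V' : Comod k C} (f : V ⟶ V') : cotensor l V ⟶ cotensor l V' :=
  cotLift l (cotι l V ≫ Comod.vactMap (Comod.Hom.lin f) (𝟙 B.toC)) (by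
    rw [Category.assoc, Category.assoc, cotLeft_naturality, cotRight_naturality,
      ← Category.assoc, cotι_condition, Category.assoc])

lemma cotMap_ι {V V' : Comod k C} (f : V ⟶ V') :
    cotMap l f ≫ cotι l V' = cotι l V ≫ Comod.vactMap (Comod.Hom.lin f) (𝟙 B.toC) := rfl

/-- The cotensor product functor. -/
def cotFunctor : Comod k C ⥤ Comod k D where
  obj := cotensor l
  map := cotMap l
  map_id V := hom_ext_cotι l (Comod.hom_ext (LinearMap.ext fun t =>
    LinearMap.congr_fun (TensorProduct.map_id (R := k) (M := V.carrier) (N := B.X.carrier))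
      (Comod.Hom.lin (cotι l V) t)))
  map_comp f g := hom_ext_cotι l (Comod.hom_ext (LinearMap.ext fun t =>
    LinearMap.congr_fun (TensorProduct.map_comp (Comod.Hom.lin g) (LinearMap.id (R := k)
      (M := B.X.carrier)) (Comod.Hom.lin f) LinearMap.id) (Comod.Hom.lin (cotι l _) t)))

lemma cotμ_condition (Y : Comod k H) (V : Comod k C) :
    (Y ⊴ₗ cotι l V ≫ cotTheta B Y V) ≫ cotLeft B (Y ⊙ₗ V) =
      (Y ⊴ₗ cotι l V ≫ cotTheta B Y V) ≫ cotRight l (Y ⊙ₗ V).carrier := by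
  have h1 : Y ⊴ₗ cotι l V ≫ Y ⊴ₗ cotLeft B V = Y ⊴ₗ cotι l V ≫ Y ⊴ₗ cotRight l V.carrier := by
    rw [← actionHomRight_comp, cotι_condition, actionHomRight_comp]
  refine Comod.hom_ext (LinearMap.ext fun t => ?_)
  have h2 := LinearMap.congr_fun (congrArg Comod.Hom.lin h1) t
  refine (LinearMap.congr_fun (theta_cotLeft B Y V) (Comod.Hom.lin (Y ⊴ₗ cotι l V) t)).trans
    (Eq.trans ?_ (LinearMap.congr_fun (theta_cotRight l Y V)
      (Comod.Hom.lin (Y ⊴ₗ cotι l V) t)).symm)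
  exact congrArg (fun x => (mixedCoact V.carrier Y (actionMap k H C)).rTensor B.X.carrier
    (Comod.Hom.lin (theta Y (V.carrier ⊗[k] C) B) x)) h2

/-- The morphism `Y ⊗ (V □ B) → (Y ⊗ V) □ B`. -/
def cotμ (Y : Comod k H) (V : Comod k C) : Y ⊙ₗ cotensor l V ⟶ cotensor l (Y ⊙ₗ V) :=
  cotLift l (Y ⊴ₗ cotι l V ≫ cotTheta B Y V) (cotμ_condition l Y V)

lemma cotμ_ι (Y : Comod k H) (V : Comod k C) :
    cotμ l Y V ≫ cotι l (Y ⊙ₗ V) = Y ⊴ₗ cotι l V ≫ cotTheta B Y V := rfl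

/-- For this and the next three lemmas: the target is a cotensor product, so the equation may be
tested after the injective `cotι`, where it becomes the corresponding property of `theta`. -/
lemma cotμ_naturality_left {Y Y' : Comod k H} (f : Y ⟶ Y') (V : Comod k C) :
    f ⊵ₗ cotensor l V ≫ cotμ l Y' V = cotμ l Y V ≫ cotMap l (f ⊵ₗ V) := by
  apply hom_ext_cotι
  have h2 : f ⊵ₗ cotensor l V ≫ Y' ⊴ₗ cotι l V = Y ⊴ₗ cotι l V ≫ f ⊵ₗ _ :=
    (action_exchange f (cotι l V)).symm
  rw [Category.assoc, Category.assoc, cotμ_ι, cotMap_ι, reassoc_of% cotμ_ι l Y V,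
    reassoc_of% h2, cotTheta_naturality_left]

lemma cotμ_naturality_right (Y : Comod k H) {V V' : Comod k C} (f : V ⟶ V') :
    Y ⊴ₗ cotMap l f ≫ cotμ l Y V' = cotμ l Y V ≫ cotMap l (Y ⊴ₗ f) := by
  apply hom_ext_cotι
  rw [Category.assoc, Category.assoc, cotμ_ι, cotMap_ι, reassoc_of% cotμ_ι l Y V,
    ← actionHomRight_comp_assoc, cotMap_ι, actionHomRight_comp, Category.assoc,
    cotTheta_naturality_right]

lemma cotμ_associativity (Y Y' : Comod k H) (V : Comod k C) :
    cotμ l (Y ⊗ Y') V ≫ cotMap l (αₗ Y Y' V).hom =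
      (αₗ Y Y' (cotensor l V)).hom ≫ Y ⊴ₗ cotμ l Y' V ≫ cotμ l Y (Y' ⊙ₗ V) := by
  apply hom_ext_cotι
  have h2 : (αₗ Y Y' (cotensor l V)).hom ≫ Y ⊴ₗ Y' ⊴ₗ cotι l V =
    (Y ⊗ Y') ⊴ₗ cotι l V ≫ (αₗ Y Y' _).hom := by simp
  rw [Category.assoc, Category.assoc, Category.assoc, cotμ_ι, cotMap_ι,
    reassoc_of% cotμ_ι l (Y ⊗ Y') V, ← actionHomRight_comp_assoc, cotμ_ι, actionHomRight_comp,
    Category.assoc, reassoc_of% h2, cotTheta_assoc]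

lemma cotμ_unitality (V : Comod k C) :
    (λₗ (cotensor l V)).hom = cotμ l (𝟙_ (Comod k H)) V ≫ cotMap l (λₗ V).hom := by
  apply hom_ext_cotι
  rw [Category.assoc, cotMap_ι, reassoc_of% cotμ_ι l (𝟙_ (Comod k H)) V, cotTheta_unit,
    actionUnitIso_hom_naturality]

instance : (cotFunctor l).LaxLeftLinear (Comod k H) where
  μₗ Y V := cotμ l Y V
  μₗ_naturality_left f V := cotμ_naturality_left l f V
  μₗ_naturality_right Y _ _ f := cotμ_naturality_right l Y f
  μₗ_associativity Y Y' V := cotμ_associativity l Y Y' V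
  μₗ_unitality V := cotμ_unitality l V

end DoiHopf

end

/-! ### Iterated cotensor products: `(V □ B) □ B' ≅ V` -/

section

open MonoidalLeftAction Functor.LaxLeftLinear

section Balanced

variable {k V C Q D Q' E : Type u} [Field k] [AddCommGroup V] [Module k V] [AddCommGroup C]
  [Module k C] [AddCommGroup Q] [Module k Q] [AddCommGroup D] [Module k D] [AddCommGroup Q']
  [Module k Q'] [AddCommGroup E] [Module k E]

/-- The equations that define the cotensor product inside `V ⊗ (Q ⊗ Q')`. -/
structure IsBalanced (ρ : V →ₗ[k] V ⊗[k] C) (l : Q →ₗ[k] C ⊗[k] Q) (r : Q →ₗ[k] Q ⊗[k] D)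
    (l' : Q' →ₗ[k] D ⊗[k] Q') (t : V ⊗[k] (Q ⊗[k] Q')) : Prop where
  left : ρ.rTensor (Q ⊗[k] Q') t = (TensorProduct.assoc k V C (Q ⊗[k] Q')).symm
    (((TensorProduct.assoc k C Q Q').toLinearMap ∘ₗ l.rTensor Q').lTensor V t)
  right : (r.rTensor Q').lTensor V t =
    ((TensorProduct.assoc k Q D Q').symm.toLinearMap ∘ₗ l'.lTensor Q).lTensor V t

/-- The map `j` intertwines `δ` with `Λ`, and tensoring it with a space stays injective, so the
condition can be tested before applying `j`. With `j : C → B ⊗ B'` it reduces balancedness over `C`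
to the equalizer condition of the coaction of `V`. -/
lemma lTensor_coaction_iff (ρ : V →ₗ[k] V ⊗[k] C) {δ : C →ₗ[k] C ⊗[k] C} {Λ : Q →ₗ[k] C ⊗[k] Q}
    {j : C →ₗ[k] Q} (hj : Function.Injective j) (h : Λ ∘ₗ j = j.lTensor C ∘ₗ δ) (s : V ⊗[k] C) :
    ρ.rTensor Q (j.lTensor V s) = (TensorProduct.assoc k V C Q).symm
      (Λ.lTensor V (j.lTensor V s)) ↔
    ρ.rTensor C s = (TensorProduct.assoc k V C C).symm (δ.lTensor V s) := by
  have h1 : ρ.rTensor Q ∘ₗ j.lTensor V = j.lTensor (V ⊗[k] C) ∘ₗ ρ.rTensor C :=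
    TensorProduct.ext' fun _ _ => rfl
  have h2 : (TensorProduct.assoc k V C Q).symm.toLinearMap ∘ₗ (j.lTensor C).lTensor V =
      j.lTensor (V ⊗[k] C) ∘ₗ (TensorProduct.assoc k V C C).symm.toLinearMap :=
    TensorProduct.ext_threefold' fun _ _ _ => rfl
  have h3 : Λ.lTensor V (j.lTensor V s) = (j.lTensor C).lTensor V (δ.lTensor V s) := by
    rw [← LinearMap.comp_apply, ← LinearMap.lTensor_comp, h, LinearMap.lTensor_comp]
    rfl
  have h4 := LinearMap.congr_fun h1 s
  have h5 := LinearMap.congr_fun h2 (δ.lTensor V s)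
  simp only [LinearMap.comp_apply, LinearEquiv.coe_coe] at h4 h5
  rw [h3, h4, h5]
  exact (Module.Flat.lTensor_preserves_injective_linearMap j hj).eq_iff

lemma balanced_left_iff (ρ : V →ₗ[k] V ⊗[k] C) (l : Q →ₗ[k] C ⊗[k] Q)
    (t : (V ⊗[k] Q) ⊗[k] Q') :
    ρ.rTensor (Q ⊗[k] Q') (TensorProduct.assoc k V Q Q' t) =
      (TensorProduct.assoc k V C (Q ⊗[k] Q')).symm
        (((TensorProduct.assoc k C Q Q').toLinearMap ∘ₗ l.rTensor Q').lTensor V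
          (TensorProduct.assoc k V Q Q' t)) ↔
    (ρ.rTensor Q).rTensor Q' t =
      ((TensorProduct.assoc k V C Q).symm.toLinearMap ∘ₗ l.lTensor V).rTensor Q' t := by
  have h1 : ρ.rTensor (Q ⊗[k] Q') ∘ₗ (TensorProduct.assoc k V Q Q').toLinearMap =
      (TensorProduct.assoc k (V ⊗[k] C) Q Q').toLinearMap ∘ₗ (ρ.rTensor Q).rTensor Q' :=
    TensorProduct.ext_threefold fun _ _ _ => rfl
  have h2 : (TensorProduct.assoc k V C (Q ⊗[k] Q')).symm.toLinearMap ∘ₗ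
      ((TensorProduct.assoc k C Q Q').toLinearMap ∘ₗ l.rTensor Q').lTensor V ∘ₗ
        (TensorProduct.assoc k V Q Q').toLinearMap =
      (TensorProduct.assoc k (V ⊗[k] C) Q Q').toLinearMap ∘ₗ
        ((TensorProduct.assoc k V C Q).symm.toLinearMap ∘ₗ l.lTensor V).rTensor Q' := by
    refine TensorProduct.ext_threefold fun v q q' => ?_
    have h3 : ∀ s : C ⊗[k] Q, (TensorProduct.assoc k V C (Q ⊗[k] Q')).symm
        (v ⊗ₜ TensorProduct.assoc k C Q Q' (s ⊗ₜ q')) = TensorProduct.assoc k (V ⊗[k] C) Q Q'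
          ((TensorProduct.assoc k V C Q).symm (v ⊗ₜ s) ⊗ₜ q') := by
      intro s
      induction s with
      | zero => simp
      | add x y hx hy => simp only [TensorProduct.add_tmul, TensorProduct.tmul_add, map_add, hx, hy]
      | tmul => rfl
    exact h3 (l q)
  have h4 := LinearMap.congr_fun h1 t
  have h5 := LinearMap.congr_fun h2 t
  simp only [LinearMap.comp_apply, LinearEquiv.coe_coe] at h4 h5
  rw [h4, h5]
  exact (TensorProduct.assoc k (V ⊗[k] C) Q Q').injective.eq_iff

lemma balanced_right_iff (r : Q →ₗ[k] Q ⊗[k] D) (l' : Q' →ₗ[k] D ⊗[k] Q')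
    (t : (V ⊗[k] Q) ⊗[k] Q') :
    (r.rTensor Q').lTensor V (TensorProduct.assoc k V Q Q' t) =
      ((TensorProduct.assoc k Q D Q').symm.toLinearMap ∘ₗ l'.lTensor Q).lTensor V
        (TensorProduct.assoc k V Q Q' t) ↔
    ((TensorProduct.assoc k V Q D).symm.toLinearMap ∘ₗ r.lTensor V).rTensor Q' t =
      (TensorProduct.assoc k (V ⊗[k] Q) D Q').symm (l'.lTensor (V ⊗[k] Q) t) := by
  let e : ((V ⊗[k] Q) ⊗[k] D) ⊗[k] Q' ≃ₗ[k] V ⊗[k] ((Q ⊗[k] D) ⊗[k] Q') :=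
    (TensorProduct.congr (TensorProduct.assoc k V Q D) (LinearEquiv.refl k Q')).trans
      (TensorProduct.assoc k V (Q ⊗[k] D) Q')
  have h1 : (r.rTensor Q').lTensor V ∘ₗ (TensorProduct.assoc k V Q Q').toLinearMap =
      e.toLinearMap ∘ₗ
        ((TensorProduct.assoc k V Q D).symm.toLinearMap ∘ₗ r.lTensor V).rTensor Q' := by
    refine TensorProduct.ext_threefold fun v q q' => ?_
    simp [e]
  have h2 : ((TensorProduct.assoc k Q D Q').symm.toLinearMap ∘ₗ l'.lTensor Q).lTensor V ∘ₗ
      (TensorProduct.assoc k V Q Q').toLinearMap = e.toLinearMap ∘ₗ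
        (TensorProduct.assoc k (V ⊗[k] Q) D Q').symm.toLinearMap ∘ₗ l'.lTensor (V ⊗[k] Q) := by
    refine TensorProduct.ext_threefold fun v q q' => ?_
    have h3 : ∀ s : D ⊗[k] Q', v ⊗ₜ (TensorProduct.assoc k Q D Q').symm (q ⊗ₜ s) =
        e ((TensorProduct.assoc k (V ⊗[k] Q) D Q').symm ((v ⊗ₜ q) ⊗ₜ s)) := by
      intro s
      induction s with
      | zero => simp
      | add x y hx hy => simp only [TensorProduct.tmul_add, map_add, hx, hy]
      | tmul => rfl
    exact h3 (l' q')
  have h4 := LinearMap.congr_fun h1 t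
  have h5 := LinearMap.congr_fun h2 t
  simp only [LinearMap.comp_apply, LinearEquiv.coe_coe] at h4 h5
  rw [h4, h5]
  exact e.injective.eq_iff

lemma rTensor_coaction_iff {r : V →ₗ[k] V ⊗[k] D} {ρ : E →ₗ[k] E ⊗[k] D} {i : E →ₗ[k] V}
    (hi : Function.Injective i) (h : r ∘ₗ i = i.rTensor D ∘ₗ ρ) (l' : Q' →ₗ[k] D ⊗[k] Q')
    (s : E ⊗[k] Q') :
    r.rTensor Q' (i.rTensor Q' s) =
      (TensorProduct.assoc k V D Q').symm (l'.lTensor V (i.rTensor Q' s)) ↔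
    ρ.rTensor Q' s = (TensorProduct.assoc k E D Q').symm (l'.lTensor E s) := by
  have h1 : r.rTensor Q' (i.rTensor Q' s) = (i.rTensor D).rTensor Q' (ρ.rTensor Q' s) := by
    rw [← LinearMap.comp_apply, ← LinearMap.rTensor_comp, h, LinearMap.rTensor_comp]
    rfl
  have h2 : (TensorProduct.assoc k V D Q').symm.toLinearMap ∘ₗ l'.lTensor V ∘ₗ i.rTensor Q' =
      (i.rTensor D).rTensor Q' ∘ₗ (TensorProduct.assoc k E D Q').symm.toLinearMap ∘ₗ
        l'.lTensor E := by
    refine TensorProduct.ext' fun x q' => ?_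
    have h3 : ∀ s : D ⊗[k] Q', (TensorProduct.assoc k V D Q').symm (i x ⊗ₜ s) =
        (i.rTensor D).rTensor Q' ((TensorProduct.assoc k E D Q').symm (x ⊗ₜ s)) := by
      intro s
      induction s with
      | zero => simp
      | add x y hx hy => simp only [TensorProduct.tmul_add, map_add, hx, hy]
      | tmul => rfl
    exact h3 (l' q')
  have h5 := LinearMap.congr_fun h2 s
  simp only [LinearMap.comp_apply, LinearEquiv.coe_coe] at h5
  rw [h1, h5]
  exact (Module.Flat.rTensor_preserves_injective_linearMap (M := Q') _
    (Module.Flat.rTensor_preserves_injective_linearMap (M := D) i hi)).eq_iff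

lemma lTensor_apply_eq {f g : Q →ₗ[k] D} {j : C →ₗ[k] Q} (h : f ∘ₗ j = g ∘ₗ j) (s : V ⊗[k] C) :
    f.lTensor V (j.lTensor V s) = g.lTensor V (j.lTensor V s) := by
  rw [← LinearMap.comp_apply, ← LinearMap.comp_apply, ← LinearMap.lTensor_comp,
    ← LinearMap.lTensor_comp, h]

/-- The elements of `E ⊗ Q'` that are balanced in `V ⊗ (Q ⊗ Q')`, where `E ⊆ V ⊗ Q` is the
cotensor product. -/
lemma isBalanced_iff {ρ : V →ₗ[k] V ⊗[k] C} {l : Q →ₗ[k] C ⊗[k] Q} {r : Q →ₗ[k] Q ⊗[k] D}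
    (l' : Q' →ₗ[k] D ⊗[k] Q') {i : E →ₗ[k] V ⊗[k] Q} (hi : Function.Injective i)
    (h : ρ.rTensor Q ∘ₗ i = ((TensorProduct.assoc k V C Q).symm.toLinearMap ∘ₗ l.lTensor V) ∘ₗ i)
    {ρ' : E →ₗ[k] E ⊗[k] D}
    (h' : ((TensorProduct.assoc k V Q D).symm.toLinearMap ∘ₗ r.lTensor V) ∘ₗ i =
      i.rTensor D ∘ₗ ρ') (s : E ⊗[k] Q') :
    IsBalanced ρ l r l' (TensorProduct.assoc k V Q Q' (i.rTensor Q' s)) ↔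
      ρ'.rTensor Q' s = (TensorProduct.assoc k E D Q').symm (l'.lTensor E s) := by
  rw [← rTensor_coaction_iff hi h' l' s, ← balanced_right_iff]
  refine ⟨fun hs => hs.right, fun hs => ⟨(balanced_left_iff ρ l _).2 ?_, hs⟩⟩
  rw [← LinearMap.comp_apply, ← LinearMap.comp_apply, ← LinearMap.rTensor_comp,
    ← LinearMap.rTensor_comp, h]

end Balanced

/-- The case of `mixedCoact_assoc` in which `δ` is the identity of `A ⊗ B` with the diagonal action.
It lets `theta` be applied to `B` and `B'` in turn or to `B ⊗ B'` at once. -/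
lemma mixedCoact_diag {k H A B : Type u} [Field k] [Ring H] [Bialgebra k H] [AddCommGroup A]
    [Module k A] [AddCommGroup B] [Module k B] (V : Type u) [AddCommGroup V] [Module k V]
    (Y : Comod k H) {a : H ⊗[k] (A ⊗[k] B) →ₗ[k] A ⊗[k] B} {b : H ⊗[k] A →ₗ[k] A}
    {c : H ⊗[k] B →ₗ[k] B} (h : a = diag b c ∘ₗ Coalgebra.comul.rTensor (A ⊗[k] B)) :
    (TensorProduct.assoc k (Y.carrier ⊗[k] V) A B).toLinearMap ∘ₗ
      (mixedCoact V Y b).rTensor B ∘ₗ mixedCoact (V ⊗[k] A) Y c =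
    mixedCoact V Y a ∘ₗ (TensorProduct.assoc k V A B).toLinearMap.lTensor Y.carrier := by
  have h1 := mixedCoact_assoc V Y (δ := LinearMap.id) h
  rw [LinearMap.lTensor_id, LinearMap.lTensor_id, LinearMap.comp_id, LinearMap.comp_id] at h1
  have h2 : (TensorProduct.assoc k V A B).symm.toLinearMap.lTensor Y.carrier ∘ₗ
      (TensorProduct.assoc k V A B).toLinearMap.lTensor Y.carrier = LinearMap.id := by
    rw [← LinearMap.lTensor_comp, LinearEquiv.symm_comp, LinearMap.lTensor_id]
  have h3 := congrArg (fun f => (TensorProduct.assoc k (Y.carrier ⊗[k] V) A B).toLinearMap ∘ₗ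
    f ∘ₗ (TensorProduct.assoc k V A B).toLinearMap.lTensor Y.carrier) h1
  simp only [LinearMap.comp_assoc, h2, LinearMap.comp_id] at h3
  rw [← h3, ← LinearMap.comp_assoc, LinearEquiv.comp_symm, LinearMap.id_comp]

namespace Comod

variable {k C : Type u} [Field k] [AddCommGroup C] [Module k C] [Coalgebra k C]

/-- Two comodules with the same image in a third one are isomorphic. -/
def isoOfRange {A B E : Comod k C} (f : A ⟶ E) (g : B ⟶ E) (hf : Function.Injective (Hom.lin f))
    (hg : Function.Injective (Hom.lin g)) (h₁ : ∀ a, ∃ b, Hom.lin g b = Hom.lin f a)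
    (h₂ : ∀ b, ∃ a, Hom.lin f a = Hom.lin g b) : A ≅ B where
  hom := ⟨factor (Hom.lin g) hg (Hom.lin f) h₁, colinear_of_comp g hg f _ (comp_factor _ _ _ _)⟩
  inv := ⟨factor (Hom.lin f) hf (Hom.lin g) h₂, colinear_of_comp f hf g _ (comp_factor _ _ _ _)⟩
  hom_inv_id := hom_ext_of_injective hf (hom_ext (by
    change Hom.lin f ∘ₗ factor (Hom.lin f) hf (Hom.lin g) h₂ ∘ₗ
      factor (Hom.lin g) hg (Hom.lin f) h₁ = Hom.lin f
    rw [← LinearMap.comp_assoc, comp_factor, comp_factor]))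
  inv_hom_id := hom_ext_of_injective hg (hom_ext (by
    change Hom.lin g ∘ₗ factor (Hom.lin g) hg (Hom.lin f) h₁ ∘ₗ
      factor (Hom.lin f) hf (Hom.lin g) h₂ = Hom.lin g
    rw [← LinearMap.comp_assoc, comp_factor, comp_factor]))

lemma isoOfRange_comp {A B E : Comod k C} (f : A ⟶ E) (g : B ⟶ E)
    (hf : Function.Injective (Hom.lin f)) (hg : Function.Injective (Hom.lin g))
    (h₁ : ∀ a, ∃ b, Hom.lin g b = Hom.lin f a) (h₂ : ∀ b, ∃ a, Hom.lin f a = Hom.lin g b) :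
    (isoOfRange f g hf hg h₁ h₂).hom ≫ g = f :=
  hom_ext (comp_factor _ _ _ _)

end Comod

namespace DoiHopf

variable {k H C D : Type u} [Field k] [Ring H] [Bialgebra k H] [FiniteDimensional k H]
    [AddCommGroup C] [Module k C] [Module H C] [IsScalarTower k H C] [Coalgebra k C]
    [IsModuleCoalgebra k H C]
    [AddCommGroup D] [Module k D] [Module H D] [IsScalarTower k H D]
    [Coalgebra k D] [IsModuleCoalgebra k H D]

/-- The linear map underlying a coaction. -/
def coLin {B : DoiHopf k H D} (l : B ⟶ Comod.ofMod k H C ⊙ₗ B) :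
    B.X.carrier →ₗ[k] C ⊗[k] B.X.carrier :=
  Hom.lin (N := act (Comod.ofMod k H C) B) l

/-- A presentation of `C` as the cotensor product of `B` and `B'`. -/
structure Presentation {B : DoiHopf k H D} {B' : DoiHopf k H C}
    (l : B ⟶ Comod.ofMod k H C ⊙ₗ B) (l' : B' ⟶ Comod.ofMod k H D ⊙ₗ B') where
  /-- The inclusion `C → B ⊗ B'`. -/
  j : regular k H C ⟶ act B.X B'
  injective : Function.Injective (Hom.lin j)
  comp_ρ : (B.ρ.rTensor B'.X.carrier) ∘ₗ Hom.lin j =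
    ((TensorProduct.assoc k B.X.carrier D B'.X.carrier).symm.toLinearMap ∘ₗ
      LinearMap.lTensor B.X.carrier (coLin l')) ∘ₗ Hom.lin j
  exists_j : ∀ t : B.X.carrier ⊗[k] B'.X.carrier, B.ρ.rTensor B'.X.carrier t =
    ((TensorProduct.assoc k B.X.carrier D B'.X.carrier).symm.toLinearMap ∘ₗ
      LinearMap.lTensor B.X.carrier (coLin l')) t →
        ∃ c, Hom.lin j c = t
  comul : ((TensorProduct.assoc k C B.X.carrier B'.X.carrier).toLinearMap ∘ₗ
      LinearMap.rTensor B'.X.carrier (coLin l)) ∘ₗ Hom.lin j =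
    LinearMap.lTensor C (Hom.lin j : C →ₗ[k] B.X.carrier ⊗[k] B'.X.carrier) ∘ₗ Coalgebra.comul

namespace Presentation

variable {B : DoiHopf k H D} {B' : DoiHopf k H C} {l : B ⟶ Comod.ofMod k H C ⊙ₗ B}
  {l' : B' ⟶ Comod.ofMod k H D ⊙ₗ B'} (P : Presentation l l')

/-- The inclusion as a linear map. -/
def jLin : C →ₗ[k] B.X.carrier ⊗[k] B'.X.carrier := Hom.lin P.j

/-- The morphism `(V ⊗ X) ⊗ M → V ⊗ (X ⊗ M)`. -/
def vactActHom (V : Type u) [AddCommGroup V] [Module k V] (X : Comod k (DualBialg k H))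
    (M : DoiHopf k H C) : Comod.vact (V ⊗[k] X.carrier) M.toC ⟶ Comod.vact V (act X M).toC :=
  (Comod.vactAssocIso V X.carrier M.toC).hom

lemma vactActHom_naturality {V V' : Type u} [AddCommGroup V] [Module k V] [AddCommGroup V']
    [Module k V'] (X : Comod k (DualBialg k H)) (M : DoiHopf k H C) (f : V →ₗ[k] V') :
    Comod.vactMap (f.rTensor X.carrier) (𝟙 M.toC) ≫ vactActHom V' X M =
      vactActHom V X M ≫ Comod.vactMap f (𝟙 (act X M).toC) :=
  Comod.hom_ext (TensorProduct.ext_threefold fun _ _ _ => rfl)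

/-- Compatibility of `theta` with associativity. -/
lemma theta_act (Y : Comod k H) (V : Type u) [AddCommGroup V] [Module k V]
    (X : Comod k (DualBialg k H)) (M : DoiHopf k H C) :
    theta Y (V ⊗[k] X.carrier) M ≫
      Comod.vactMap (mixedCoact V Y (TensorProduct.lift X.hact)) (𝟙 M.toC) ≫
        vactActHom (Y.carrier ⊗[k] V) X M =
      Y ⊴ₗ vactActHom V X M ≫ theta Y V (act X M) := by
  exact Comod.hom_ext (mixedCoact_diag V Y (lift_hact_act X M.X))

/-- The functoriality of `V ⊗ M` in a comodule `V`. -/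
def vactLeft {E : Type u} [AddCommGroup E] [Module k E] [Coalgebra k E] {V V' : Comod k E}
    (f : V ⟶ V') (M : Comod k C) : Comod.vact V.carrier M ⟶ Comod.vact V'.carrier M :=
  Comod.vactMap (Comod.Hom.lin f) (𝟙 M)

lemma vactLeft_comp_assoc {E : Type u} [AddCommGroup E] [Module k E] [Coalgebra k E]
    {V V' V'' : Comod k E} (f : V ⟶ V') (g : V' ⟶ V'') (M : Comod k C) {T : Comod k C}
    (s : Comod.vact V''.carrier M ⟶ T) :
    vactLeft (f ≫ g) M ≫ s = vactLeft f M ≫ vactLeft g M ≫ s := by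
  rw [← Category.assoc]
  exact congrArg (fun t => t ≫ s) (Comod.hom_ext (TensorProduct.ext' fun _ _ => rfl))

variable (B B') in
/-- The morphism `(V ⊗ B) ⊗ B' → V ⊗ (B ⊗ B')`. -/
def vactAct (V : Comod k C) : Comod.vact (Comod.vact V.carrier B.toC).carrier B'.toC ⟶
    Comod.vact V.carrier (act B.X B').toC := vactActHom V.carrier B.X B'

variable (B B') in
lemma vactAct_naturality {V V' : Comod k C} (f : V ⟶ V') :
    vactLeft (vactLeft f B.toC) B'.toC ≫ vactAct B B' V' =
      vactAct B B' V ≫ vactLeft f (act B.X B').toC :=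
  vactActHom_naturality B.X B' (Comod.Hom.lin f)

variable (l l') in
/-- The inclusion `(V □ B) □ B' → V ⊗ (B ⊗ B')`. -/
def incl (V : Comod k C) : cotensor l' (cotensor l V) ⟶
    Comod.vact V.carrier (act B.X B').toC :=
  cotι l' (cotensor l V) ≫ vactLeft (cotι l V) B'.toC ≫ vactAct B B' V

end Presentation

/-- The coaction as a morphism of comodules. -/
def coactHom (V : Comod k C) : V ⟶ Comod.vact V.carrier (regular k H C).toC where
  lin := V.coact
  colinear := by
    have h1 := congrArg
      (fun f => (TensorProduct.assoc k V.carrier C C).symm.toLinearMap ∘ₗ f) V.coassoc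
    simp only [← LinearMap.comp_assoc, LinearEquiv.symm_comp, LinearMap.id_comp] at h1
    exact h1.symm

namespace Presentation

variable {B : DoiHopf k H D} {B' : DoiHopf k H C} {l : B ⟶ Comod.ofMod k H C ⊙ₗ B}
  {l' : B' ⟶ Comod.ofMod k H D ⊙ₗ B'} (P : Presentation l l')

/-- The morphism `V → V ⊗ (B ⊗ B')`, `v ↦ v₍₀₎ ⊗ j(v₍₁₎)`. -/
def phi (V : Comod k C) : V ⟶ Comod.vact V.carrier (act B.X B').toC :=
  coactHom (H := H) V ≫ Comod.vactMap LinearMap.id (Hom.toC P.j)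

lemma lTensor_jLin_injective (W : Type u) [AddCommGroup W] [Module k W] :
    Function.Injective (P.jLin.lTensor W) :=
  Module.Flat.lTensor_preserves_injective_linearMap _ P.injective

lemma phi_injective (V : Comod k C) : Function.Injective (Comod.Hom.lin (P.phi V)) :=
  (P.lTensor_jLin_injective V.carrier).comp V.coact_injective

lemma incl_injective (V : Comod k C) : Function.Injective (Comod.Hom.lin (incl l l' V)) :=
  (TensorProduct.assoc k V.carrier B.X.carrier B'.X.carrier).injective.comp
    ((Module.Flat.rTensor_preserves_injective_linearMap (M := B'.X.carrier) _
      (cotι_injective l V)).comp (cotι_injective l' (cotensor l V)))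

/-- Over `C` this is coassociativity of `V`, transferred along `j`; over `D` it holds because `j`
lands in the cotensor product of `B` and `B'`. -/
lemma isBalanced_phi (V : Comod k C) (v : V.carrier) :
    IsBalanced V.coact (coLin l) B.ρ (coLin l') (P.jLin.lTensor V.carrier (V.coact v)) where
  left := (lTensor_coaction_iff V.coact P.injective P.comul (V.coact v)).2
    ((LinearEquiv.eq_symm_apply _).2 (LinearMap.congr_fun V.coassoc v))
  right := lTensor_apply_eq P.comp_ρ _

/-- The condition over `D` and flatness write `t` as `(V ⊗ j)(s)`; the condition over `C` then says
that `s` satisfies the equalizer condition, so it is the coaction of an element, obtained by the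
counit. -/
lemma exists_phi (V : Comod k C) (t : V.carrier ⊗[k] (B.X.carrier ⊗[k] B'.X.carrier))
    (ht : IsBalanced V.coact (coLin l) B.ρ (coLin l') t) :
    ∃ v, Comod.Hom.lin (P.phi V) v = t := by
  obtain ⟨s, rfl⟩ := exists_lTensor V.carrier _ _ P.jLin P.exists_j P.comp_ρ t ht.right
  exact ⟨_, congrArg (P.jLin.lTensor V.carrier) (V.coact_counit_eq s
    ((lTensor_coaction_iff V.coact P.injective P.comul s).1 ht.left))⟩

variable (l l') in
lemma isBalanced_cotι (V : Comod k C) (s : (cotensor l V).carrier ⊗[k] B'.X.carrier) :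
    IsBalanced V.coact (coLin l) B.ρ (coLin l') (TensorProduct.assoc k V.carrier B.X.carrier
      B'.X.carrier ((Comod.Hom.lin (cotι l V)).rTensor B'.X.carrier s)) ↔
    Comod.Hom.lin (cotLeft B' (cotensor l V)) s =
      Comod.Hom.lin (cotRight l' (cotensor l V).carrier) s :=
  isBalanced_iff (coLin l') (cotι_injective l V) (congrArg Comod.Hom.lin (cotι_condition l V))
    (Comod.Hom.colinear (cotι l V)) s

variable (l l') in
lemma isBalanced_incl (V : Comod k C) (x : (cotensor l' (cotensor l V)).carrier) :
    IsBalanced V.coact (coLin l) B.ρ (coLin l') (Comod.Hom.lin (incl l l' V) x) :=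
  (isBalanced_cotι l l' V _).2
    (LinearMap.congr_fun (congrArg Comod.Hom.lin (cotι_condition l' (cotensor l V))) x)

-- The condition over `C` and flatness place `t` in `(V □ B) ⊗ B'`, and the condition over `D` then
-- places it in the second cotensor product. So `V` and `(V □ B) □ B'` have the same image in `V ⊗
-- (B ⊗ B')`, the set of balanced elements.
variable (l l') in
lemma exists_incl (V : Comod k C) (t : V.carrier ⊗[k] (B.X.carrier ⊗[k] B'.X.carrier))
    (ht : IsBalanced V.coact (coLin l) B.ρ (coLin l') t) :
    ∃ x, Comod.Hom.lin (incl l l' V) x = t := by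
  obtain ⟨t, rfl⟩ := (TensorProduct.assoc k V.carrier B.X.carrier B'.X.carrier).surjective t
  obtain ⟨s, rfl⟩ := exists_rTensor_eqLocus B'.X.carrier _ _ t ((balanced_left_iff _ _ t).1 ht.left)
  obtain ⟨x, rfl⟩ := Comod.exists_eqzι (cotLeft B' (cotensor l V))
    (cotRight l' (cotensor l V).carrier) s ((isBalanced_cotι l l' V s).1 ht)
  exact ⟨x, rfl⟩

/-- The isomorphism `(V □ B) □ B' ≅ V`. -/
def iso (V : Comod k C) : cotensor l' (cotensor l V) ≅ V :=
  Comod.isoOfRange (incl l l' V) (P.phi V) (incl_injective V) (P.phi_injective V)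
    (fun x => P.exists_phi V _ (isBalanced_incl l l' V x))
    (fun v => exists_incl l l' V _ (P.isBalanced_phi V v))

lemma iso_comp (V : Comod k C) : (P.iso V).hom ≫ P.phi V = incl l l' V :=
  Comod.isoOfRange_comp _ _ _ _ _ _

lemma hom_ext_phi {T V : Comod k C} {f g : T ⟶ V} (h : f ≫ P.phi V = g ≫ P.phi V) : f = g :=
  Comod.hom_ext_of_injective (P.phi_injective V) h

variable (l l') in
lemma incl_naturality {V V' : Comod k C} (f : V ⟶ V') :
    cotMap l' (cotMap l f) ≫ incl l l' V' = incl l l' V ≫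
      vactLeft f (act B.X B').toC := by
  have h1 : cotMap l' (cotMap l f) ≫ cotι l' (cotensor l V') =
    cotι l' (cotensor l V) ≫ vactLeft (cotMap l f) B'.toC := cotMap_ι l' (cotMap l f)
  have h2 : cotMap l f ≫ cotι l V' = cotι l V ≫ vactLeft f B.toC := cotMap_ι l f
  rw [incl, incl, reassoc_of% h1, ← vactLeft_comp_assoc, h2, vactLeft_comp_assoc,
    vactAct_naturality, Category.assoc, Category.assoc]

lemma phi_naturality {V V' : Comod k C} (f : V ⟶ V') :
    f ≫ P.phi V' = P.phi V ≫
      vactLeft f (act B.X B').toC := by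
  have h1 : V'.coact ∘ₗ Comod.Hom.lin f = (Comod.Hom.lin f).rTensor C ∘ₗ V.coact :=
    Comod.Hom.colinear f
  refine Comod.hom_ext (LinearMap.ext fun v => ?_)
  have h2 := LinearMap.congr_fun h1 v
  refine (congrArg (P.jLin.lTensor V'.carrier) h2).trans ?_
  exact LinearMap.congr_fun ((LinearMap.lTensor_comp_rTensor _ _ _).trans
    (LinearMap.rTensor_comp_lTensor _ _ _).symm) (V.coact v)

/-- The isomorphism of functors. -/
def natIso : cotFunctor l ⋙ cotFunctor l' ≅ 𝟭 (Comod k C) :=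
  NatIso.ofComponents P.iso (fun {V V'} f => P.hom_ext_phi (by
    have h1 := incl_naturality l l' f
    have h2 := P.phi_naturality f
    calc (cotMap l' (cotMap l f) ≫ (P.iso V').hom) ≫ P.phi V' = _ := by
          rw [Category.assoc, iso_comp, h1, ← iso_comp P, Category.assoc, ← h2]
          rfl
      _ = _ := (Category.assoc _ _ _).symm))

variable (l l') in
lemma incl_μ (Y : Comod k H) (V : Comod k C) :
    (cotμ l' Y (cotensor l V) ≫ cotMap l' (cotμ l Y V)) ≫ incl l l' (Y ⊙ₗ V) =
      Y ⊴ₗ incl l l' V ≫ cotTheta (act B.X B') Y V := by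
  have h1 : cotTheta B' Y (Comod.vact V.carrier B.toC) ≫ vactLeft (cotTheta B Y V) B'.toC ≫
        vactAct B B' (Y ⊙ₗ V) = Y ⊴ₗ vactAct B B' V ≫ cotTheta (act B.X B') Y V :=
    theta_act Y V.carrier B.X B'
  have h2 : cotMap l' (cotμ l Y V) ≫ cotι l' (cotensor l (Y ⊙ₗ V)) =
    cotι l' (Y ⊙ₗ cotensor l V) ≫ vactLeft (cotμ l Y V) B'.toC := cotMap_ι l' (cotμ l Y V)
  have h3 : Y ⊴ₗ vactLeft (cotι l V) B'.toC ≫ cotTheta B' Y (Comod.vact V.carrier B.toC) =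
      cotTheta B' Y (cotensor l V) ≫ vactLeft (Y ⊴ₗ cotι l V) B'.toC :=
    cotTheta_naturality_right B' Y (cotι l V)
  rw [incl, incl, Category.assoc, reassoc_of% h2, ← vactLeft_comp_assoc, cotμ_ι,
    vactLeft_comp_assoc, reassoc_of% cotμ_ι l' Y (cotensor l V), ← reassoc_of% h3, h1,
    actionHomRight_comp, actionHomRight_comp, Category.assoc, Category.assoc]

/-- For the regular Doi–Hopf module, `theta` after the coaction of `V` is the coaction of `Y ⊗ V`;
since `j` is `H`-linear, `theta` is natural along it. -/
lemma phi_act (Y : Comod k H) (V : Comod k C) :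
    P.phi (Y ⊙ₗ V) = Y ⊴ₗ P.phi V ≫ cotTheta (act B.X B') Y V := by
  have h1 : Y ⊴ₗ Comod.vactMap LinearMap.id (Hom.toC P.j) ≫ cotTheta (act B.X B') Y V =
      cotTheta (regular k H C) Y V ≫
        Comod.vactMap (LinearMap.id (M := (Y ⊙ₗ V).carrier)) (Hom.toC P.j) :=
    (theta_naturality_right Y LinearMap.id P.j).trans (congrArg (fun g =>
      theta Y V.carrier (regular k H C) ≫ Comod.vactMap g (Hom.toC P.j))
        (LinearMap.lTensor_id Y.carrier V.carrier))
  have h2 : Y ⊴ₗ coactHom V ≫ cotTheta (regular k H C) Y V = coactHom (H := H) (Y ⊙ₗ V) := by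
    refine Comod.hom_ext (Eq.trans ?_ (mixedCoact_act Y V))
    exact congrArg (fun a => mixedCoact V.carrier Y a ∘ₗ V.coact.lTensor Y.carrier)
      lift_hact_ofMod
  rw [phi, phi, actionHomRight_comp, Category.assoc, h1, reassoc_of% h2]

/-- After the injective `phi` both sides become the inclusion of `(V □ B) □ B'`, tensored with `Y`,
followed by `theta` (`incl_μ`, `phi_act`). -/
lemma isModuleNatTrans_natIso : IsModuleNatTrans (Comod k H) P.natIso.hom := by
  intro Y V
  refine P.hom_ext_phi ?_
  have h1 : (cotμ l' Y (cotensor l V) ≫ cotMap l' (cotμ l Y V)) ≫ (P.iso (Y ⊙ₗ V)).hom ≫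
      P.phi (Y ⊙ₗ V) = Y ⊴ₗ (P.iso V).hom ≫ P.phi (Y ⊙ₗ V) := by
    rw [iso_comp, incl_μ, phi_act, ← actionHomRight_comp_assoc, iso_comp]
  exact (Category.assoc _ _ _).trans
    (h1.trans (congrArg (fun f => f ≫ P.phi (Y ⊙ₗ V)) (Category.comp_id _).symm))

end Presentation

end DoiHopf

end

/-! ### From equivalences of Doi–Hopf modules back to comodules -/

section

open MonoidalLeftAction Functor.LaxLeftLinear

namespace DoiHopf

variable {k H C D : Type u} [Field k] [Ring H] [Bialgebra k H] [FiniteDimensional k H]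
    [AddCommGroup C] [Module k C] [Module H C] [IsScalarTower k H C] [Coalgebra k C]
    [IsModuleCoalgebra k H C]
    [AddCommGroup D] [Module k D] [Module H D] [IsScalarTower k H D]
    [Coalgebra k D] [IsModuleCoalgebra k H D]

lemma lin_bijective {M N : DoiHopf k H C} (f : M ⟶ N) [IsIso f] :
    Function.Bijective (Hom.lin f) :=
  Function.bijective_iff_has_inverse.2 ⟨Hom.lin (inv f),
    LinearMap.congr_fun (congrArg Hom.lin (IsIso.hom_inv_id f)),
    LinearMap.congr_fun (congrArg Hom.lin (IsIso.inv_hom_id f))⟩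

/-- A presentation of `C` from morphisms of Doi–Hopf modules. -/
def Presentation.ofHom {B : DoiHopf k H D} {B' : DoiHopf k H C}
    (l : B ⟶ (regular k H C).X ⊙ₗ B) (l' : B' ⟶ (regular k H D).X ⊙ₗ B')
    (j : regular k H C ⟶ B.X ⊙ₗ B')
    (injective : Function.Injective (Hom.lin j))
    (comp_ρ : j ≫ toAct B.free ⊵ₗ B' =
      j ≫ B.X ⊴ₗ l' ≫ (αₗ B.X (regular k H D).X B').inv)
    (exists_j : ∀ t, Hom.lin (toAct B.free ⊵ₗ B') t =
      Hom.lin (B.X ⊴ₗ l' ≫ (αₗ B.X (regular k H D).X B').inv) t → ∃ c, Hom.lin j c = t)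
    (comul : j ≫ toAct l ⊵ₗ B' = (regular k H C).free ≫ (regular k H C).X ⊴ₗ j ≫
      (αₗ (regular k H C).X B.X B').inv) : Presentation l l' where
  j := j
  injective := injective
  comp_ρ := congrArg Hom.lin comp_ρ
  exists_j := exists_j
  comul := LinearMap.ext fun c =>
    (LinearEquiv.eq_symm_apply (TensorProduct.assoc k C B.X.carrier B'.X.carrier)).1
      (LinearMap.congr_fun (congrArg Hom.lin comul) c)

section Equivalence

variable {F : DoiHopf k H C ⥤ DoiHopf k H D} {G : DoiHopf k H D ⥤ DoiHopf k H C}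
  [F.LaxLeftLinear (Comod k (DualBialg k H))] [G.LaxLeftLinear (Comod k (DualBialg k H))]
  [∀ (X : Comod k (DualBialg k H)) M, IsIso (μₗ F X M)]
  [∀ (X : Comod k (DualBialg k H)) M, IsIso (μₗ G X M)]

/-- The presentation of `C` given by an equivalence. -/
def presentation [G.IsEquivalence] (η : F ⋙ G ≅ 𝟭 (DoiHopf k H C))
    (hη : IsModuleNatTrans (Comod k (DualBialg k H)) η.hom) :
    Presentation (coactionMap F (regular k H C).free) (coactionMap G (regular k H D).free) :=
  have h := coactionMap_free_injective G (F.obj (regular k H C))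
  have h' : Function.Bijective (Hom.lin (η.inv.app (regular k H C))) := lin_bijective _
  Presentation.ofHom _ _ (unitTransport η) (h.1.comp h'.1)
    ((Category.assoc _ _ _).trans ((congrArg (fun f => η.inv.app (regular k H C) ≫ f)
      (coactionMap_free G (F.obj (regular k H C)))).trans (Category.assoc _ _ _).symm))
    (fun t ht => by
      obtain ⟨m, rfl⟩ := h.2 t ht
      obtain ⟨c, rfl⟩ := h'.2 m
      exact ⟨c, rfl⟩)
    (unitTransport_comul η hη)

end Equivalence

end DoiHopf

open DoiHopf in
lemma ModuleCategoryEquivalent.of_doiHopf {k H C D : Type u} [Field k] [Ring H] [Bialgebra k H]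
    [FiniteDimensional k H]
    [AddCommGroup C] [Module k C] [Module H C] [IsScalarTower k H C] [Coalgebra k C]
    [IsModuleCoalgebra k H C]
    [AddCommGroup D] [Module k D] [Module H D] [IsScalarTower k H D]
    [Coalgebra k D] [IsModuleCoalgebra k H D]
    (h : ModuleCategoryEquivalent (Comod k (DualBialg k H)) (DoiHopf k H C) (DoiHopf k H D)) :
    ModuleCategoryEquivalent (Comod k H) (Comod k C) (Comod k D) := by
  obtain ⟨F, G, _, _, η, ε, hη, hε⟩ := h
  have : F.IsEquivalence := (CategoryTheory.Equivalence.mk F G η.symm ε).isEquivalence_functor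
  have : G.IsEquivalence := (CategoryTheory.Equivalence.mk F G η.symm ε).isEquivalence_inverse
  -- Transporting the comultiplications to left coactions on `F(C)` and `G(D)` requires invertible
  -- structure morphisms.
  have : ∀ X M, IsIso (μₗ F X M) := isIso_μₗ F G η ε hη hε
  have : ∀ X M, IsIso (μₗ G X M) := isIso_μₗ G F ε η hε hη
  -- The functors are the cotensor products with `F(C)` and `G(D)`; the presentation from `η`
  -- handles one composite, and the one from `ε`, with the roles of `C` and `D` exchanged, the
  -- other.
  exact ⟨cotFunctor _, cotFunctor _, inferInstance, inferInstance, (presentation η hη).natIso,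
    (presentation ε hε).natIso, (presentation η hη).isModuleNatTrans_natIso,
    (presentation ε hε).isModuleNatTrans_natIso⟩

end

end MoritaTakeuchi

end

theorem mainTheorem10 {k H : Type u} [Field k] [Ring H] [Bialgebra k H] [FiniteDimensional k H]
    (C D : Type u)
    [AddCommGroup C] [Module k C] [Module H C] [IsScalarTower k H C] [Coalgebra k C]
    [MoritaTakeuchi.IsModuleCoalgebra k H C]
    [AddCommGroup D] [Module k D] [Module H D] [IsScalarTower k H D] [Coalgebra k D]
    [MoritaTakeuchi.IsModuleCoalgebra k H D] :
    MoritaTakeuchi.HMoritaTakeuchi k H C D ↔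
      MoritaTakeuchi.HMoritaTakeuchi k (MoritaTakeuchi.DualBialg k H)
        (MoritaTakeuchi.Cosmash k H C) (MoritaTakeuchi.Cosmash k H D) := by
  have hC := MoritaTakeuchi.DoiHopf.moduleCategoryEquivalent_cosmash k H C
  have hD := MoritaTakeuchi.DoiHopf.moduleCategoryEquivalent_cosmash k H D
  exact ⟨fun h => (hC.symm.trans
    (MoritaTakeuchi.ModuleCategoryEquivalent.doiHopf h)).trans hD,
    fun h => MoritaTakeuchi.ModuleCategoryEquivalent.of_doiHopf
      ((hC.trans h).trans hD.symm)⟩
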